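/- Let $H$ be a Hopf algebra over a field $\Bbbk$, with comultiplication $h\mapsto h_{(1)}\otimes h_{(2)}$, counit $\varepsilon_H$ and antipode $\mathcal S$. A (left-left) Yetter–Drinfeld module over $H$ is a $\Bbbk$-vector space $V$ with a left $H$-action and a left $H$-coaction $v\mapsto v_{(-1)}\otimes v_{(0)}$ such that $$(h\cdot v)_{(-1)}\otimes (h\cdot v)_{(0)}=h_{(1)}v_{(-1)}\mathcal S(h_{(3)})\otimes h_{(2)}\cdot v_{(0)};$$ morphisms are the linear and colinear maps. With $\otimes=\otimes_\Bbbk$ (diagonal action and codiagonal coaction) and the unit object $\Bbbk$ they form a monoidal category ${}^H_H\mathcal{YD}$, and we use the maps $c_{V,W}:V\otimes W\to W\otimes V$, $c_{V,W}(v\otimes w)=v_{(-1)}\cdot w\otimes v_{(0)}$, which form a braiding when $\mathcal S$ is bijective. Let $A$ be a bimonoid in $({}^H_H\mathcal{YD},\otimes,\Bbbk,c)$, that is, a monoid $(A,\mu,\eta)$ and comonoid $(A,\Delta,\varepsilon)$ in ${}^H_H\mathcal{YD}$ with $\Delta\mu=(\mu\otimes\mu)(\mathrm{id}\otimes c_{A,A}\otimes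 \mathrm{id})(\Delta\otimes\Delta)$, $\Delta\eta=\eta\otimes\eta$, $\varepsilon\mu=\varepsilon\otimes\varepsilon$ and $\varepsilon\eta=\mathrm{id}_\Bbbk$. Let $S_\bullet(A)$ be the chain complex in ${}^H_H\mathcal{YD}$ with $S_n(A)=A^{\otimes n}$ and differential $\delta_n=\sum_{i=0}^{n+1}(-1)^i\partial_i:S_{n+1}(A)\to S_n(A)$, where $\partial_0$ applies $\varepsilon$ to the first factor, $\partial_{n+1}$ applies $\varepsilon$ to the last factor, and $\partial_i$ for $1\le i\le n$ multiplies the $i$-th and $(i+1)$-st factors. On the cochain complex $\mathrm{Hom}_\Bbbk(S_\bullet(A),\Bbbk)$, with differential $f\mapsto f\circ\delta$, the cup product of $f\in\mathrm{Hom}_\Bbbk(S_p(A),\Bbbk)$ and $g\in\mathrm{Hom}_\Bbbk(S_q(A),\Bbbk)$ is $(f\cup g)(x\otimes y)=f(x)g(y)$ for $x\in A^{\otimes p}$, $y\in A^{\otimes q}$, and the opposite cup product is $f\cdot g=(-1)^{pq}\,g\cup f$. **Theorem.** Suppose that $H$ is finite dimensional, or that $A$ is finite dimensional and $\mathcal S$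 is bijective. Then: 1. For every $n$ the vector space $\mathrm{Hom}_\Bbbk(S_n(A),\Bbbk)$ carries a Yetter–Drinfeld structure which makes it, with the evaluation map $\mathrm{Hom}_\Bbbk(S_n(A),\Bbbk)\otimes S_n(A)\to\Bbbk$, the internal hom $\hom(S_n(A),\Bbbk)$ of ${}^H_H\mathcal{YD}$: evaluation is a morphism, and every morphism $X\otimes S_n(A)\to\Bbbk$ of ${}^H_H\mathcal{YD}$ factors through it by a unique morphism $X\to \mathrm{Hom}_\Bbbk(S_n(A),\Bbbk)$. 2. With these structures, the differential $f\mapsto f\circ\delta$, the opposite cup product and the unit $\mathrm{id}_\Bbbk\in\mathrm{Hom}_\Bbbk(S_0(A),\Bbbk)$, $C=\mathrm{Hom}_\Bbbk(S_\bullet(A),\Bbbk)$ is a differential graded algebra in ${}^H_H\mathcal{YD}$, i.e. a monoid in the monoidal category of cochain complexes in ${}^H_H\mathcal{YD}$, where the differential of $K\otimes L$ is $d\otimes 1+(-1)^p\,1\otimes d$ on $K^p\otimes L^q$. 3. $C$ is graded braided commutative up to homotopy: let $m:C\otimes C\to C$ be the product and let $c^{gr}:C\otimes C\to C\otimes C$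 be the morphism of complexes equal to $(-1)^{pq}c_{C^p,C^q}$ on $C^p\otimes C^q$. Then $m\circ c^{gr}$ and $m$ are homotopic as morphisms of cochain complexes in ${}^H_H\mathcal{YD}$ (the homotopy consists of morphisms of Yetter–Drinfeld modules). -/

import Mathlib

open CategoryTheory MonoidalCategory Limits
open scoped TensorProduct

universe u v

namespace YetterDrinfeld

section Operators

variable (k : Type u) [Field k] {H : Type v} [Ring H] [HopfAlgebra k H]
  {V : Type u} [AddCommGroup V] [Module k V]

/-- The diagonal left action `h · (x ⊗ v) = h₍₁₎ x ⊗ h₍₂₎ · v` of `H` on `H ⊗ V`. -/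
noncomputable def diag (ρ : H →ₐ[k] Module.End k V) : H →ₐ[k] Module.End k (H ⊗[k] V) :=
  (Module.endTensorEndAlgHom (R := k) (S := k) (A := k) (M := H) (N := V)).comp
    ((Algebra.TensorProduct.map (Algebra.lmul k H) ρ).comp (Bialgebra.comulAlgHom k H))

variable (V) in
/-- Right multiplication on the first factor: `h ↦ (x ⊗ v ↦ x h ⊗ v)`. -/
noncomputable def rightMul : H →ₗ[k] Module.End k (H ⊗[k] V) :=
  LinearMap.rTensorHom V ∘ₗ (LinearMap.mul k H).flip

/-- The map `h ↦ (x ⊗ v ↦ h₍₁₎ x S(h₍₃₎) ⊗ h₍₂₎ · v)`. -/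
noncomputable def twist (ρ : H →ₐ[k] Module.End k V) : H →ₗ[k] Module.End k (H ⊗[k] V) :=
  LinearMap.mul' k (Module.End k (H ⊗[k] V)) ∘ₗ
    TensorProduct.map (diag k ρ).toLinearMap (rightMul k V ∘ₗ HopfAlgebra.antipode k) ∘ₗ
      Coalgebra.comul

/-- The map `a ⊗ b ↦ (v ↦ (a · v)₍₋₁₎ b ⊗ (a · v)₍₀₎)`. -/
noncomputable def sweep (ρ : H →ₐ[k] Module.End k V) (δ : V →ₗ[k] H ⊗[k] V) :
    H ⊗[k] H →ₗ[k] V →ₗ[k] H ⊗[k] V :=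
  TensorProduct.lift (((LinearMap.llcomp k V (H ⊗[k] V) (H ⊗[k] V)).flip ∘ₗ
    (LinearMap.llcomp k V V (H ⊗[k] V) δ) ∘ₗ ρ.toLinearMap).compl₂ (rightMul k V))

@[simp] lemma rightMul_tmul (h x : H) (v : V) : rightMul k V h (x ⊗ₜ v) = (x * h) ⊗ₜ[k] v := rfl

@[simp] lemma sweep_tmul (ρ : H →ₐ[k] Module.End k V) (δ : V →ₗ[k] H ⊗[k] V) (a b : H) (v : V) :
    sweep k ρ δ (a ⊗ₜ b) v = rightMul k V b (δ (ρ a v)) := rfl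

lemma rightMul_mul (a b : H) (x : H ⊗[k] V) :
    rightMul k V b (rightMul k V a x) = rightMul k V (a * b) x := by
  induction x with
  | zero => simp
  | add x y hx hy => simp [hx, hy]
  | tmul x y => simp [mul_assoc]

@[simp] lemma rightMul_one (x : H ⊗[k] V) : rightMul k V (1 : H) x = x := by
  induction x with
  | zero => simp
  | add x y hx hy => simp [hx, hy]
  | tmul x y => simp

lemma diag_apply_tmul (ρ : H →ₐ[k] Module.End k V) (h x : H) (v : V) :
    diag k ρ h (x ⊗ₜ v) = TensorProduct.map ((LinearMap.mul k H).flip x)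
      (ρ.toLinearMap.flip v) (Coalgebra.comul h) := by
  simp only [diag, AlgHom.comp_apply, Bialgebra.comulAlgHom_apply]
  generalize (Coalgebra.comul h : H ⊗[k] H) = t
  induction t with
  | zero => simp
  | add x y hx hy => simp [hx, hy]
  | tmul a b => simp [Module.endTensorEndAlgHom_apply]

lemma rightMul_diag (ρ : H →ₐ[k] Module.End k V) (a b : H) (x : H ⊗[k] V) :
    rightMul k V b (diag k ρ a x) = diag k ρ a (rightMul k V b x) := by
  induction x with
  | zero => simp
  | add x y hx hy => simp [hx, hy]
  | tmul x y =>
    simp only [diag_apply_tmul, rightMul_tmul]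
    generalize (Coalgebra.comul a : H ⊗[k] H) = t
    induction t with
    | zero => simp
    | add x y hx hy => simp only [map_add, hx, hy]
    | tmul a b => simp [mul_assoc]

/-- The compatibility written with the antipode is equivalent to the one without it,
`(h₍₁₎ v)₍₋₁₎ h₍₂₎ ⊗ (h₍₁₎ v)₍₀₎ = h₍₁₎ v₍₋₁₎ ⊗ h₍₂₎ v₍₀₎`. -/
lemma compat_iff (ρ : H →ₐ[k] Module.End k V) (δ : V →ₗ[k] H ⊗[k] V) :
    (∀ h v, δ (ρ h v) = twist k ρ h (δ v)) ↔
      ∀ h v, sweep k ρ δ (Coalgebra.comul h) v = diag k ρ h (δ v) := by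
  constructor
  · intro hc h v
    let F : H ⊗[k] (H ⊗[k] H) →ₗ[k] H ⊗[k] V :=
      TensorProduct.lift (LinearMap.compl₂
        (((LinearMap.llcomp k H (H ⊗[k] V) (H ⊗[k] V)).flip ((rightMul k V).flip (δ v)))
          ∘ₗ (diag k ρ).toLinearMap)
        (LinearMap.mul' k H ∘ₗ TensorProduct.map (HopfAlgebra.antipode k) LinearMap.id))
    have e1 : (sweep k ρ δ).flip v =
        F ∘ₗ (TensorProduct.assoc k H H H).toLinearMap ∘ₗ
          (Coalgebra.comul (R := k) (A := H)).rTensor H := by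
      ext a b
      simp only [TensorProduct.AlgebraTensorModule.curry_apply, TensorProduct.curry_apply,
        LinearMap.coe_restrictScalars, LinearMap.flip_apply, sweep_tmul, LinearMap.comp_apply,
        LinearMap.rTensor_tmul, hc, twist]
      generalize (Coalgebra.comul a : H ⊗[k] H) = t
      induction t with
      | zero => simp
      | add x y hx hy => simp only [map_add, TensorProduct.add_tmul, LinearMap.add_apply, hx, hy]
      | tmul a c => simp [F, rightMul_diag, rightMul_mul]
    have e2 : F ∘ₗ (Coalgebra.comul (R := k) (A := H)).lTensor H =
        ((diag k ρ).toLinearMap.flip (δ v)) ∘ₗ (TensorProduct.rid k H).toLinearMap ∘ₗ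
          (Coalgebra.counit (R := k) (A := H)).lTensor H := by
      ext a b
      have := HopfAlgebra.mul_antipode_rTensor_comul_apply (R := k) b
      simp only [LinearMap.rTensor] at this
      simp [F, this, Algebra.algebraMap_eq_smul_one]
    have h1 := LinearMap.congr_fun e1 (Coalgebra.comul h)
    have h2 := LinearMap.congr_fun e2 (Coalgebra.comul h)
    simp only [LinearMap.flip_apply, LinearMap.comp_apply, LinearEquiv.coe_coe,
      Coalgebra.coassoc_apply, Coalgebra.lTensor_counit_comul] at h1 h2
    rw [h1, h2]
    simp
  · intro hs h v
    let F : H ⊗[k] (H ⊗[k] H) →ₗ[k] H ⊗[k] V :=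
      TensorProduct.lift (LinearMap.compl₂
        ((LinearMap.llcomp k H (Module.End k (H ⊗[k] V)) (H ⊗[k] V)).flip (rightMul k V)
          ∘ₗ LinearMap.applyₗ ∘ₗ δ ∘ₗ ρ.toLinearMap.flip v)
        (LinearMap.mul' k H ∘ₗ TensorProduct.map LinearMap.id (HopfAlgebra.antipode k)))
    have e1 : (LinearMap.mul' k (Module.End k (H ⊗[k] V)) ∘ₗ
        TensorProduct.map (diag k ρ).toLinearMap (rightMul k V ∘ₗ HopfAlgebra.antipode k)).flip
          (δ v) =
        F ∘ₗ (TensorProduct.assoc k H H H).toLinearMap ∘ₗ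
          (Coalgebra.comul (R := k) (A := H)).rTensor H := by
      ext a b
      have := hs a v
      simp only [TensorProduct.AlgebraTensorModule.curry_apply, TensorProduct.curry_apply,
        LinearMap.coe_restrictScalars, LinearMap.flip_apply, LinearMap.comp_apply,
        LinearMap.rTensor_tmul, TensorProduct.map_tmul, LinearMap.mul'_apply,
        AlgHom.toLinearMap_apply, Module.End.mul_apply, ← rightMul_diag, ← this]
      generalize (Coalgebra.comul a : H ⊗[k] H) = t
      induction t with
      | zero => simp
      | add x y hx hy => simp only [map_add, TensorProduct.add_tmul, LinearMap.add_apply, hx, hy]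
      | tmul a c => simp [F, rightMul_mul]
    have e2 : F ∘ₗ (Coalgebra.comul (R := k) (A := H)).lTensor H =
        (δ ∘ₗ ρ.toLinearMap.flip v) ∘ₗ (TensorProduct.rid k H).toLinearMap ∘ₗ
          (Coalgebra.counit (R := k) (A := H)).lTensor H := by
      ext a b
      have := HopfAlgebra.mul_antipode_lTensor_comul_apply (R := k) b
      simp only [LinearMap.lTensor] at this
      simp [F, this, Algebra.algebraMap_eq_smul_one]
    have h1 := LinearMap.congr_fun e1 (Coalgebra.comul h)
    have h2 := LinearMap.congr_fun e2 (Coalgebra.comul h)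
    simp only [LinearMap.flip_apply, LinearMap.comp_apply, LinearEquiv.coe_coe,
      Coalgebra.coassoc_apply, Coalgebra.lTensor_counit_comul] at h1 h2
    simp only [twist, LinearMap.comp_apply]
    rw [h1, h2]
    simp

end Operators

section TensorCoaction

variable (k : Type u) [Field k] {H : Type v} [Ring H] [HopfAlgebra k H]
  {V W X : Type u} [AddCommGroup V] [Module k V] [AddCommGroup W] [Module k W]
  [AddCommGroup X] [Module k X]

/-- The diagonal action `h · (v ⊗ w) = h₍₁₎ · v ⊗ h₍₂₎ · w` on a tensor product. -/
noncomputable def tensorAct (ρ : H →ₐ[k] Module.End k V) (σ : H →ₐ[k] Module.End k W) :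
    H →ₐ[k] Module.End k (V ⊗[k] W) :=
  (Module.endTensorEndAlgHom (R := k) (S := k) (A := k) (M := V) (N := W)).comp
    ((Algebra.TensorProduct.map ρ σ).comp (Bialgebra.comulAlgHom k H))

/-- The map `(x ⊗ v) ⊗ (y ⊗ w) ↦ x y ⊗ (v ⊗ w)`. -/
noncomputable def merge (B : Type*) [Ring B] [Algebra k B] (V W : Type u) [AddCommGroup V]
    [Module k V] [AddCommGroup W] [Module k W] :
    (B ⊗[k] V) ⊗[k] (B ⊗[k] W) →ₗ[k] B ⊗[k] (V ⊗[k] W) :=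
  (LinearMap.mul' k B).rTensor (V ⊗[k] W) ∘ₗ
    (TensorProduct.tensorTensorTensorComm k B V B W).toLinearMap

/-- The codiagonal coaction `v ⊗ w ↦ v₍₋₁₎ w₍₋₁₎ ⊗ (v₍₀₎ ⊗ w₍₀₎)` on a tensor product. -/
noncomputable def tensorCoact (δ : V →ₗ[k] H ⊗[k] V) (γ : W →ₗ[k] H ⊗[k] W) :
    V ⊗[k] W →ₗ[k] H ⊗[k] (V ⊗[k] W) :=
  merge k H V W ∘ₗ TensorProduct.map δ γ

/-- The map `v ⊗ w ↦ v₍₋₁₎ · w ⊗ v₍₀₎`. -/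
noncomputable def braidLin (δ : V →ₗ[k] H ⊗[k] V) (σ : H →ₐ[k] Module.End k W) :
    V ⊗[k] W →ₗ[k] W ⊗[k] V :=
  (TensorProduct.lift σ.toLinearMap).rTensor V ∘ₗ
    (TensorProduct.assoc k H W V).symm.toLinearMap ∘ₗ
      (TensorProduct.comm k V W).toLinearMap.lTensor H ∘ₗ
        (TensorProduct.assoc k H V W).toLinearMap ∘ₗ δ.rTensor W

@[simp] lemma merge_tmul (B : Type*) [Ring B] [Algebra k B] (x y : B) (v : V) (w : W) :
    merge k B V W ((x ⊗ₜ v) ⊗ₜ (y ⊗ₜ w)) = (x * y) ⊗ₜ[k] (v ⊗ₜ[k] w) := rfl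

@[simp] lemma tensorCoact_tmul (δ : V →ₗ[k] H ⊗[k] V) (γ : W →ₗ[k] H ⊗[k] W) (v : V) (w : W) :
    tensorCoact k δ γ (v ⊗ₜ w) = merge k H V W (δ v ⊗ₜ γ w) := rfl

lemma tensorAct_tmul (ρ : H →ₐ[k] Module.End k V) (σ : H →ₐ[k] Module.End k W) (h : H)
    (v : V) (w : W) :
    tensorAct k ρ σ h (v ⊗ₜ w) = TensorProduct.map (ρ.toLinearMap.flip v) (σ.toLinearMap.flip w)
      (Coalgebra.comul h) := by
  simp only [tensorAct, AlgHom.comp_apply, Bialgebra.comulAlgHom_apply]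
  generalize (Coalgebra.comul h : H ⊗[k] H) = t
  induction t with
  | zero => simp
  | add x y hx hy => simp [hx, hy]
  | tmul a b => simp [Module.endTensorEndAlgHom_apply]

lemma rightMul_merge (h : H) (x : H ⊗[k] V) (y : H ⊗[k] W) :
    rightMul k (V ⊗[k] W) h (merge k H V W (x ⊗ₜ y)) =
      merge k H V W (x ⊗ₜ rightMul k W h y) := by
  induction x with
  | zero => simp
  | add x x' hx hx' => simp only [map_add, TensorProduct.add_tmul, hx, hx']
  | tmul a v =>
    induction y with
    | zero => simp
    | add y y' hy hy' => simp only [map_add, TensorProduct.tmul_add, hy, hy']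
    | tmul b w => simp [mul_assoc]

lemma merge_diag (σ : H →ₐ[k] Module.End k W) (h : H) (x : H ⊗[k] V) (y : H ⊗[k] W) :
    merge k H V W (x ⊗ₜ diag k σ h y) =
      (merge k H V W ∘ₗ TensorProduct.map ((rightMul k V).flip x)
        ((LinearMap.lTensorHom H ∘ₗ σ.toLinearMap).flip y)) (Coalgebra.comul h) := by
  induction x with
  | zero => simp
  | add x x' hx hx' =>
    simp only [map_add, TensorProduct.add_tmul, hx, hx', LinearMap.comp_apply,
      TensorProduct.map_add_left, LinearMap.add_apply]
  | tmul a v =>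
    induction y with
    | zero => simp
    | add y y' hy hy' =>
      simp only [map_add, TensorProduct.tmul_add, hy, hy', LinearMap.comp_apply,
        TensorProduct.map_add_right, LinearMap.add_apply]
    | tmul b w =>
      rw [diag_apply_tmul]
      generalize (Coalgebra.comul h : H ⊗[k] H) = t
      induction t with
      | zero => simp
      | add x y hx hy => simp only [map_add, TensorProduct.tmul_add, hx, hy]
      | tmul c d => simp [mul_assoc]

lemma diag_merge (ρ : H →ₐ[k] Module.End k V) (σ : H →ₐ[k] Module.End k W) (h : H)
    (x : H ⊗[k] V) (y : H ⊗[k] W) :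
    diag k (tensorAct k ρ σ) h (merge k H V W (x ⊗ₜ y)) =
      (merge k H V W ∘ₗ TensorProduct.map ((diag k ρ).toLinearMap.flip x)
        ((LinearMap.lTensorHom H ∘ₗ σ.toLinearMap).flip y)) (Coalgebra.comul h) := by
  induction x with
  | zero => simp
  | add x x' hx hx' =>
    simp only [map_add, TensorProduct.add_tmul, hx, hx', LinearMap.comp_apply,
      TensorProduct.map_add_left, LinearMap.add_apply]
  | tmul p v =>
    induction y with
    | zero => simp
    | add y y' hy hy' =>
      simp only [map_add, TensorProduct.tmul_add, hy, hy', LinearMap.comp_apply,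
        TensorProduct.map_add_right, LinearMap.add_apply]
    | tmul q w =>
      let K : H ⊗[k] (H ⊗[k] H) →ₗ[k] H ⊗[k] (V ⊗[k] W) :=
        TensorProduct.map ((LinearMap.mul k H).flip (p * q))
          (TensorProduct.map (ρ.toLinearMap.flip v) (σ.toLinearMap.flip w))
      have e1 : TensorProduct.map ((LinearMap.mul k H).flip (p * q))
          ((tensorAct k ρ σ).toLinearMap.flip (v ⊗ₜ w)) =
          K ∘ₗ (Coalgebra.comul (R := k) (A := H)).lTensor H := by
        ext a b
        simp [K, tensorAct_tmul]
      have e2 : merge k H V W ∘ₗ TensorProduct.map ((diag k ρ).toLinearMap.flip (p ⊗ₜ v))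
          ((LinearMap.lTensorHom H ∘ₗ σ.toLinearMap).flip (q ⊗ₜ w)) =
          K ∘ₗ (TensorProduct.assoc k H H H).toLinearMap ∘ₗ
            (Coalgebra.comul (R := k) (A := H)).rTensor H := by
        ext a b
        simp only [TensorProduct.AlgebraTensorModule.curry_apply, TensorProduct.curry_apply,
          LinearMap.coe_restrictScalars, LinearMap.comp_apply, TensorProduct.map_tmul,
          LinearMap.flip_apply, AlgHom.toLinearMap_apply, LinearMap.rTensor_tmul, diag_apply_tmul]
        generalize (Coalgebra.comul a : H ⊗[k] H) = t
        induction t with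
        | zero => simp
        | add x y hx hy => simp only [map_add, TensorProduct.add_tmul, hx, hy]
        | tmul c d => simp [K, mul_assoc]
      rw [merge_tmul, diag_apply_tmul, e1, e2]
      simp only [LinearMap.comp_apply, LinearEquiv.coe_coe, Coalgebra.coassoc_apply]

end TensorCoaction

end YetterDrinfeld

/-- A left-left Yetter-Drinfeld module over the Hopf algebra `H`: a vector space with a left
`H`-action `act` and a left `H`-coaction `coact` such that
`(h v)₍₋₁₎ ⊗ (h v)₍₀₎ = h₍₁₎ v₍₋₁₎ S(h₍₃₎) ⊗ h₍₂₎ v₍₀₎`. -/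
structure YetterDrinfeld (k : Type u) [Field k] (H : Type v) [Ring H] [HopfAlgebra k H] where
  carrier : Type u
  [addCommGroup : AddCommGroup carrier]
  [module : Module k carrier]
  act : H →ₐ[k] Module.End k carrier
  coact : carrier →ₗ[k] H ⊗[k] carrier
  coassoc : (TensorProduct.assoc k H H carrier).toLinearMap ∘ₗ
    (Coalgebra.comul (R := k) (A := H)).rTensor carrier ∘ₗ coact = coact.lTensor H ∘ₗ coact
  counit_coact : (TensorProduct.lid k carrier).toLinearMap ∘ₗ
    (Coalgebra.counit (R := k) (A := H)).rTensor carrier ∘ₗ coact = LinearMap.id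
  compat : ∀ (h : H) (v : carrier),
    coact (act h v) = YetterDrinfeld.twist k act h (coact v)

namespace YetterDrinfeld

variable {k : Type u} [Field k] {H : Type v} [Ring H] [HopfAlgebra k H]

instance : CoeSort (YetterDrinfeld k H) (Type u) := ⟨YetterDrinfeld.carrier⟩

attribute [instance] YetterDrinfeld.addCommGroup YetterDrinfeld.module

/-- Morphisms of Yetter-Drinfeld modules: linear and colinear maps. -/
@[ext]
structure Hom (V W : YetterDrinfeld k H) where
  lin : V →ₗ[k] W
  map_act : ∀ (h : H) (v : V), lin (V.act h v) = W.act h (lin v)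
  map_coact : ∀ v : V, W.coact (lin v) = lin.lTensor H (V.coact v)

instance : Category (YetterDrinfeld k H) where
  Hom := Hom
  id V := ⟨LinearMap.id, fun _ _ => rfl, fun v => by simp⟩
  comp f g := ⟨g.lin ∘ₗ f.lin, fun h v => by simp [f.map_act, g.map_act], fun v => by
    simp [f.map_coact, g.map_coact, LinearMap.lTensor_comp]⟩

variable {V W X Y : YetterDrinfeld k H}

@[ext] lemma hom_ext {f g : V ⟶ W} (h : f.lin = g.lin) : f = g := Hom.ext h

@[simp] lemma id_lin (V : YetterDrinfeld k H) : Hom.lin (𝟙 V) = LinearMap.id := rfl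

@[simp] lemma comp_lin (f : V ⟶ W) (g : W ⟶ X) : (f ≫ g).lin = g.lin ∘ₗ f.lin := rfl

/-- A linear isomorphism compatible with the structure is an isomorphism. -/
def mkIso (e : V ≃ₗ[k] W) (h₁ : ∀ (h : H) (v : V), e (V.act h v) = W.act h (e v))
    (h₂ : ∀ v : V, W.coact (e v) = e.toLinearMap.lTensor H (V.coact v)) : V ≅ W where
  hom := ⟨e.toLinearMap, h₁, h₂⟩
  inv := ⟨e.symm.toLinearMap, fun h w => by
      obtain ⟨v, rfl⟩ := e.surjective w
      simp [← h₁], fun w => by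
      obtain ⟨v, rfl⟩ := e.surjective w
      simp only [LinearEquiv.coe_coe, LinearEquiv.symm_apply_apply, h₂]
      rw [← LinearMap.comp_apply, ← LinearMap.lTensor_comp]
      simp⟩
  hom_inv_id := by ext; simp
  inv_hom_id := by ext; simp

lemma sweep_comul (V : YetterDrinfeld k H) (h : H) (v : V) :
    sweep k V.act V.coact (Coalgebra.comul h) v = diag k V.act h (V.coact v) :=
  (compat_iff k V.act V.coact).1 V.compat h v

/-- The tensor product of Yetter-Drinfeld modules. -/
noncomputable abbrev tensor (V W : YetterDrinfeld k H) : YetterDrinfeld k H where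
  carrier := V ⊗[k] W
  act := tensorAct k V.act W.act
  coact := tensorCoact k V.coact W.coact
  coassoc := by
    let M := merge k H V W
    let M2 := merge k (H ⊗[k] H) V W ∘ₗ TensorProduct.map
      (TensorProduct.assoc k H H V).symm.toLinearMap (TensorProduct.assoc k H H W).symm.toLinearMap
    have e1 : (TensorProduct.assoc k H H (V ⊗[k] W)).toLinearMap ∘ₗ
        (Coalgebra.comul (R := k) (A := H)).rTensor (V ⊗[k] W) ∘ₗ M =
        (TensorProduct.assoc k H H (V ⊗[k] W)).toLinearMap ∘ₗ merge k (H ⊗[k] H) V W ∘ₗ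
        TensorProduct.map ((Coalgebra.comul (R := k) (A := H)).rTensor V)
          ((Coalgebra.comul (R := k) (A := H)).rTensor W) := by
      ext x v y w
      simp [M]
    have e2 : (tensorCoact k V.coact W.coact).lTensor H ∘ₗ M =
        (TensorProduct.assoc k H H (V ⊗[k] W)).toLinearMap ∘ₗ M2 ∘ₗ
        TensorProduct.map (V.coact.lTensor H) (W.coact.lTensor H) := by
      ext x v y w
      simp only [M, M2, TensorProduct.AlgebraTensorModule.curry_apply, TensorProduct.curry_apply,
        LinearMap.coe_restrictScalars, LinearMap.comp_apply, merge_tmul, LinearMap.lTensor_tmul,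
        tensorCoact_tmul, TensorProduct.map_tmul, LinearEquiv.coe_coe]
      generalize V.coact v = s
      generalize W.coact w = t
      induction s with
      | zero => simp
      | add s s' hs hs' => simp only [map_add, TensorProduct.add_tmul, TensorProduct.tmul_add, hs, hs']
      | tmul a b =>
        induction t with
        | zero => simp
        | add s s' hs hs' => simp only [map_add, TensorProduct.tmul_add, hs, hs']
        | tmul c d => simp
    have c1 := fun v => LinearMap.congr_fun V.coassoc v
    have c2 := fun w => LinearMap.congr_fun W.coassoc w
    simp only [LinearMap.comp_apply, LinearEquiv.coe_coe] at c1 c2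
    ext v w
    have h1 := LinearMap.congr_fun e1 (V.coact v ⊗ₜ W.coact w)
    have h2 := LinearMap.congr_fun e2 (V.coact v ⊗ₜ W.coact w)
    simp only [M, M2, LinearMap.comp_apply, TensorProduct.map_tmul, LinearEquiv.coe_coe,
      ← c1, ← c2, LinearEquiv.symm_apply_apply] at h1 h2
    simp only [TensorProduct.AlgebraTensorModule.curry_apply, TensorProduct.curry_apply,
      LinearMap.coe_restrictScalars, LinearMap.comp_apply, LinearEquiv.coe_coe, tensorCoact_tmul]
    exact h1.trans h2.symm
  counit_coact := by
    have e1 : (TensorProduct.lid k (V ⊗[k] W)).toLinearMap ∘ₗ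
        (Coalgebra.counit (R := k) (A := H)).rTensor (V ⊗[k] W) ∘ₗ merge k H V W =
        TensorProduct.map
          ((TensorProduct.lid k V).toLinearMap ∘ₗ (Coalgebra.counit (R := k) (A := H)).rTensor V)
          ((TensorProduct.lid k W).toLinearMap ∘ₗ
            (Coalgebra.counit (R := k) (A := H)).rTensor W) := by
      ext x v y w
      simp [TensorProduct.smul_tmul', TensorProduct.tmul_smul]
      rw [smul_smul, mul_comm]
    have c1 := fun v => LinearMap.congr_fun V.counit_coact v
    have c2 := fun w => LinearMap.congr_fun W.counit_coact w
    simp only [LinearMap.comp_apply, LinearEquiv.coe_coe] at c1 c2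
    ext v w
    have h1 := LinearMap.congr_fun e1 (V.coact v ⊗ₜ W.coact w)
    simp only [LinearMap.comp_apply, TensorProduct.map_tmul, LinearEquiv.coe_coe, c1, c2] at h1
    exact h1
  compat := by
    rw [compat_iff]
    intro h x
    induction x with
    | zero => simp
    | add x y hx hy => simp only [map_add, hx, hy]
    | tmul v w =>
    rw [tensorCoact_tmul, diag_merge]
    let L : H →ₗ[k] Module.End k (H ⊗[k] W) := LinearMap.lTensorHom H ∘ₗ W.act.toLinearMap
    let K : H ⊗[k] (H ⊗[k] H) →ₗ[k] H ⊗[k] (V ⊗[k] W) := merge k H V W ∘ₗ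
      TensorProduct.map (V.coact ∘ₗ V.act.toLinearMap.flip v)
        ((sweep k W.act W.coact).flip w)
    let K' : (H ⊗[k] H) ⊗[k] H →ₗ[k] H ⊗[k] (V ⊗[k] W) := merge k H V W ∘ₗ
      TensorProduct.map ((sweep k V.act V.coact).flip v) (L.flip (W.coact w))
    have e1 : (sweep k (tensorAct k V.act W.act) (tensorCoact k V.coact W.coact)).flip (v ⊗ₜ w) =
        K ∘ₗ (TensorProduct.assoc k H H H).toLinearMap ∘ₗ
          (Coalgebra.comul (R := k) (A := H)).rTensor H := by
      ext a b
      simp only [TensorProduct.AlgebraTensorModule.curry_apply, TensorProduct.curry_apply,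
        LinearMap.coe_restrictScalars, LinearMap.flip_apply, sweep_tmul, LinearMap.comp_apply,
        LinearMap.rTensor_tmul, tensorAct_tmul]
      generalize (Coalgebra.comul a : H ⊗[k] H) = t
      induction t with
      | zero => simp
      | add x y hx hy => simp only [map_add, TensorProduct.add_tmul, hx, hy]
      | tmul a c => simp [K, rightMul_merge]
    have e2 : K ∘ₗ (Coalgebra.comul (R := k) (A := H)).lTensor H =
        K' ∘ₗ (TensorProduct.assoc k H H H).symm.toLinearMap ∘ₗ
          (Coalgebra.comul (R := k) (A := H)).lTensor H := by
      ext a b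
      have := sweep_comul W b w
      simp only [TensorProduct.AlgebraTensorModule.curry_apply, TensorProduct.curry_apply,
        LinearMap.coe_restrictScalars, LinearMap.comp_apply, K, LinearMap.lTensor_tmul,
        TensorProduct.map_tmul, LinearMap.flip_apply, this]
      rw [merge_diag]
      generalize (Coalgebra.comul b : H ⊗[k] H) = t
      induction t with
      | zero => simp
      | add x y hx hy => simp only [map_add, TensorProduct.tmul_add, hx, hy]
      | tmul c d => simp [K', L]
    have h1 := LinearMap.congr_fun e1 (Coalgebra.comul h)
    have h2 := LinearMap.congr_fun e2 (Coalgebra.comul h)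
    simp only [LinearMap.flip_apply, LinearMap.comp_apply, LinearEquiv.coe_coe,
      Coalgebra.coassoc_apply, Coalgebra.coassoc_symm_apply] at h1 h2
    rw [h1, h2]
    generalize (Coalgebra.comul h : H ⊗[k] H) = t
    induction t with
    | zero => simp
    | add x y hx hy => simp only [map_add, hx, hy]
    | tmul c d => simp [K', L, sweep_comul]
section

variable {k : Type u} [Field k] {H : Type v} [Ring H] [HopfAlgebra k H]
variable {V W X Y : YetterDrinfeld k H}

variable (k H) in
/-- The unit object: the ground field with trivial action and coaction. -/
noncomputable abbrev unit : YetterDrinfeld k H where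
  carrier := k
  act := (Algebra.ofId k (Module.End k k)).comp (Bialgebra.counitAlgHom k H)
  coact := TensorProduct.mk k H k 1
  coassoc := by
    ext
    simp [Algebra.TensorProduct.one_def]
  counit_coact := by
    ext
    simp
  compat := by
    rw [compat_iff]
    intro h r
    rw [TensorProduct.mk_apply, diag_apply_tmul]
    have e1 : (sweep k ((Algebra.ofId k (Module.End k k)).comp (Bialgebra.counitAlgHom k H))
        (TensorProduct.mk k H k 1)).flip r =
        (TensorProduct.mk k H k).flip r ∘ₗ (TensorProduct.lid k H).toLinearMap ∘ₗ
          (Coalgebra.counit (R := k) (A := H)).rTensor H := by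
      ext a b
      simp [Algebra.ofId_apply, Algebra.algebraMap_eq_smul_one, TensorProduct.smul_tmul',
        ← smul_eq_mul]
    have e2 : TensorProduct.map ((LinearMap.mul k H).flip 1)
        (((Algebra.ofId k (Module.End k k)).comp (Bialgebra.counitAlgHom k H)).toLinearMap.flip
          r) =
        (TensorProduct.mk k H k).flip r ∘ₗ (TensorProduct.rid k H).toLinearMap ∘ₗ
          (Coalgebra.counit (R := k) (A := H)).lTensor H := by
      ext a b
      simp only [TensorProduct.AlgebraTensorModule.curry_apply, TensorProduct.curry_apply,
        LinearMap.coe_restrictScalars]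
      simp [Algebra.ofId_apply, Algebra.algebraMap_eq_smul_one, TensorProduct.smul_tmul',
        TensorProduct.tmul_smul, -smul_eq_mul]
    have h1 := LinearMap.congr_fun e1 (Coalgebra.comul h)
    rw [LinearMap.flip_apply] at h1
    rw [h1, e2]
    simp

/-- The tensor product of morphisms of Yetter-Drinfeld modules. -/
noncomputable def tensorMap (f : V ⟶ W) (g : X ⟶ Y) : tensor V X ⟶ tensor W Y where
  lin := TensorProduct.map f.lin g.lin
  map_act h (z : V ⊗[k] X) := by
    induction z with
    | zero => simp
    | add x y hx hy => simp only [map_add, hx, hy]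
    | tmul v w =>
      change TensorProduct.map f.lin g.lin (tensorAct k V.act X.act h (v ⊗ₜ w)) =
        tensorAct k W.act Y.act h (f.lin v ⊗ₜ g.lin w)
      rw [tensorAct_tmul, tensorAct_tmul]
      generalize (Coalgebra.comul h : H ⊗[k] H) = t
      induction t with
      | zero => simp
      | add x y hx hy => simp only [map_add, hx, hy]
      | tmul c d => simp [Hom.map_act]
  map_coact (z : V ⊗[k] X) := by
    induction z with
    | zero => simp
    | add x y hx hy => simp only [map_add, hx, hy]
    | tmul v w =>
      change merge k H W Y (W.coact (f.lin v) ⊗ₜ Y.coact (g.lin w)) =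
        (TensorProduct.map f.lin g.lin).lTensor H (merge k H V X (V.coact v ⊗ₜ X.coact w))
      rw [f.map_coact, g.map_coact]
      generalize V.coact v = s
      generalize X.coact w = t
      induction s with
      | zero => simp
      | add s s' hs hs' => simp only [map_add, TensorProduct.add_tmul, hs, hs']
      | tmul a b =>
        induction t with
        | zero => simp
        | add s s' hs hs' => simp only [map_add, TensorProduct.tmul_add, hs, hs']
        | tmul c d => simp

/-- The associator. -/
noncomputable def assocIso (V W X : YetterDrinfeld k H) :
    tensor (tensor V W) X ≅ tensor V (tensor W X) :=
  mkIso (TensorProduct.assoc k V W X)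
    (fun h (z : (V ⊗[k] W) ⊗[k] X) => by
      change TensorProduct.assoc k V W X (tensorAct k (tensorAct k V.act W.act) X.act h z) =
        tensorAct k V.act (tensorAct k W.act X.act) h (TensorProduct.assoc k V W X z)
      induction z with
      | zero => simp
      | add x y hx hy => simp only [map_add, hx, hy]
      | tmul y x =>
      induction y with
      | zero => simp
      | add y y' hy hy' => simp only [map_add, TensorProduct.add_tmul, hy, hy']
      | tmul v w =>
      let K : H ⊗[k] (H ⊗[k] H) →ₗ[k] V ⊗[k] (W ⊗[k] X) :=
        TensorProduct.map (V.act.toLinearMap.flip v)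
          (TensorProduct.map (W.act.toLinearMap.flip w) (X.act.toLinearMap.flip x))
      have e1 : (TensorProduct.assoc k V W X).toLinearMap ∘ₗ
          TensorProduct.map ((tensorAct k V.act W.act).toLinearMap.flip (v ⊗ₜ w))
            (X.act.toLinearMap.flip x) =
          K ∘ₗ (TensorProduct.assoc k H H H).toLinearMap ∘ₗ
            (Coalgebra.comul (R := k) (A := H)).rTensor H := by
        ext a b
        simp only [TensorProduct.AlgebraTensorModule.curry_apply, TensorProduct.curry_apply,
          LinearMap.coe_restrictScalars, LinearMap.comp_apply, TensorProduct.map_tmul,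
          LinearMap.flip_apply, AlgHom.toLinearMap_apply, LinearMap.rTensor_tmul, tensorAct_tmul]
        generalize (Coalgebra.comul a : H ⊗[k] H) = t
        induction t with
        | zero => simp
        | add x y hx hy => simp only [map_add, TensorProduct.add_tmul, hx, hy]
        | tmul c d => simp [K]
      have e2 : TensorProduct.map (V.act.toLinearMap.flip v)
            ((tensorAct k W.act X.act).toLinearMap.flip (w ⊗ₜ x)) =
          K ∘ₗ (Coalgebra.comul (R := k) (A := H)).lTensor H := by
        ext a b
        simp [K, tensorAct_tmul]
      rw [TensorProduct.assoc_tmul, tensorAct_tmul, tensorAct_tmul, e2]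
      have h1 := LinearMap.congr_fun e1 (Coalgebra.comul h)
      simp only [LinearMap.comp_apply, LinearEquiv.coe_coe, Coalgebra.coassoc_apply] at h1 ⊢
      exact h1)
    (fun (z : (V ⊗[k] W) ⊗[k] X) => by
      change tensorCoact k V.coact (tensorCoact k W.coact X.coact)
          (TensorProduct.assoc k V W X z) =
        (TensorProduct.assoc k V W X).toLinearMap.lTensor H
          (tensorCoact k (tensorCoact k V.coact W.coact) X.coact z)
      induction z with
      | zero => simp
      | add x y hx hy => simp only [map_add, hx, hy]
      | tmul y x =>
      induction y with
      | zero => simp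
      | add y y' hy hy' => simp only [map_add, TensorProduct.add_tmul, hy, hy']
      | tmul v w =>
      simp only [TensorProduct.assoc_tmul, tensorCoact_tmul]
      generalize V.coact v = r
      generalize W.coact w = s
      generalize X.coact x = t
      induction r with
      | zero => simp
      | add s s' hs hs' => simp only [map_add, TensorProduct.add_tmul, hs, hs']
      | tmul a b =>
      induction s with
      | zero => simp
      | add s s' hs hs' =>
        simp only [map_add, TensorProduct.tmul_add, TensorProduct.add_tmul, hs, hs']
      | tmul c d =>
      induction t with
      | zero => simp
      | add s s' hs hs' => simp only [map_add, TensorProduct.tmul_add, hs, hs']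
      | tmul e f => simp [mul_assoc])

/-- The left unitor. -/
noncomputable def leftUnitIso (V : YetterDrinfeld k H) : tensor (unit k H) V ≅ V :=
  mkIso (TensorProduct.lid k V)
    (fun h (z : k ⊗[k] V) => by
      change TensorProduct.lid k V (tensorAct k (unit k H).act V.act h z) =
        V.act h (TensorProduct.lid k V z)
      induction z with
      | zero => simp
      | add x y hx hy => simp only [map_add, hx, hy]
      | tmul r v =>
      have e : (TensorProduct.lid k V).toLinearMap ∘ₗ TensorProduct.map
          ((unit k H).act.toLinearMap.flip r) (V.act.toLinearMap.flip v) =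
          V.act.toLinearMap.flip (r • v) ∘ₗ (TensorProduct.lid k H).toLinearMap ∘ₗ
          (Coalgebra.counit (R := k) (A := H)).rTensor H := by
        ext a b
        simp [Algebra.ofId_apply, Algebra.algebraMap_eq_smul_one, mul_smul]
        exact smul_comm _ _ _
      have h1 := LinearMap.congr_fun e (Coalgebra.comul h)
      rw [tensorAct_tmul]
      simpa using h1)
    (fun (z : k ⊗[k] V) => by
      change V.coact (TensorProduct.lid k V z) = (TensorProduct.lid k V).toLinearMap.lTensor H
        (tensorCoact k (unit k H).coact V.coact z)
      induction z with
      | zero => simp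
      | add x y hx hy => simp only [map_add, hx, hy]
      | tmul r v =>
      simp only [tensorCoact_tmul, TensorProduct.lid_tmul, map_smul]
      generalize V.coact v = t
      induction t with
      | zero => simp
      | add s s' hs hs' => simp only [map_add, smul_add, TensorProduct.tmul_add, hs, hs']
      | tmul e f => simp)

/-- The right unitor. -/
noncomputable def rightUnitIso (V : YetterDrinfeld k H) : tensor V (unit k H) ≅ V :=
  mkIso (TensorProduct.rid k V)
    (fun h (z : V ⊗[k] k) => by
      change TensorProduct.rid k V (tensorAct k V.act (unit k H).act h z) =
        V.act h (TensorProduct.rid k V z)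
      induction z with
      | zero => simp
      | add x y hx hy => simp only [map_add, hx, hy]
      | tmul v r =>
      have e : (TensorProduct.rid k V).toLinearMap ∘ₗ TensorProduct.map
          (V.act.toLinearMap.flip v) ((unit k H).act.toLinearMap.flip r) =
          V.act.toLinearMap.flip (r • v) ∘ₗ (TensorProduct.rid k H).toLinearMap ∘ₗ
          (Coalgebra.counit (R := k) (A := H)).lTensor H := by
        ext a b
        simp [Algebra.ofId_apply, Algebra.algebraMap_eq_smul_one, mul_smul]
        exact smul_comm _ _ _
      have h1 := LinearMap.congr_fun e (Coalgebra.comul h)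
      rw [tensorAct_tmul]
      simpa using h1)
    (fun (z : V ⊗[k] k) => by
      change V.coact (TensorProduct.rid k V z) = (TensorProduct.rid k V).toLinearMap.lTensor H
        (tensorCoact k V.coact (unit k H).coact z)
      induction z with
      | zero => simp
      | add x y hx hy => simp only [map_add, hx, hy]
      | tmul v r =>
      simp only [tensorCoact_tmul, TensorProduct.rid_tmul, map_smul]
      generalize V.coact v = t
      induction t with
      | zero => simp
      | add s s' hs hs' => simp only [map_add, smul_add, TensorProduct.add_tmul, hs, hs']
      | tmul e f => simp)

noncomputable instance : MonoidalCategoryStruct (YetterDrinfeld k H) where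
  tensorObj := tensor
  tensorUnit := unit k H
  tensorHom := tensorMap
  whiskerLeft V _ _ f := tensorMap (𝟙 V) f
  whiskerRight f V := tensorMap f (𝟙 V)
  associator := assocIso
  leftUnitor := leftUnitIso
  rightUnitor := rightUnitIso

variable (k H) in
/-- The forgetful functor to vector spaces. -/
def forgetToModule : YetterDrinfeld k H ⥤ ModuleCat.{u} k where
  obj V := ModuleCat.of k V
  map f := ModuleCat.ofHom f.lin

instance : (forgetToModule k H).Faithful where
  map_injective h := hom_ext (congrArg ModuleCat.Hom.hom h)

noncomputable instance : MonoidalCategory (YetterDrinfeld k H) :=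
  Monoidal.induced (forgetToModule k H)
    { μIso := fun _ _ => Iso.refl _
      εIso := Iso.refl _
      whiskerLeft_eq := by intros; rfl
      whiskerRight_eq := by intros; rfl
      tensorHom_eq := by intros; rfl
      associator_eq := by
        intro X Y Z
        apply ModuleCat.hom_ext
        refine TensorProduct.ext_threefold ?_
        intro x y z
        rfl
      leftUnitor_eq := by
        intro X
        apply ModuleCat.hom_ext
        refine TensorProduct.ext' ?_
        intro x y
        rfl
      rightUnitor_eq := by
        intro X
        apply ModuleCat.hom_ext
        refine TensorProduct.ext' ?_
        intro x y
        rfl }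

lemma braidLin_tmul (V W : YetterDrinfeld k H) (v : V) (w : W) :
    braidLin k V.coact W.act (v ⊗ₜ w) =
      (TensorProduct.map (W.act.toLinearMap.flip w) LinearMap.id) (V.coact v) := by
  simp only [braidLin, LinearMap.comp_apply, LinearMap.rTensor_tmul]
  generalize V.coact v = t
  induction t with
  | zero => simp
  | add x y hx hy => simp only [map_add, TensorProduct.add_tmul, hx, hy]
  | tmul a b => simp

/-- The map `c : V ⊗ W ⟶ W ⊗ V`, `v ⊗ w ↦ v₍₋₁₎ · w ⊗ v₍₀₎`. It is invertible when the antipode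
of `H` is bijective, and is then the standard braiding. -/
noncomputable def braid (V W : YetterDrinfeld k H) : V ⊗ W ⟶ W ⊗ V where
  lin := braidLin k V.coact W.act
  map_act h (z : V ⊗[k] W) := by
    change braidLin k V.coact W.act (tensorAct k V.act W.act h z) =
      tensorAct k W.act V.act h (braidLin k V.coact W.act z)
    induction z with
    | zero => simp
    | add x y hx hy => simp only [map_add, hx, hy]
    | tmul v w =>
      have e1 : ∀ (b : H) (x : H ⊗[k] V),
          TensorProduct.map (W.act.toLinearMap.flip (W.act b w)) LinearMap.id x =
          TensorProduct.map (W.act.toLinearMap.flip w) LinearMap.id (rightMul k V b x) := by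
        intro b x
        induction x with
        | zero => simp
        | add x y hx hy => simp only [map_add, hx, hy]
        | tmul p v => simp
      have e2 : ∀ x : H ⊗[k] V, tensorAct k W.act V.act h
          (TensorProduct.map (W.act.toLinearMap.flip w) LinearMap.id x) =
          TensorProduct.map (W.act.toLinearMap.flip w) LinearMap.id (diag k V.act h x) := by
        intro x
        induction x with
        | zero => simp
        | add x y hx hy => simp only [map_add, hx, hy]
        | tmul p v =>
          simp only [TensorProduct.map_tmul, tensorAct_tmul, diag_apply_tmul]
          generalize (Coalgebra.comul h : H ⊗[k] H) = t
          induction t with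
          | zero => simp
          | add x y hx hy => simp only [map_add, hx, hy]
          | tmul c d => simp
      rw [braidLin_tmul, e2, ← sweep_comul, tensorAct_tmul]
      generalize (Coalgebra.comul h : H ⊗[k] H) = t
      induction t with
      | zero => simp
      | add x y hx hy => simp only [map_add, LinearMap.add_apply, hx, hy]
      | tmul c d => simp [braidLin_tmul, e1]
  map_coact (z : V ⊗[k] W) := by
    change tensorCoact k W.coact V.coact (braidLin k V.coact W.act z) =
      (braidLin k V.coact W.act).lTensor H (tensorCoact k V.coact W.coact z)
    induction z with
    | zero => simp
    | add x y hx hy => simp only [map_add, hx, hy]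
    | tmul v w =>
      let D : H ⊗[k] H →ₗ[k] Module.End k (H ⊗[k] W) :=
        ((Module.endTensorEndAlgHom (R := k) (S := k) (A := k) (M := H) (N := W)).comp
          (Algebra.TensorProduct.map (Algebra.lmul k H) W.act)).toLinearMap
      have e1 : tensorCoact k W.coact V.coact ∘ₗ
          TensorProduct.map (W.act.toLinearMap.flip w) LinearMap.id =
          (TensorProduct.assoc k H W V).toLinearMap ∘ₗ
            ((sweep k W.act W.coact).flip w).rTensor V ∘ₗ
            (TensorProduct.assoc k H H V).symm.toLinearMap ∘ₗ V.coact.lTensor H := by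
        ext p v'
        simp only [TensorProduct.AlgebraTensorModule.curry_apply, TensorProduct.curry_apply,
          LinearMap.coe_restrictScalars, LinearMap.comp_apply, TensorProduct.map_tmul,
          LinearMap.lTensor_tmul, tensorCoact_tmul, LinearMap.id_apply, LinearMap.flip_apply,
          AlgHom.toLinearMap_apply]
        generalize V.coact v' = t
        induction t with
        | zero => simp
        | add x y hx hy => simp only [map_add, TensorProduct.tmul_add, hx, hy]
        | tmul b v'' =>
          simp only [LinearEquiv.coe_coe, TensorProduct.assoc_symm_tmul, LinearMap.rTensor_tmul,
            LinearMap.flip_apply, sweep_tmul]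
          generalize W.coact (W.act p w) = t
          induction t with
          | zero => simp
          | add x y hx hy => simp only [map_add, TensorProduct.add_tmul, hx, hy]
          | tmul c d => simp
      have e2 : ∀ y : H ⊗[k] W, (braidLin k V.coact W.act).lTensor H ∘ₗ merge k H V W ∘ₗ
          (TensorProduct.mk k (H ⊗[k] V) (H ⊗[k] W)).flip y =
          (TensorProduct.assoc k H W V).toLinearMap ∘ₗ (D.flip y).rTensor V ∘ₗ
            (TensorProduct.assoc k H H V).symm.toLinearMap ∘ₗ V.coact.lTensor H := by
        intro y
        induction y with
        | zero => simp
        | add x y hx hy =>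
          simp only [map_add, LinearMap.comp_add, LinearMap.rTensor_add, LinearMap.add_comp, hx, hy]
        | tmul r w' =>
          ext q v''
          simp only [TensorProduct.AlgebraTensorModule.curry_apply, TensorProduct.curry_apply,
            LinearMap.coe_restrictScalars, LinearMap.comp_apply, TensorProduct.mk_apply,
            LinearMap.lTensor_tmul, merge_tmul, LinearMap.flip_apply, braidLin_tmul]
          generalize V.coact v'' = t
          induction t with
          | zero => simp
          | add x y hx hy => simp only [map_add, TensorProduct.tmul_add, hx, hy]
          | tmul b v'' => simp [D, Module.endTensorEndAlgHom_apply]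
      have e3 : ((sweep k W.act W.coact).flip w) ∘ₗ Coalgebra.comul =
          (D.flip (W.coact w)) ∘ₗ Coalgebra.comul :=
        LinearMap.ext fun h => sweep_comul W h w
      have c1 := LinearMap.congr_fun V.coassoc v
      have h1 := LinearMap.congr_fun e1 (V.coact v)
      have h2 := LinearMap.congr_fun (e2 (W.coact w)) (V.coact v)
      simp only [LinearMap.comp_apply, LinearEquiv.coe_coe, TensorProduct.mk_apply,
        LinearMap.flip_apply] at h1 h2 c1
      rw [braidLin_tmul, tensorCoact_tmul, h1, h2, ← c1, LinearEquiv.symm_apply_apply,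
        ← LinearMap.comp_apply (LinearMap.rTensor _ _), ← LinearMap.comp_apply (LinearMap.rTensor _ _),
        ← LinearMap.rTensor_comp, ← LinearMap.rTensor_comp, e3]

lemma braid_naturality (f : V ⟶ W) (g : X ⟶ Y) :
    (f ⊗ₘ g) ≫ braid W Y = braid V X ≫ (g ⊗ₘ f) := by
  apply hom_ext
  refine TensorProduct.ext' fun v x => ?_
  change braidLin k W.coact Y.act (f.lin v ⊗ₜ g.lin x) =
    TensorProduct.map g.lin f.lin (braidLin k V.coact X.act (v ⊗ₜ x))
  rw [braidLin_tmul, braidLin_tmul, f.map_coact]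
  generalize V.coact v = t
  induction t with
  | zero => simp
  | add x y hx hy => simp only [map_add, hx, hy]
  | tmul a b => simp [g.map_act]

instance : Zero (V ⟶ W) := ⟨⟨0, by simp, by simp⟩⟩
instance : Add (V ⟶ W) := ⟨fun f g => ⟨f.lin + g.lin, by simp [f.map_act, g.map_act],
  by simp [f.map_coact, g.map_coact, LinearMap.lTensor_add]⟩⟩
instance : Neg (V ⟶ W) := ⟨fun f => ⟨-f.lin, by simp [f.map_act],
  by simp [f.map_coact, LinearMap.lTensor_neg]⟩⟩
@[simp] lemma zero_lin : (0 : V ⟶ W).lin = 0 := rfl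
@[simp] lemma add_lin (f g : V ⟶ W) : (f + g).lin = f.lin + g.lin := rfl
@[simp] lemma neg_lin (f : V ⟶ W) : (-f).lin = -f.lin := rfl

instance : AddCommGroup (V ⟶ W) where
  add_assoc _ _ _ := by ext; simp [add_assoc]
  zero_add _ := by ext; simp
  add_zero _ := by ext; simp
  add_comm _ _ := by ext; simp [add_comm]
  neg_add_cancel _ := by ext; simp
  nsmul := nsmulRec
  zsmul := zsmulRec

instance : Preadditive (YetterDrinfeld k H) where
  add_comp _ _ _ _ _ _ := by ext; simp
  comp_add _ _ _ _ _ _ := by ext; simp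

instance : MonoidalPreadditive (YetterDrinfeld k H) where
  whiskerLeft_zero := hom_ext (TensorProduct.map_zero_right _)
  zero_whiskerRight := hom_ext (TensorProduct.map_zero_left _)
  whiskerLeft_add _ _ := hom_ext (TensorProduct.map_add_right _ _ _)
  add_whiskerRight _ _ := hom_ext (TensorProduct.map_add_left _ _ _)

variable (k H) in
/-- The zero Yetter-Drinfeld module. -/
noncomputable def zeroObj : YetterDrinfeld k H where
  carrier := PUnit
  act := AlgHom.ofLinearMap 0 (Subsingleton.elim _ _) (fun _ _ => Subsingleton.elim _ _)
  coact := 0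
  coassoc := by simp
  counit_coact := Subsingleton.elim _ _
  compat _ _ := by simp

instance : HasZeroObject (YetterDrinfeld k H) where
  zero := ⟨zeroObj k H, (IsZero.iff_id_eq_zero _).2 (hom_ext (LinearMap.ext fun _ => rfl))⟩

lemma twist_lTensor {U V : Type u} [AddCommGroup U] [Module k U] [AddCommGroup V] [Module k V]
    (ρ : H →ₐ[k] Module.End k U) (σ : H →ₐ[k] Module.End k V) (f : U →ₗ[k] V)
    (hf : ∀ h u, f (ρ h u) = σ h (f u)) (h : H) (x : H ⊗[k] U) :
    twist k σ h (f.lTensor H x) = f.lTensor H (twist k ρ h x) := by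
  have e1 : ∀ (a : H) (x : H ⊗[k] U),
      diag k σ a (f.lTensor H x) = f.lTensor H (diag k ρ a x) := by
    intro a x
    induction x with
    | zero => simp
    | add x y hx hy => simp only [map_add, hx, hy]
    | tmul p u =>
      simp only [LinearMap.lTensor_tmul, diag_apply_tmul]
      generalize (Coalgebra.comul a : H ⊗[k] H) = t
      induction t with
      | zero => simp
      | add x y hx hy => simp only [map_add, hx, hy]
      | tmul c d => simp [hf]
  have e2 : ∀ (a : H) (x : H ⊗[k] U),
      rightMul k V a (f.lTensor H x) = f.lTensor H (rightMul k U a x) := by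
    intro a x
    induction x with
    | zero => simp
    | add x y hx hy => simp only [map_add, hx, hy]
    | tmul p u => simp
  simp only [twist, LinearMap.comp_apply]
  generalize (Coalgebra.comul h : H ⊗[k] H) = t
  induction t with
  | zero => simp
  | add x y hx hy => simp only [map_add, LinearMap.add_apply, hx, hy]
  | tmul c d => simp [e1, e2]

lemma comul_lTensor {U V : Type u} [AddCommGroup U] [Module k U] [AddCommGroup V] [Module k V]
    (f : U →ₗ[k] V) :
    (TensorProduct.assoc k H H V).toLinearMap ∘ₗ
      (Coalgebra.comul (R := k) (A := H)).rTensor V ∘ₗ f.lTensor H =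
    (f.lTensor H).lTensor H ∘ₗ (TensorProduct.assoc k H H U).toLinearMap ∘ₗ
      (Coalgebra.comul (R := k) (A := H)).rTensor U := by
  ext a u
  simp only [TensorProduct.AlgebraTensorModule.curry_apply, TensorProduct.curry_apply,
    LinearMap.coe_restrictScalars, LinearMap.comp_apply, LinearMap.lTensor_tmul,
    LinearMap.rTensor_tmul]
  generalize (Coalgebra.comul a : H ⊗[k] H) = t
  induction t with
  | zero => simp
  | add x y hx hy => simp only [map_add, TensorProduct.add_tmul, hx, hy]
  | tmul c d => simp

lemma counit_lTensor {U V : Type u} [AddCommGroup U] [Module k U] [AddCommGroup V] [Module k V]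
    (f : U →ₗ[k] V) :
    (TensorProduct.lid k V).toLinearMap ∘ₗ
      (Coalgebra.counit (R := k) (A := H)).rTensor V ∘ₗ f.lTensor H =
    f ∘ₗ (TensorProduct.lid k U).toLinearMap ∘ₗ
      (Coalgebra.counit (R := k) (A := H)).rTensor U := by
  ext a u
  simp

/-- The direct sum of two Yetter-Drinfeld modules. -/
noncomputable abbrev prod (V W : YetterDrinfeld k H) : YetterDrinfeld k H where
  carrier := V × W
  act := AlgHom.ofLinearMap ((LinearMap.prodMapLinear k V W V W k) ∘ₗ
    V.act.toLinearMap.prod W.act.toLinearMap) (by ext <;> simp) (by intros; ext <;> simp)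
  coact := ((LinearMap.inl k V W).lTensor H ∘ₗ V.coact).coprod
    ((LinearMap.inr k V W).lTensor H ∘ₗ W.coact)
  coassoc := by
    have c1 := fun v => LinearMap.congr_fun V.coassoc v
    have c2 := fun w => LinearMap.congr_fun W.coassoc w
    have l1 := fun x => LinearMap.congr_fun (comul_lTensor (H := H) (LinearMap.inl k V W)) x
    have l2 := fun x => LinearMap.congr_fun (comul_lTensor (H := H) (LinearMap.inr k V W)) x
    simp only [LinearMap.comp_apply] at c1 c2 l1 l2
    apply LinearMap.prod_ext
    · refine LinearMap.ext fun v => ?_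
      simp only [LinearMap.comp_apply, LinearMap.coprod_apply, LinearMap.inl_apply, map_zero,
        add_zero, l1, c1]
      rw [← LinearMap.lTensor_comp_apply, ← LinearMap.lTensor_comp_apply, LinearMap.coprod_inl]
    · refine LinearMap.ext fun v => ?_
      simp only [LinearMap.comp_apply, LinearMap.coprod_apply, LinearMap.inr_apply, map_zero,
        zero_add, l2, c2]
      rw [← LinearMap.lTensor_comp_apply, ← LinearMap.lTensor_comp_apply, LinearMap.coprod_inr]
  counit_coact := by
    have c1 := fun v => LinearMap.congr_fun V.counit_coact v
    have c2 := fun w => LinearMap.congr_fun W.counit_coact w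
    have l1 := fun x => LinearMap.congr_fun (counit_lTensor (H := H) (LinearMap.inl k V W)) x
    have l2 := fun x => LinearMap.congr_fun (counit_lTensor (H := H) (LinearMap.inr k V W)) x
    simp only [LinearMap.comp_apply] at c1 c2 l1 l2
    apply LinearMap.prod_ext
    · refine LinearMap.ext fun v => ?_
      simp only [LinearMap.comp_apply, LinearMap.coprod_apply, LinearMap.inl_apply, map_zero,
        add_zero, l1, c1, LinearMap.id_apply]
    · refine LinearMap.ext fun v => ?_
      simp only [LinearMap.comp_apply, LinearMap.coprod_apply, LinearMap.inr_apply, map_zero,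
        zero_add, l2, c2, LinearMap.id_apply]
  compat h := by
    rintro ⟨v, w⟩
    have e1 := twist_lTensor V.act (AlgHom.ofLinearMap ((LinearMap.prodMapLinear k V W V W k) ∘ₗ
      V.act.toLinearMap.prod W.act.toLinearMap) (by ext <;> simp) (by intros; ext <;> simp))
      (LinearMap.inl k V W) (by simp) h (V.coact v)
    have e2 := twist_lTensor W.act (AlgHom.ofLinearMap ((LinearMap.prodMapLinear k V W V W k) ∘ₗ
      V.act.toLinearMap.prod W.act.toLinearMap) (by ext <;> simp) (by intros; ext <;> simp))
      (LinearMap.inr k V W) (by simp) h (W.coact w)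
    simp only [LinearMap.coprod_apply, LinearMap.comp_apply, map_add, e1, e2, ← V.compat,
      ← W.compat]
    simp

instance : HasBinaryBiproducts (YetterDrinfeld k H) where
  has_binary_biproduct V W := hasBinaryBiproduct_of_total
    { pt := prod V W
      fst := ⟨LinearMap.fst k V W, fun _ _ => rfl, fun x => by
        simp only [prod, LinearMap.coprod_apply, LinearMap.comp_apply, map_add]
        rw [← LinearMap.lTensor_comp_apply, ← LinearMap.lTensor_comp_apply,
          LinearMap.fst_comp_inl, LinearMap.fst_comp_inr]
        simp⟩
      snd := ⟨LinearMap.snd k V W, fun _ _ => rfl, fun x => by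
        simp only [prod, LinearMap.coprod_apply, LinearMap.comp_apply, map_add]
        rw [← LinearMap.lTensor_comp_apply, ← LinearMap.lTensor_comp_apply,
          LinearMap.snd_comp_inl, LinearMap.snd_comp_inr]
        simp⟩
      inl := ⟨LinearMap.inl k V W, fun h v => by simp [prod], fun v => by simp [prod]⟩
      inr := ⟨LinearMap.inr k V W, fun h w => by simp [prod], fun w => by simp [prod]⟩
      inl_fst := hom_ext (LinearMap.ext fun _ => rfl)
      inl_snd := hom_ext (LinearMap.ext fun _ => rfl)
      inr_fst := hom_ext (LinearMap.ext fun _ => rfl)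
      inr_snd := hom_ext (LinearMap.ext fun _ => rfl) }
    (hom_ext (LinearMap.ext fun (x : V × W) => by
      change (x.1, (0 : W)) + ((0 : V), x.2) = x
      simp))

instance : HasFiniteProducts (YetterDrinfeld k H) :=
  hasFiniteProducts_of_has_binary_and_terminal

instance : HasFiniteBiproducts (YetterDrinfeld k H) := HasFiniteBiproducts.of_hasFiniteProducts

instance : (curriedTensor (YetterDrinfeld k H)).Additive where
  map_add {_ _ _ _} := by ext : 2; exact MonoidalPreadditive.add_whiskerRight _ _

instance (X : YetterDrinfeld k H) : ((curriedTensor (YetterDrinfeld k H)).obj X).Additive where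
  map_add {_ _ _ _} := MonoidalPreadditive.whiskerLeft_add _ _

instance (X : YetterDrinfeld k H) :
    ((curriedTensor (YetterDrinfeld k H)).flip.obj X).Additive where
  map_add {_ _ _ _} := MonoidalPreadditive.add_whiskerRight _ _

/-- The sign `(-1) ^ p` in the differential `d ⊗ 1 + (-1) ^ p • 1 ⊗ d` of a tensor product of
cochain complexes. -/
instance tensorSignsUp : ComplexShape.TensorSigns (ComplexShape.up ℕ) where
  ε' := MonoidHom.mk' (fun i : ℕ => (-1 : ℤˣ) ^ i) (pow_add (-1 : ℤˣ))
  rel_add p q r hpq := by change p + r + 1 = q + r; have : p + 1 = q := hpq; omega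
  add_rel p q r hpq := by change r + p + 1 = r + q; have : p + 1 = q := hpq; omega
  ε'_succ p q hpq := by
    have : p + 1 = q := hpq
    subst this
    exact (pow_succ (-1 : ℤˣ) p).trans (by rw [mul_neg, mul_one]; rfl)

lemma d₁_eq (K L : CochainComplex (YetterDrinfeld k H) ℕ) (p q j : ℕ) (h : p + 1 + q = j) :
    HomologicalComplex.mapBifunctor.d₁ K L (curriedTensor (YetterDrinfeld k H))
      (ComplexShape.up ℕ) p q j =
    K.d p (p + 1) ▷ L.X q ≫ HomologicalComplex.ιTensorObj K L (p + 1) q j h := by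
  rw [HomologicalComplex.mapBifunctor.d₁_eq K L (curriedTensor (YetterDrinfeld k H))
    (ComplexShape.up ℕ) (i₁ := p) (i₁' := p + 1) rfl q j h]
  exact one_smul ℤˣ _

lemma d₂_eq (K L : CochainComplex (YetterDrinfeld k H) ℕ) (p q j : ℕ) (h : p + (q + 1) = j) :
    HomologicalComplex.mapBifunctor.d₂ K L (curriedTensor (YetterDrinfeld k H))
      (ComplexShape.up ℕ) p q j =
    (-1 : ℤˣ) ^ p • (K.X p ◁ L.d q (q + 1) ≫ HomologicalComplex.ιTensorObj K L p (q + 1) j h) :=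
  HomologicalComplex.mapBifunctor.d₂_eq K L (curriedTensor (YetterDrinfeld k H))
    (ComplexShape.up ℕ) p (i₂ := q) (i₂' := q + 1) rfl j h

lemma ι_d (K L : CochainComplex (YetterDrinfeld k H) ℕ) (p q i j : ℕ) (h : p + q = i)
    (hij : i + 1 = j) :
    HomologicalComplex.ιTensorObj K L p q i h ≫ (HomologicalComplex.tensorObj K L).d i j =
      K.d p (p + 1) ▷ L.X q ≫ HomologicalComplex.ιTensorObj K L (p + 1) q j (by omega) +
      (-1 : ℤˣ) ^ p • (K.X p ◁ L.d q (q + 1) ≫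
        HomologicalComplex.ιTensorObj K L p (q + 1) j (by omega)) := by
  rw [HomologicalComplex.mapBifunctor.d_eq, Preadditive.comp_add,
    HomologicalComplex.mapBifunctor.ι_D₁, HomologicalComplex.mapBifunctor.ι_D₂,
    d₁_eq K L p q j (by omega), d₂_eq K L p q j (by omega)]

/-- The degree `n` part of the graded braiding. -/
noncomputable def gradedBraidingX (K L : CochainComplex (YetterDrinfeld k H) ℕ) (n : ℕ) :
    (HomologicalComplex.tensorObj K L).X n ⟶ (HomologicalComplex.tensorObj L K).X n :=
  HomologicalComplex.mapBifunctorDesc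
    fun p q h => (-1 : ℤˣ) ^ (p * q) • (braid (K.X p) (L.X q) ≫
      HomologicalComplex.ιTensorObj L K q p n ((Nat.add_comm q p).trans h))

lemma ι_gradedBraidingX (K L : CochainComplex (YetterDrinfeld k H) ℕ) (p q n : ℕ)
    (h : p + q = n) :
    HomologicalComplex.ιTensorObj K L p q n h ≫ gradedBraidingX K L n =
      (-1 : ℤˣ) ^ (p * q) • (braid (K.X p) (L.X q) ≫
        HomologicalComplex.ιTensorObj L K q p n ((Nat.add_comm q p).trans h)) :=
  HomologicalComplex.ι_mapBifunctorDesc _ _ _ _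

lemma whiskerRight_braid (f : V ⟶ W) : f ▷ X ≫ braid W X = braid V X ≫ X ◁ f := by
  simpa using braid_naturality f (𝟙 X)

lemma whiskerLeft_braid (f : V ⟶ W) : X ◁ f ≫ braid X W = braid X V ≫ f ▷ X := by
  simpa using braid_naturality (𝟙 X) f

/-- The graded map `K ⊗ L ⟶ L ⊗ K` of cochain complexes of Yetter-Drinfeld modules, equal to
`(-1) ^ (p * q) • c` on `K.X p ⊗ L.X q`. -/
noncomputable def gradedBraiding (K L : CochainComplex (YetterDrinfeld k H) ℕ) :
    K ⊗ L ⟶ L ⊗ K where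
  f n := gradedBraidingX K L n
  comm' i j hij := by
    change i + 1 = j at hij
    change gradedBraidingX K L i ≫ (HomologicalComplex.tensorObj L K).d i j =
      (HomologicalComplex.tensorObj K L).d i j ≫ gradedBraidingX K L j
    refine HomologicalComplex.mapBifunctor.hom_ext fun p q h => ?_
    change p + q = i at h
    change HomologicalComplex.ιTensorObj K L p q i h ≫ _ =
      HomologicalComplex.ιTensorObj K L p q i h ≫ _
    rw [← Category.assoc, ← Category.assoc, ι_gradedBraidingX, ι_d K L p q i j h hij,
      Preadditive.add_comp, Category.assoc, ι_gradedBraidingX, Linear.units_smul_comp,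
      Linear.units_smul_comp, Category.assoc, Category.assoc,
      ι_d L K q p i j ((Nat.add_comm q p).trans h) hij, ι_gradedBraidingX,
      Linear.comp_units_smul, Linear.comp_units_smul, ← Category.assoc (K.d p (p + 1) ▷ _),
      ← Category.assoc (K.X p ◁ _), whiskerRight_braid, whiskerLeft_braid, Preadditive.comp_add,
      Linear.comp_units_smul, smul_add, smul_smul, smul_smul, Category.assoc, Category.assoc,
      add_comm]
    congr 2
    · rw [← pow_add]; congr 1; ring
    · rw [← pow_add, Nat.mul_succ, ← add_assoc, add_comm p, add_assoc, ← two_mul, pow_add, pow_mul]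
      simp

/-- The equations making a monoid and comonoid `A` in the category of Yetter-Drinfeld modules a
bimonoid with respect to the braiding `c`. -/
structure IsBimonoid (A : YetterDrinfeld k H) [MonObj A] [ComonObj A] : Prop where
  mul_comul : MonObj.mul (X := A) ≫ ComonObj.comul =
    (ComonObj.comul (X := A) ⊗ₘ ComonObj.comul (X := A)) ≫ (α_ A A (A ⊗ A)).hom ≫
      A ◁ ((α_ A A A).inv ≫ braid A A ▷ A ≫ (α_ A A A).hom) ≫ (α_ A A (A ⊗ A)).inv ≫
      (MonObj.mul ⊗ₘ MonObj.mul)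
  one_comul : MonObj.one (X := A) ≫ ComonObj.comul =
    (λ_ (𝟙_ (YetterDrinfeld k H))).inv ≫ (MonObj.one ⊗ₘ MonObj.one)
  mul_counit : MonObj.mul (X := A) ≫ ComonObj.counit =
    (ComonObj.counit ⊗ₘ ComonObj.counit) ≫ (λ_ (𝟙_ (YetterDrinfeld k H))).hom
  one_counit : MonObj.one (X := A) ≫ ComonObj.counit = 𝟙 (𝟙_ (YetterDrinfeld k H))

/-- A morphism `ev : E ⊗ V ⟶ 𝟙_` exhibits `E` as the internal hom `hom(V, 𝟙_)`, the value at the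
unit object of the right adjoint of `- ⊗ V`. -/
def IsInternalDual {E V : YetterDrinfeld k H} (ev : E ⊗ V ⟶ 𝟙_ (YetterDrinfeld k H)) : Prop :=
  ∀ (X : YetterDrinfeld k H) (φ : X ⊗ V ⟶ 𝟙_ (YetterDrinfeld k H)),
    ∃! g : X ⟶ E, g ▷ V ≫ ev = φ

/-- The element `v ⊗ w` of the tensor product of two Yetter-Drinfeld modules. -/
noncomputable def tmul {V W : YetterDrinfeld k H} (v : V) (w : W) :
    (V ⊗ W : YetterDrinfeld k H) :=
  (v ⊗ₜ[k] w : V ⊗[k] W)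

/-- The functional `v ⊗ w ↦ φ v * ψ w` on `V ⊗ W`. -/
noncomputable def tensorDual {V W : YetterDrinfeld k H} (φ : Module.Dual k V)
    (ψ : Module.Dual k W) : Module.Dual k (V ⊗ W : YetterDrinfeld k H) :=
  (LinearMap.mul' k k ∘ₗ TensorProduct.map φ ψ : V ⊗[k] W →ₗ[k] k)

/-- The underlying linear functional of a morphism `V ⟶ 𝟙_`. -/
def toDual {V : YetterDrinfeld k H} (φ : V ⟶ 𝟙_ (YetterDrinfeld k H)) : Module.Dual k V :=
  φ.lin

/-- The objects `S_n(A) = A ⊗ ⋯ ⊗ A` (`n` factors), associated to the left. -/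
noncomputable def S (A : YetterDrinfeld k H) : ℕ → YetterDrinfeld k H
  | 0 => 𝟙_ _
  | n + 1 => S A n ⊗ A

section Bar

variable (A : YetterDrinfeld k H) [MonObj A] [ComonObj A]

/-- The `i`-th face `S_{n+1}(A) ⟶ S_n(A)`, `0 ≤ i ≤ n + 1`: it applies the counit to the first
factor if `i = 0` and to the last factor if `i = n + 1`, and otherwise it multiplies the `i`-th
and the `(i+1)`-st factor. -/
noncomputable def face : (n : ℕ) → ℕ → (S A (n + 1) ⟶ S A n)
  | 0, _ => 𝟙_ _ ◁ ComonObj.counit (X := A) ≫ (ρ_ (𝟙_ (YetterDrinfeld k H))).hom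
  | n + 1, i =>
    if i = n + 2 then S A (n + 1) ◁ ComonObj.counit (X := A) ≫ (ρ_ (S A (n + 1))).hom
    else if i = n + 1 then (α_ (S A n) A A).hom ≫ S A n ◁ MonObj.mul (X := A)
    else face n i ▷ A

/-- The differential `δ_n = ∑ (-1) ^ i ∂_i : S_{n+1}(A) ⟶ S_n(A)`. -/
noncomputable def barDifferential (n : ℕ) : S A (n + 1) ⟶ S A n :=
  ∑ i ∈ Finset.range (n + 2), (-1 : ℤ) ^ i • face A n i

end Bar

/-- The deconcatenation `S_{p+q}(A) ⟶ S_p(A) ⊗ S_q(A)`. -/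
noncomputable def dec (A : YetterDrinfeld k H) (p : ℕ) : (q : ℕ) → (S A (p + q) ⟶ S A p ⊗ S A q)
  | 0 => (ρ_ (S A p)).inv
  | q + 1 => dec A p q ▷ A ≫ (α_ (S A p) (S A q) A).hom

end

end YetterDrinfeld

/-! The commutativity is that of a cup-one product, and everything is proved for coproducts on
tensor powers before dualizing. The cup product is the transpose of the deconcatenation `decon`. The
homotopy is the transpose of a map `cupOne A q p n : S_n → S_q ⊗ S_p`, where n + 1 = q + p. Its
construction rests on the codiagonal coaction `lam` of `A` on its own tensor powers, x₁ ⊗ … ⊗ x_p ↦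
x₁'⋯x_p' ⊗ x₁'' ⊗ … ⊗ x_p'' up to braidings.

The map `cupOne` is a signed sum over all blocks of p consecutive letters in a word of n letters.
The coefficient of the block under `lam` is put in its place as one letter of S_q; what remains of
the block is carried to the right as an element of S_p, the later letters being braided past it.
Since Δ is multiplicative, the inner faces commute with `lam`, while the first and last faces
multiply the coefficient by the first or last letter (`lam_barDifferential`). Hence in the boundary
of `cupOne` everything cancels in pairs but two terms. The block at the front of the word leaves
deconcatenation followed by the braiding; the block at the end leaves the other deconcatenation.
This is `barDifferential_cupOne`, obtained from `frontDiff_cupOne` by induction on q. Only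
naturality, the hexagons and the unit laws of the braiding are used, not its invertibility.

On Hom(V, k) an element h acts through S(h), and the coaction is v₍₋₁₎ ↦ S⁻¹(v₍₋₁₎). For this S must
be bijective and H ⊗ V* → Hom(V, H) must be an isomorphism, which holds if H or V is finite
dimensional (`contract_bijective`). When H is finite dimensional, S is bijective by
`antipode_bijective_of_finite`.

The evaluation of V* ⊗ W* on W ⊗ V is nested, so transposing N → W ⊗ V to a product V* ⊗ W* → N*
reverses the order of the factors. That is why the opposite cup product is the one that lives in
Yetter–Drinfeld modules. The braiding of duals is the transpose of the braiding (`braid_pair`), so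
identities between coproducts transpose to identities between products. -/

namespace YetterDrinfeld

/-! ### Hexagon and unit identities of the Yetter–Drinfeld braiding. -/

section Braiding

variable {k : Type u} [Field k] {H : Type v} [Ring H] [HopfAlgebra k H]
variable {V W X : YetterDrinfeld k H}

/-- The first hexagon identity. -/
lemma braid_tensor_right (V W X : YetterDrinfeld k H) :
    braid V (W ⊗ X) = (α_ V W X).inv ≫ braid V W ▷ X ≫ (α_ W V X).hom ≫ W ◁ braid V X ≫
      (α_ W X V).inv := by
  apply hom_ext
  refine TensorProduct.ext (LinearMap.ext fun v => TensorProduct.ext' fun w x => ?_)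
  change braidLin k V.coact (tensorAct k W.act X.act) (v ⊗ₜ (w ⊗ₜ x)) =
    (TensorProduct.assoc k W X V).symm ((braidLin k V.coact X.act).lTensor W
      (TensorProduct.assoc k W V X ((braidLin k V.coact W.act (v ⊗ₜ w)) ⊗ₜ x)))
  have c := LinearMap.congr_fun V.coassoc v
  -- Both sides are `F` applied to the twofold coaction of `v`. On the left it arises by
  -- comultiplying the coefficient, on the right by coacting twice, so coassociativity identifies
  -- them.
  let F : H ⊗[k] (H ⊗[k] V) →ₗ[k] (W ⊗[k] X) ⊗[k] V :=
    (TensorProduct.assoc k W X V).symm.toLinearMap ∘ₗ TensorProduct.map (W.act.toLinearMap.flip w)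
      (TensorProduct.map (X.act.toLinearMap.flip x) LinearMap.id)
  have e1 : TensorProduct.map ((tensorAct k W.act X.act).toLinearMap.flip (w ⊗ₜ x))
      LinearMap.id = F ∘ₗ (TensorProduct.assoc k H H V).toLinearMap ∘ₗ
        (Coalgebra.comul (R := k) (A := H)).rTensor V := by
    ext a y
    simp only [TensorProduct.AlgebraTensorModule.curry_apply, TensorProduct.curry_apply,
      LinearMap.coe_restrictScalars, LinearMap.comp_apply, TensorProduct.map_tmul,
      LinearMap.flip_apply, AlgHom.toLinearMap_apply, LinearMap.rTensor_tmul, tensorAct_tmul]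
    generalize (Coalgebra.comul a : H ⊗[k] H) = t
    induction t with
    | zero => simp
    | add x y hx hy => simp only [map_add, TensorProduct.add_tmul, hx, hy]
    | tmul c d => simp [F]
  have h1 := LinearMap.congr_fun e1 (V.coact v)
  have b1 := braidLin_tmul V (tensor W X) v (w ⊗ₜ x)
  rw [braidLin_tmul]
  refine b1.trans (h1.trans ((congrArg F c).trans ?_))
  change F (V.coact.lTensor H (V.coact v)) = _
  generalize V.coact v = t
  induction t with
  | zero => simp
  | add x y hx hy => simp only [map_add, TensorProduct.add_tmul, hx, hy]
  | tmul a y => simp [F, braidLin_tmul]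

/-- The second hexagon identity. -/
lemma braid_tensor_left (V W X : YetterDrinfeld k H) :
    braid (V ⊗ W) X = (α_ V W X).hom ≫ V ◁ braid W X ≫ (α_ V X W).inv ≫ braid V X ▷ W ≫
      (α_ X V W).hom := by
  apply hom_ext
  refine TensorProduct.ext_threefold fun v w x => ?_
  change braidLin k (tensorCoact k V.coact W.coact) X.act ((v ⊗ₜ w) ⊗ₜ x) =
    TensorProduct.assoc k X V W ((braidLin k V.coact X.act).rTensor W
      ((TensorProduct.assoc k V X W).symm (v ⊗ₜ (braidLin k W.coact X.act (w ⊗ₜ x)))))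
  have b1 := braidLin_tmul (tensor V W) X (v ⊗ₜ w) x
  rw [braidLin_tmul]
  refine b1.trans ?_
  rw [tensorCoact_tmul]
  generalize W.coact w = t
  induction t with
  | zero => simp
  | add x y hx hy => simp only [map_add, TensorProduct.tmul_add, hx, hy]
  | tmul b w =>
    simp only [TensorProduct.map_tmul, LinearMap.flip_apply, AlgHom.toLinearMap_apply,
      LinearMap.id_apply, TensorProduct.assoc_symm_tmul, LinearMap.rTensor_tmul, braidLin_tmul]
    generalize V.coact v = s
    induction s with
    | zero => simp
    | add x y hx hy => simp only [map_add, TensorProduct.add_tmul, hx, hy]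
    | tmul a v => simp

lemma braid_unit_left (X : YetterDrinfeld k H) :
    braid (𝟙_ _) X = (λ_ X).hom ≫ (ρ_ X).inv := by
  apply hom_ext
  refine TensorProduct.ext' fun r x => ?_
  change braidLin k (unit k H).coact X.act (r ⊗ₜ x) = (r • x) ⊗ₜ[k] (1 : k)
  have b1 := braidLin_tmul (unit k H) X r x
  refine b1.trans ?_
  simp [TensorProduct.smul_tmul]

/-- `H` acts on the unit object through its counit, so this is the counit axiom of the coaction of
`V`. -/
lemma braid_unit_right (V : YetterDrinfeld k H) :
    braid V (𝟙_ _) = (ρ_ V).hom ≫ (λ_ V).inv := by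
  apply hom_ext
  refine TensorProduct.ext' fun v r => ?_
  change braidLin k V.coact (unit k H).act (v ⊗ₜ r) = (1 : k) ⊗ₜ[k] (r • v)
  have b1 := braidLin_tmul V (unit k H) v r
  have c := LinearMap.congr_fun V.counit_coact v
  refine b1.trans ?_
  rw [LinearMap.id_apply] at c
  nth_rw 2 [← c]
  simp only [LinearMap.comp_apply]
  generalize V.coact v = t
  induction t with
  | zero => simp
  | add x y hx hy => simp only [map_add, TensorProduct.tmul_add, smul_add, hx, hy]
  | tmul a v =>
    simp [TensorProduct.smul_tmul', TensorProduct.tmul_smul, Algebra.ofId_apply,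
      Algebra.algebraMap_eq_smul_one, mul_comm]

end Braiding

end YetterDrinfeld

/-! ### One-letter extensions of maps between words in a prebraided monoidal category. -/

/-- A prebraiding on a monoidal category: a natural family of morphisms `X ⊗ Y ⟶ Y ⊗ X`,
not necessarily invertible, satisfying the hexagon identities. -/
structure Prebraiding (C : Type*) [Category* C] [MonoidalCategory C] where
  c (X Y : C) : X ⊗ Y ⟶ Y ⊗ X
  whiskerRight_c {X X' : C} (f : X ⟶ X') (Y : C) : f ▷ Y ≫ c X' Y = c X Y ≫ Y ◁ f
  whiskerLeft_c {X X' : C} (Y : C) (f : X ⟶ X') : Y ◁ f ≫ c Y X' = c Y X ≫ f ▷ Y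
  c_tensor_right (X Y Z : C) : c X (Y ⊗ Z) =
    (α_ X Y Z).inv ≫ c X Y ▷ Z ≫ (α_ Y X Z).hom ≫ Y ◁ c X Z ≫ (α_ Y Z X).inv
  c_tensor_left (X Y Z : C) : c (X ⊗ Y) Z =
    (α_ X Y Z).hom ≫ X ◁ c Y Z ≫ (α_ X Z Y).inv ≫ c X Z ▷ Y ≫ (α_ Z X Y).hom
  c_unit_left (X : C) : c (𝟙_ C) X = (λ_ X).hom ≫ (ρ_ X).inv
  c_unit_right (X : C) : c X (𝟙_ C) = (ρ_ X).hom ≫ (λ_ X).inv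

namespace Prebraiding

set_option linter.unusedSectionVars false

open scoped MonObj ComonObj

variable {C : Type*} [Category* C] [MonoidalCategory C]
  {A N N' Q Q' P P' M : C}

section Append

lemma whiskerRight_comp_mul (u : N ⟶ P) (m : A ⊗ A ⟶ A) :
    u ▷ A ▷ A ≫ (α_ P A A).hom ≫ P ◁ m = ((α_ N A A).hom ≫ N ◁ m) ≫ u ▷ A := by
  calc _ = (α_ N A A).hom ≫ u ▷ (A ⊗ A) ≫ P ◁ m := by monoidal
    _ = _ := by rw [← whisker_exchange]; monoidal

lemma mul_mul_whisker (N : C) (m : A ⊗ A ⟶ A)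
    (hm : m ▷ A ≫ m = (α_ A A A).hom ≫ A ◁ m ≫ m) :
    ((α_ N A A).hom ≫ N ◁ m) ▷ A ≫ (α_ N A A).hom ≫ N ◁ m =
      ((α_ (N ⊗ A) A A).hom ≫ (N ⊗ A) ◁ m) ≫ (α_ N A A).hom ≫ N ◁ m := by
  calc _ = 𝟙 _ ⊗≫ N ◁ (m ▷ A ≫ m) := by monoidal
    _ = _ := by rw [hm]; monoidal

lemma mul_counit_whisker (N : C) (m : A ⊗ A ⟶ A) (e : A ⟶ 𝟙_ C)
    (hm : m ≫ e = (e ▷ A ≫ 𝟙_ C ◁ e) ≫ (λ_ (𝟙_ C)).hom) :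
    ((α_ N A A).hom ≫ N ◁ m) ≫ N ◁ e ≫ (ρ_ N).hom =
      ((N ⊗ A) ◁ e ≫ (ρ_ (N ⊗ A)).hom) ≫ N ◁ e ≫ (ρ_ N).hom := by
  calc _ = (α_ N A A).hom ≫ N ◁ (m ≫ e) ≫ (ρ_ N).hom := by monoidal
    _ = 𝟙 _ ⊗≫ N ◁ (e ▷ A ≫ 𝟙_ C ◁ e) ⊗≫ 𝟙 _ := by rw [hm]; monoidal
    _ = _ := by rw [← whisker_exchange]; monoidal

lemma whiskerRight_comp_counit (u : N ⟶ P) (e : A ⟶ 𝟙_ C) :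
    u ▷ A ≫ P ◁ e ≫ (ρ_ P).hom = (N ◁ e ≫ (ρ_ N).hom) ≫ u := by
  rw [← whisker_exchange_assoc]; monoidal

/-- Append a factor `A` on the right of `N` and of `P`. -/
def append (A : C) (f : N ⟶ Q ⊗ P) : N ⊗ A ⟶ Q ⊗ (P ⊗ A) :=
  f ▷ A ≫ (α_ Q P A).hom

lemma append_comp (g : N' ⟶ N) (f : N ⟶ Q ⊗ P) : append A (g ≫ f) = g ▷ A ≫ append A f := by
  simp [append]

lemma append_comp_whiskerRight (f : N ⟶ Q ⊗ P) (u : Q ⟶ Q') :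
    append A (f ≫ u ▷ P) = append A f ≫ u ▷ (P ⊗ A) := by
  simp [append]

lemma append_comp_whiskerLeft (f : N ⟶ Q ⊗ P) (u : P ⟶ P') :
    append A (f ≫ Q ◁ u) = append A f ≫ Q ◁ (u ▷ A) := by
  simp [append]

lemma append_append_comp (f : N ⟶ Q ⊗ P) (m : A ⊗ A ⟶ A) :
    append A (append A f) ≫ Q ◁ ((α_ P A A).hom ≫ P ◁ m) =
      ((α_ N A A).hom ≫ N ◁ m) ≫ append A f := by
  simp only [append]
  calc _ = (α_ N A A).hom ≫ (f ▷ (A ⊗ A) ≫ (Q ⊗ P) ◁ m) ≫ (α_ Q P A).hom := by monoidal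
    _ = _ := by rw [← whisker_exchange]; monoidal

lemma append_comp_counit (f : N ⟶ Q ⊗ P) (e : A ⟶ 𝟙_ C) :
    append A f ≫ Q ◁ (P ◁ e ≫ (ρ_ P).hom) = (N ◁ e ≫ (ρ_ N).hom) ≫ f := by
  simp only [append]
  calc _ = (f ▷ A ≫ (Q ⊗ P) ◁ e) ≫ (ρ_ (Q ⊗ P)).hom := by monoidal
    _ = _ := by rw [← whisker_exchange]; monoidal

/-- Here `f` and `g` are cuts of one word at neighbouring places, and `d` splits off the letter
between them. A further letter at the far end does not disturb this; it is the inductive step of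
`decon_splitFirst`. -/
lemma append_split (f : N ⟶ (Q ⊗ A) ⊗ P) (g : N ⟶ Q ⊗ M) (d : M ⟶ A ⊗ P)
    (h : f ≫ (α_ Q A P).hom = g ≫ Q ◁ d) :
    append A f ≫ (α_ Q A (P ⊗ A)).hom = append A g ≫ Q ◁ append A d := by
  calc _ = (f ≫ (α_ Q A P).hom) ▷ A ⊗≫ 𝟙 _ := by simp only [append]; monoidal
    _ = _ := by rw [h]; simp only [append]; monoidal

lemma append_splitUnit :
    (ρ_ (Q ⊗ A)).inv ≫ (α_ Q A (𝟙_ C)).hom =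
      append A (ρ_ Q).inv ≫ Q ◁ ((λ_ A).hom ≫ (ρ_ A).inv) := by
  simp only [append]; monoidal

lemma comp_splitUnit_assoc (f : N ⟶ Q ⊗ P) :
    f ≫ Q ◁ (ρ_ P).inv ≫ (α_ Q P (𝟙_ C)).inv = (ρ_ N).inv ≫ f ▷ 𝟙_ C := by
  monoidal

lemma append_leftUnitor_inv : append A (λ_ P).inv = (λ_ (P ⊗ A)).inv := by
  simp only [append]; monoidal

lemma append_assoc (f : N ⟶ Q ⊗ P) (g : P ⟶ M ⊗ P') (g' : N ⟶ N' ⊗ P') (f' : N' ⟶ Q ⊗ M)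
    (h : f ≫ Q ◁ g ≫ (α_ Q M P').inv = g' ≫ f' ▷ P') :
    append A f ≫ Q ◁ append A g ≫ (α_ Q M (P' ⊗ A)).inv = append A g' ≫ f' ▷ (P' ⊗ A) := by
  calc _ = (f ≫ Q ◁ g ≫ (α_ Q M P').inv) ▷ A ⊗≫ 𝟙 _ := by simp only [append]; monoidal
    _ = _ := by rw [h]; simp only [append]; monoidal

end Append

/-- Apply `l` to the second factor, and append the factor `A` so obtained to the first one. -/
def attach (f : N ⟶ Q ⊗ P) (l : P ⟶ A ⊗ P') : N ⟶ (Q ⊗ A) ⊗ P' :=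
  f ≫ Q ◁ l ≫ (α_ Q A P').inv

lemma attach_comp (u : N' ⟶ N) (f : N ⟶ Q ⊗ P) (l : P ⟶ A ⊗ P') :
    attach (u ≫ f) l = u ≫ attach f l := by
  simp [attach]

lemma attach_comp_whiskerRight (f : N ⟶ Q ⊗ P) (u : Q ⟶ Q') (l : P ⟶ A ⊗ P') :
    attach (f ≫ u ▷ P) l = attach f l ≫ (u ▷ A) ▷ P' := by
  simp only [attach]
  rw [Category.assoc, ← whisker_exchange_assoc]
  simp

lemma attach_comp_whiskerLeft (f : N ⟶ Q ⊗ P) (u : P ⟶ P') (l : P' ⟶ A ⊗ M) :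
    attach (f ≫ Q ◁ u) l = attach f (u ≫ l) := by
  simp [attach]

lemma attach_whiskerLeft (f : N ⟶ Q ⊗ P) (l : P ⟶ A ⊗ P') (u : P' ⟶ M) :
    attach f (l ≫ A ◁ u) = attach f l ≫ (Q ⊗ A) ◁ u := by
  simp [attach]

/-- By `h`, the last letter left of the cut `f` is the first letter right of the cut `g`.
Multiplying it with the inserted coefficient is therefore a left multiplication of the coefficient
for the longer block. -/
lemma attach_comp_mul (f : N ⟶ (Q ⊗ A) ⊗ P) (l : P ⟶ A ⊗ P') (g : N ⟶ Q ⊗ M) (d : M ⟶ A ⊗ P)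
    (h : f ≫ (α_ Q A P).hom = g ≫ Q ◁ d) (m : A ⊗ A ⟶ A) :
    attach f l ≫ ((α_ Q A A).hom ≫ Q ◁ m) ▷ P' =
      attach g (d ≫ A ◁ l ≫ (α_ A A P').inv ≫ m ▷ P') := by
  calc _ = (f ≫ (α_ Q A P).hom) ≫ Q ◁ (A ◁ l ≫ (α_ A A P').inv ≫ m ▷ P') ≫ (α_ Q A P').inv := by
        simp only [attach]; monoidal
    _ = _ := by rw [h]; simp [attach]

lemma attach_comp_counit (f : N ⟶ Q ⊗ P) (l : P ⟶ A ⊗ P) (e : A ⟶ 𝟙_ C)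
    (hl : l ≫ e ▷ P = (λ_ P).inv) :
    attach f l ≫ (Q ◁ e ≫ (ρ_ Q).hom) ▷ P = f := by
  calc _ = f ≫ Q ◁ (l ≫ e ▷ P) ⊗≫ 𝟙 _ := by simp only [attach]; monoidal
    _ = _ := by rw [hl]; monoidal

variable (B : Prebraiding C)

/-- Append a factor `A` on the right of `N` and move it to the right of `Q` by the braiding. -/
def up (A : C) (f : N ⟶ Q ⊗ P) : N ⊗ A ⟶ (Q ⊗ A) ⊗ P :=
  append A f ≫ Q ◁ B.c P A ≫ (α_ Q A P).inv

lemma up_comp (g : N' ⟶ N) (f : N ⟶ Q ⊗ P) : B.up A (g ≫ f) = g ▷ A ≫ B.up A f := by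
  simp [up, append]

lemma up_comp_whiskerRight (f : N ⟶ Q ⊗ P) (u : Q ⟶ Q') :
    B.up A (f ≫ u ▷ P) = B.up A f ≫ (u ▷ A) ▷ P := by
  simp only [up, append]
  calc _ = f ▷ A ⊗≫ (u ▷ (P ⊗ A) ≫ Q' ◁ B.c P A) ⊗≫ 𝟙 _ := by monoidal
    _ = _ := by rw [← whisker_exchange]; monoidal

lemma up_comp_whiskerLeft (f : N ⟶ Q ⊗ P) (u : P ⟶ P') :
    B.up A (f ≫ Q ◁ u) = B.up A f ≫ (Q ⊗ A) ◁ u := by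
  simp only [up, append]
  calc _ = f ▷ A ⊗≫ Q ◁ (u ▷ A ≫ B.c P' A) ⊗≫ 𝟙 _ := by monoidal
    _ = _ := by rw [B.whiskerRight_c]; monoidal

/-- Two letters moved past `P` one after the other are moved as a pair, by the hexagon; naturality
of the braiding then lets the multiplication happen beforehand. -/
lemma up_up_comp (f : N ⟶ Q ⊗ P) (m : A ⊗ A ⟶ A) :
    B.up A (B.up A f) ≫ ((α_ Q A A).hom ≫ Q ◁ m) ▷ P =
      ((α_ N A A).hom ≫ N ◁ m) ≫ B.up A f := by
  simp only [up, append]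
  calc _ = f ▷ A ▷ A ⊗≫ Q ◁ ((α_ P A A).inv ≫ B.c P A ▷ A ≫ (α_ A P A).hom ≫ A ◁ B.c P A ≫
      (α_ A A P).inv) ⊗≫ Q ◁ m ▷ P ⊗≫ 𝟙 _ := by monoidal
    _ = f ▷ A ▷ A ⊗≫ Q ◁ (B.c P (A ⊗ A) ≫ m ▷ P) ⊗≫ 𝟙 _ := by
      rw [← B.c_tensor_right]; monoidal
    _ = (α_ N A A).hom ≫ (f ▷ (A ⊗ A) ≫ (Q ⊗ P) ◁ m) ⊗≫ Q ◁ B.c P A ⊗≫ 𝟙 _ := by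
      rw [← B.whiskerLeft_c]; monoidal
    _ = _ := by rw [← whisker_exchange]; monoidal

lemma up_comp_counit (f : N ⟶ Q ⊗ P) (e : A ⟶ 𝟙_ C) :
    B.up A f ≫ (Q ◁ e ≫ (ρ_ Q).hom) ▷ P = (N ◁ e ≫ (ρ_ N).hom) ≫ f := by
  simp only [up]
  calc _ = append A f ⊗≫ Q ◁ (B.c P A ≫ e ▷ P) ⊗≫ 𝟙 _ := by monoidal
    _ = append A f ⊗≫ Q ◁ P ◁ e ⊗≫ 𝟙 _ := by
      rw [← B.whiskerLeft_c, B.c_unit_right]; monoidal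
    _ = append A f ≫ Q ◁ (P ◁ e ≫ (ρ_ P).hom) := by monoidal
    _ = _ := append_comp_counit _ _

/-- This grows a deconcatenation followed by the braiding one letter at a time, as the induction for
the homotopy formula requires. -/
lemma up_comp_c (f : N ⟶ P ⊗ Q) : B.up A (f ≫ B.c P Q) = append A f ≫ B.c P (Q ⊗ A) := by
  rw [B.c_tensor_right]
  simp [up, append]

/-- The codiagonal coaction on `P ⊗ A` of a comonoid and monoid `A`. -/
def coext [MonObj A] [ComonObj A] (l : N ⟶ A ⊗ P) : N ⊗ A ⟶ A ⊗ (P ⊗ A) :=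
  (l ▷ A ≫ (A ⊗ P) ◁ Δ[A]) ≫ (α_ A P (A ⊗ A)).hom ≫
    A ◁ ((α_ P A A).inv ≫ B.c P A ▷ A ≫ (α_ A P A).hom) ≫ (α_ A A (P ⊗ A)).inv ≫
      μ[A] ▷ (P ⊗ A)

/-- Multiply the coefficient of a coaction by a further factor on the right. -/
def mulRight [MonObj A] (l : N ⟶ A ⊗ P) : N ⊗ A ⟶ A ⊗ P :=
  append A l ≫ A ◁ B.c P A ≫ (α_ A A P).inv ≫ μ[A] ▷ P

/-! ### The codiagonal coaction and its behaviour under the faces. -/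

section Coaction

variable [MonObj A] [ComonObj A]

lemma coext_comp (g : N' ⟶ N) (l : N ⟶ A ⊗ P) : B.coext (g ≫ l) = g ▷ A ≫ B.coext l := by
  simp [coext]

lemma coext_comp_whiskerLeft (l : N ⟶ A ⊗ P) (u : P ⟶ P') :
    B.coext (l ≫ A ◁ u) = B.coext l ≫ A ◁ (u ▷ A) := by
  simp only [coext]
  symm
  calc _ = l ▷ A ≫ (A ⊗ P) ◁ Δ[A] ⊗≫ A ◁ B.c P A ▷ A ⊗≫
        (μ[A] ▷ (P ⊗ A) ≫ A ◁ (u ▷ A)) ⊗≫ 𝟙 _ := by monoidal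
    _ = l ▷ A ≫ (A ⊗ P) ◁ Δ[A] ⊗≫ A ◁ (B.c P A ≫ A ◁ u) ▷ A ⊗≫
        μ[A] ▷ (P' ⊗ A) ⊗≫ 𝟙 _ := by
          rw [← whisker_exchange]; monoidal
    _ = l ▷ A ≫ ((A ⊗ P) ◁ Δ[A] ≫ (A ◁ u) ▷ (A ⊗ A)) ⊗≫ A ◁ B.c P' A ▷ A ⊗≫
        μ[A] ▷ (P' ⊗ A) ⊗≫ 𝟙 _ := by
          rw [← B.whiskerRight_c]; monoidal
    _ = _ := by rw [whisker_exchange]; monoidal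

/-- The counit removes the second leg of the new letter's coproduct, so the whole letter passes into
the coefficient. -/
lemma coext_comp_counit (l : N ⟶ A ⊗ P) :
    B.coext l ≫ A ◁ (P ◁ ε[A] ≫ (ρ_ P).hom) = B.mulRight l := by
  simp only [coext, mulRight, append]
  calc _ = l ▷ A ≫ (A ⊗ P) ◁ Δ[A] ⊗≫ A ◁ B.c P A ▷ A ⊗≫
        (μ[A] ▷ (P ⊗ A) ≫ A ◁ (P ◁ ε[A])) ⊗≫ 𝟙 _ := by
          monoidal
    _ = l ▷ A ≫ (A ⊗ P) ◁ Δ[A] ⊗≫ A ◁ (B.c P A ▷ A ≫ (A ⊗ P) ◁ ε[A]) ⊗≫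
        μ[A] ▷ P ⊗≫ 𝟙 _ := by
          rw [← whisker_exchange]; monoidal
    _ = l ▷ A ≫ (A ⊗ P) ◁ (Δ[A] ≫ A ◁ ε[A]) ⊗≫ A ◁ B.c P A ⊗≫
        μ[A] ▷ P ⊗≫ 𝟙 _ := by
          rw [← whisker_exchange]; monoidal
    _ = _ := by rw [ComonObj.comul_counit]; monoidal

lemma coext_counital (l : P ⟶ A ⊗ P)
    (hl : l ≫ ε[A] ▷ P = (λ_ P).inv)
    (hm : μ[A] ≫ ε[A] =
      (ε[A] ▷ A ≫ 𝟙_ C ◁ ε[A]) ≫ (λ_ (𝟙_ C)).hom) :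
    B.coext l ≫ ε[A] ▷ (P ⊗ A) = (λ_ (P ⊗ A)).inv := by
  simp only [coext]
  calc _ = l ▷ A ≫ (A ⊗ P) ◁ Δ[A] ⊗≫ A ◁ B.c P A ▷ A ⊗≫
        (μ[A] ≫ ε[A]) ▷ (P ⊗ A) ⊗≫ 𝟙 _ := by
          monoidal
    _ = l ▷ A ≫ ((A ⊗ P) ◁ Δ[A] ⊗≫ A ◁ (B.c P A ▷ A) ⊗≫
        (ε[A] ▷ (A ⊗ P ⊗ A))) ⊗≫ (ε[A] ▷ (P ⊗ A)) ⊗≫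
          𝟙 _ := by
          rw [hm]; monoidal
    _ = l ▷ A ≫ ((A ⊗ P) ◁ Δ[A] ≫ (α_ _ _ _).hom ≫ A ◁ ((α_ P A A).inv ≫ B.c P A ▷ A
        ≫ (α_ A P A).hom) ≫ ε[A] ▷ (A ⊗ P ⊗ A)) ⊗≫
          (ε[A] ▷ (P ⊗ A)) ⊗≫ 𝟙 _ := by monoidal
    _ = l ▷ A ≫ ((A ⊗ P) ◁ Δ[A] ≫ (α_ _ _ _).hom ≫
        ε[A] ▷ (P ⊗ A ⊗ A)) ⊗≫ (B.c P A ≫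
          (ε[A] ▷ P)) ▷ A ⊗≫ 𝟙 _ := by
          rw [whisker_exchange]; monoidal
    _ = l ▷ A ≫ ((A ⊗ P) ◁ Δ[A] ≫
        (ε[A] ▷ P) ▷ (A ⊗ A)) ⊗≫ P ◁ (ε[A] ▷ A) ⊗≫
          𝟙 _ := by
          rw [← B.whiskerLeft_c, B.c_unit_right]; monoidal
    _ = (l ≫ ε[A] ▷ P) ▷ A ⊗≫ P ◁ (Δ[A] ≫
        (ε[A] ▷ A)) ⊗≫ 𝟙 _ := by
          rw [whisker_exchange]; monoidal
    _ = _ := by rw [hl, ComonObj.counit_comul]; monoidal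

/-- The new letter contributes to the coefficient at the far right and `g` at the far left, so
associativity of `μ` suffices. -/
lemma coext_mul (g : N ⟶ A ⊗ P) (l : P ⟶ A ⊗ P') :
    B.coext (g ≫ A ◁ l ≫ (α_ A A P').inv ≫ μ[A] ▷ P') =
      append A g ≫ A ◁ B.coext l ≫ (α_ A A (P' ⊗ A)).inv ≫ μ[A] ▷ (P' ⊗ A) := by
  simp only [coext, append]
  calc _ = g ▷ A ⊗≫ A ◁ l ▷ A ⊗≫ ((μ[A] ▷ P') ▷ A ≫ (A ⊗ P') ◁ Δ[A]) ⊗≫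
        A ◁ B.c P' A ▷ A ⊗≫ μ[A] ▷ (P' ⊗ A) ⊗≫ 𝟙 _ := by monoidal
    _ = g ▷ A ⊗≫ A ◁ l ▷ A ⊗≫ (A ⊗ A ⊗ P') ◁ Δ[A] ⊗≫ (μ[A] ▷ ((P' ⊗ A) ⊗ A) ≫
        A ◁ (B.c P' A ▷ A)) ⊗≫ μ[A] ▷ (P' ⊗ A) ⊗≫ 𝟙 _ := by
      rw [← whisker_exchange]; monoidal
    _ = g ▷ A ⊗≫ A ◁ l ▷ A ⊗≫ (A ⊗ A ⊗ P') ◁ Δ[A] ⊗≫ (A ⊗ A) ◁ (B.c P' A ▷ A) ⊗≫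
        (μ[A] ▷ A ≫ μ[A]) ▷ (P' ⊗ A) ⊗≫ 𝟙 _ := by
      rw [← whisker_exchange]; monoidal
    _ = _ := by rw [MonObj.mul_assoc]; monoidal

/-- This is where multiplicativity of the comultiplication enters. After expanding Δ of the product,
one hexagon separates the two letters crossing `P`, the other one joins the crossings of `P` and of
a leg of the first letter, and associativity regroups the coefficient. -/
lemma coext_coext_comp_mul (l : N ⟶ A ⊗ P)
    (hA : μ[A] ≫ Δ[A] =
      (Δ[A] ▷ A ≫ (A ⊗ A) ◁ Δ[A]) ≫ (α_ A A (A ⊗ A)).hom ≫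
        A ◁ ((α_ A A A).inv ≫ B.c A A ▷ A ≫ (α_ A A A).hom) ≫ (α_ A A (A ⊗ A)).inv ≫
          (μ[A] ▷ (A ⊗ A) ≫ A ◁ μ[A])) :
    B.coext (B.coext l) ≫ A ◁ ((α_ P A A).hom ≫ P ◁ μ[A]) =
      ((α_ N A A).hom ≫ N ◁ μ[A]) ≫ B.coext l := by
  simp only [coext]
  symm
  calc _ = (α_ N A A).hom ≫ (N ◁ μ[A] ≫ l ▷ A) ≫ (A ⊗ P) ◁ Δ[A] ⊗≫
        A ◁ B.c P A ▷ A ⊗≫ μ[A] ▷ (P ⊗ A) ⊗≫ 𝟙 _ := by monoidal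
    _ = l ▷ A ▷ A ⊗≫ (A ⊗ P) ◁ (μ[A] ≫ Δ[A]) ⊗≫
        A ◁ B.c P A ▷ A ⊗≫ μ[A] ▷ (P ⊗ A) ⊗≫ 𝟙 _ := by
      rw [whisker_exchange]; monoidal
    _ = l ▷ A ▷ A ⊗≫ (A ⊗ P) ◁ (Δ[A] ▷ A ≫ (A ⊗ A) ◁ Δ[A]) ⊗≫
        (A ⊗ P ⊗ A) ◁ B.c A A ▷ A ⊗≫ (A ⊗ P) ◁ μ[A] ▷ (A ⊗ A) ⊗≫
        A ◁ ((P ⊗ A) ◁ μ[A] ≫ B.c P A ▷ A) ⊗≫ μ[A] ▷ (P ⊗ A) ⊗≫ 𝟙 _ := by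
      rw [hA]; monoidal
    _ = l ▷ A ▷ A ⊗≫ (A ⊗ P) ◁ (Δ[A] ▷ A ≫ (A ⊗ A) ◁ Δ[A]) ⊗≫
        (A ⊗ P ⊗ A) ◁ B.c A A ▷ A ⊗≫ A ◁ (P ◁ μ[A] ≫ B.c P A) ▷ (A ⊗ A) ⊗≫
        ((A ⊗ A) ◁ (P ◁ μ[A]) ≫ μ[A] ▷ (P ⊗ A)) ⊗≫ 𝟙 _ := by
      rw [whisker_exchange]; monoidal
    -- The product of the two first legs crosses `P`; by naturality both legs cross first and are
    -- multiplied afterwards.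
    _ = l ▷ A ▷ A ⊗≫ (A ⊗ P) ◁ (Δ[A] ▷ A ≫ (A ⊗ A) ◁ Δ[A]) ⊗≫
        (A ⊗ P ⊗ A) ◁ B.c A A ▷ A ⊗≫ A ◁ (B.c P (A ⊗ A) ≫ μ[A] ▷ P) ▷ (A ⊗ A) ⊗≫
        (μ[A] ▷ (P ⊗ (A ⊗ A)) ≫ A ◁ (P ◁ μ[A])) ⊗≫ 𝟙 _ := by
      rw [B.whiskerLeft_c, whisker_exchange]
    _ = l ▷ A ▷ A ⊗≫ (A ⊗ P) ◁ (Δ[A] ▷ A ≫ (A ⊗ A) ◁ Δ[A]) ⊗≫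
        (A ⊗ P ⊗ A) ◁ B.c A A ▷ A ⊗≫ A ◁ B.c P A ▷ (A ⊗ A ⊗ A) ⊗≫
        (A ⊗ A) ◁ B.c P A ▷ (A ⊗ A) ⊗≫ (A ◁ μ[A] ≫ μ[A]) ▷ (P ⊗ (A ⊗ A)) ⊗≫
        A ◁ (P ◁ μ[A]) ⊗≫ 𝟙 _ := by
      rw [B.c_tensor_right]; monoidal
    _ = l ▷ A ▷ A ⊗≫ (A ⊗ P) ◁ (Δ[A] ▷ A ≫ (A ⊗ A) ◁ Δ[A]) ⊗≫
        A ◁ ((P ⊗ A) ◁ (B.c A A ▷ A) ≫ B.c P A ▷ ((A ⊗ A) ⊗ A)) ⊗≫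
        (A ⊗ A) ◁ B.c P A ▷ (A ⊗ A) ⊗≫ (μ[A] ▷ A ≫ μ[A]) ▷ (P ⊗ (A ⊗ A)) ⊗≫
        A ◁ (P ◁ μ[A]) ⊗≫ 𝟙 _ := by
      rw [MonObj.mul_assoc]; monoidal
    _ = l ▷ A ▷ A ⊗≫ (A ⊗ P) ◁ (Δ[A] ▷ A) ⊗≫
        A ◁ ((P ⊗ A) ◁ (A ◁ Δ[A]) ≫ B.c P A ▷ (A ⊗ (A ⊗ A))) ⊗≫
        (A ⊗ A ⊗ P) ◁ (B.c A A ▷ A) ⊗≫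
        (A ⊗ A) ◁ B.c P A ▷ (A ⊗ A) ⊗≫ (μ[A] ▷ A ≫ μ[A]) ▷ (P ⊗ (A ⊗ A)) ⊗≫
        A ◁ (P ◁ μ[A]) ⊗≫ 𝟙 _ := by
      rw [whisker_exchange]; monoidal
    -- The first leg of the second letter crosses the second leg of the first letter and then `P`;
    -- the hexagon makes this a single crossing of `P ⊗ A`, as in the iterated coaction.
    _ = l ▷ A ▷ A ⊗≫ (A ⊗ P) ◁ (Δ[A] ▷ A) ⊗≫
        A ◁ (B.c P A ▷ (A ⊗ A)) ⊗≫ (A ⊗ A ⊗ P ⊗ A) ◁ Δ[A] ⊗≫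
        (A ⊗ A) ◁ (B.c (P ⊗ A) A ▷ A) ⊗≫ (μ[A] ▷ A ≫ μ[A]) ▷ (P ⊗ (A ⊗ A)) ⊗≫
        A ◁ (P ◁ μ[A]) ⊗≫ 𝟙 _ := by
      rw [whisker_exchange, B.c_tensor_left]; monoidal
    _ = l ▷ A ▷ A ⊗≫ (A ⊗ P) ◁ (Δ[A] ▷ A) ⊗≫
        A ◁ (B.c P A ▷ (A ⊗ A)) ⊗≫ (A ⊗ A ⊗ P ⊗ A) ◁ Δ[A] ⊗≫
        ((A ⊗ A) ◁ (B.c (P ⊗ A) A ▷ A) ≫ μ[A] ▷ ((A ⊗ P ⊗ A) ⊗ A)) ⊗≫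
        μ[A] ▷ (P ⊗ (A ⊗ A)) ⊗≫ A ◁ (P ◁ μ[A]) ⊗≫ 𝟙 _ := by monoidal
    _ = l ▷ A ▷ A ⊗≫ (A ⊗ P) ◁ (Δ[A] ▷ A) ⊗≫
        A ◁ (B.c P A ▷ (A ⊗ A)) ⊗≫ ((A ⊗ A) ◁ ((P ⊗ A) ◁ Δ[A]) ≫
        μ[A] ▷ ((P ⊗ A) ⊗ (A ⊗ A))) ⊗≫ A ◁ (B.c (P ⊗ A) A ▷ A) ⊗≫
        μ[A] ▷ (P ⊗ (A ⊗ A)) ⊗≫ A ◁ (P ◁ μ[A]) ⊗≫ 𝟙 _ := by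
      rw [whisker_exchange]; monoidal
    _ = _ := by rw [whisker_exchange]; monoidal

/-- A letter braided past the remainder of the block lands next to the inserted coefficient, so
multiplying the two is a right multiplication of the coefficient for the longer block. -/
lemma up_attach_comp_mul (f : N ⟶ Q ⊗ P) (l : P ⟶ A ⊗ P') :
    B.up A (attach f l) ≫ ((α_ Q A A).hom ≫ Q ◁ μ[A]) ▷ P' =
      attach (append A f) (B.mulRight l) := by
  simp only [up, mulRight, append, attach]
  monoidal

lemma mulRight_one :
    B.mulRight (η[A] ≫ (ρ_ A).inv) = (λ_ A).hom ≫ (ρ_ A).inv := by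
  simp only [mulRight, append]
  rw [B.c_unit_left]
  calc _ = (η[A] ▷ A ≫ μ[A]) ≫ (ρ_ A).inv := by monoidal
    _ = _ := by rw [MonObj.one_mul]

lemma mulLeft_one :
    (λ_ A).hom ≫ (ρ_ A).inv ≫ A ◁ (η[A] ≫ (ρ_ A).inv) ≫ (α_ A A (𝟙_ C)).inv ≫ μ[A] ▷ 𝟙_ C =
      (λ_ A).hom ≫ (ρ_ A).inv := by
  calc _ = (λ_ A).hom ≫ (ρ_ A).inv ≫ (A ◁ η[A] ≫ μ[A]) ≫ (ρ_ A).inv := by monoidal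
    _ = _ := by rw [MonObj.mul_one]; simp

lemma one_counital (h : η[A] ≫ ε[A] = 𝟙 (𝟙_ C)) :
    (η[A] ≫ (ρ_ A).inv) ≫ ε[A] ▷ 𝟙_ C = (λ_ (𝟙_ C)).inv := by
  calc _ = (η[A] ≫ ε[A]) ≫ (ρ_ (𝟙_ C)).inv := by monoidal
    _ = _ := by rw [h]; monoidal

end Coaction

section Preadditive

variable [Preadditive C] [MonoidalPreadditive C]

lemma zsmul_whiskerRight (n : ℤ) (f : N ⟶ P) (A : C) : (n • f) ▷ A = n • f ▷ A :=
  (tensorRight A).map_zsmul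

lemma whiskerLeft_zsmul (n : ℤ) (f : N ⟶ P) (A : C) : A ◁ (n • f) = n • A ◁ f :=
  (tensorLeft A).map_zsmul

@[simp] lemma append_zero : append A (0 : N ⟶ Q ⊗ P) = 0 := by simp [append]

lemma append_add (f g : N ⟶ Q ⊗ P) : append A (f + g) = append A f + append A g := by
  simp [append]

lemma append_zsmul (n : ℤ) (f : N ⟶ Q ⊗ P) : append A (n • f) = n • append A f := by
  simp [append, zsmul_whiskerRight]

lemma add_attach (f g : N ⟶ Q ⊗ P) (l : P ⟶ A ⊗ P') :
    attach (f + g) l = attach f l + attach g l := by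
  simp [attach]

lemma zsmul_attach (c : ℤ) (f : N ⟶ Q ⊗ P) (l : P ⟶ A ⊗ P') :
    attach (c • f) l = c • attach f l := by
  simp [attach]

lemma attach_add (f : N ⟶ Q ⊗ P) (l l' : P ⟶ A ⊗ P') :
    attach f (l + l') = attach f l + attach f l' := by
  simp [attach]

lemma attach_zsmul (c : ℤ) (f : N ⟶ Q ⊗ P) (l : P ⟶ A ⊗ P') :
    attach f (c • l) = c • attach f l := by
  simp [attach, whiskerLeft_zsmul]

@[simp] lemma up_zero : B.up A (0 : N ⟶ Q ⊗ P) = 0 := by simp [up]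

lemma up_add (f g : N ⟶ Q ⊗ P) : B.up A (f + g) = B.up A f + B.up A g := by
  simp [up, append_add]

lemma up_zsmul (n : ℤ) (f : N ⟶ Q ⊗ P) : B.up A (n • f) = n • B.up A f := by
  simp [up, append_zsmul]

end Preadditive

end Prebraiding

namespace YetterDrinfeld

set_option linter.unusedSectionVars false

open Prebraiding
open scoped MonObj ComonObj

/-! ### Tensor powers, deconcatenation and the bar differential. -/

section TensorPowers

variable {k : Type u} [Field k] {H : Type v} [Ring H] [HopfAlgebra k H]

variable (k H) in
/-- The prebraiding of the category of Yetter-Drinfeld modules. -/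
noncomputable def prebraiding : Prebraiding (YetterDrinfeld k H) where
  c := braid
  whiskerRight_c f _ := whiskerRight_braid f
  whiskerLeft_c _ f := whiskerLeft_braid f
  c_tensor_right := braid_tensor_right
  c_tensor_left := braid_tensor_left
  c_unit_left := braid_unit_left
  c_unit_right := braid_unit_right

variable {A : YetterDrinfeld k H} {m n p p' q q' r : ℕ}

/-- The morphism `u ⊗ A`. -/
noncomputable def tl (u : S A m ⟶ S A n) : S A (m + 1) ⟶ S A (n + 1) := u ▷ A

/-- Append a factor to the source and to the second factor of the target. -/
noncomputable def app (f : S A n ⟶ S A q ⊗ S A p) : S A (n + 1) ⟶ S A q ⊗ S A (p + 1) :=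
  append A f

/-- Append a factor to the source and to the first factor of the target, by the braiding. -/
noncomputable def ups (f : S A n ⟶ S A q ⊗ S A p) : S A (n + 1) ⟶ S A (q + 1) ⊗ S A p :=
  (prebraiding k H).up A f

lemma tl_comp (u : S A m ⟶ S A n) (v : S A n ⟶ S A r) : tl (u ≫ v) = tl u ≫ tl v :=
  comp_whiskerRight u v A

@[simp] lemma tl_zero : tl (0 : S A m ⟶ S A n) = 0 := MonoidalPreadditive.zero_whiskerRight

lemma tl_add (u v : S A m ⟶ S A n) : tl (u + v) = tl u + tl v :=
  MonoidalPreadditive.add_whiskerRight u v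

lemma tl_zsmul (c : ℤ) (u : S A m ⟶ S A n) : tl (c • u) = c • tl u :=
  zsmul_whiskerRight c u A

lemma app_comp (u : S A m ⟶ S A n) (f : S A n ⟶ S A q ⊗ S A p) : app (u ≫ f) = tl u ≫ app f :=
  append_comp u f

lemma app_comp_whiskerRight (f : S A n ⟶ S A q ⊗ S A p) (u : S A q ⟶ S A q') :
    app (f ≫ u ▷ S A p) = app f ≫ u ▷ S A (p + 1) :=
  append_comp_whiskerRight f u

lemma app_comp_whiskerLeft (f : S A n ⟶ S A q ⊗ S A p) (u : S A p ⟶ S A p') :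
    app (f ≫ S A q ◁ u) = app f ≫ S A q ◁ tl u :=
  append_comp_whiskerLeft f u

lemma app_add (f g : S A n ⟶ S A q ⊗ S A p) : app (f + g) = app f + app g := append_add f g

lemma app_zsmul (c : ℤ) (f : S A n ⟶ S A q ⊗ S A p) : app (c • f) = c • app f :=
  append_zsmul c f

lemma ups_comp (u : S A m ⟶ S A n) (f : S A n ⟶ S A q ⊗ S A p) : ups (u ≫ f) = tl u ≫ ups f :=
  (prebraiding k H).up_comp u f

lemma ups_comp_whiskerRight (f : S A n ⟶ S A q ⊗ S A p) (u : S A q ⟶ S A q') :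
    ups (f ≫ u ▷ S A p) = ups f ≫ tl u ▷ S A p :=
  (prebraiding k H).up_comp_whiskerRight f u

lemma ups_comp_whiskerLeft (f : S A n ⟶ S A q ⊗ S A p) (u : S A p ⟶ S A p') :
    ups (f ≫ S A q ◁ u) = ups f ≫ S A (q + 1) ◁ u :=
  (prebraiding k H).up_comp_whiskerLeft f u

lemma ups_comp_braid (f : S A n ⟶ S A p ⊗ S A q) :
    ups (f ≫ braid (S A p) (S A q)) = app f ≫ braid (S A p) (S A (q + 1)) :=
  (prebraiding k H).up_comp_c f

@[simp] lemma ups_zero : ups (0 : S A n ⟶ S A q ⊗ S A p) = 0 := (prebraiding k H).up_zero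

lemma ups_add (f g : S A n ⟶ S A q ⊗ S A p) : ups (f + g) = ups f + ups g :=
  (prebraiding k H).up_add f g

lemma ups_sub (f g : S A n ⟶ S A q ⊗ S A p) : ups (f - g) = ups f - ups g :=
  (AddMonoidHom.mk' (ups (A := A) (n := n) (q := q) (p := p)) ups_add).map_sub f g

lemma ups_zsmul (c : ℤ) (f : S A n ⟶ S A q ⊗ S A p) : ups (c • f) = c • ups f :=
  (prebraiding k H).up_zsmul c f

/-- The inverse of the right unitor. -/
noncomputable def splitUnit (A : YetterDrinfeld k H) (n : ℕ) : S A n ⟶ S A n ⊗ S A 0 :=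
  (ρ_ (S A n)).inv

lemma comp_splitUnit (u : S A m ⟶ S A n) : u ≫ splitUnit A n = splitUnit A m ≫ u ▷ S A 0 :=
  rightUnitor_inv_naturality u

/-- The deconcatenation `S_n(A) ⟶ S_q(A) ⊗ S_p(A)`, equal to zero unless `n = q + p`. -/
noncomputable def decon (A : YetterDrinfeld k H) : (n q p : ℕ) → (S A n ⟶ S A q ⊗ S A p)
  -- Leaving `n` free, with value zero off the diagonal, makes the recursion hold for all indices
  -- and keeps transports out of the later inductions.
  | n, q, 0 => if h : n = q then eqToHom (by rw [h]) ≫ splitUnit A q else 0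
  | 0, _, _ + 1 => 0
  | n + 1, q, p + 1 => app (decon A n q p)

lemma decon_self (n : ℕ) : decon A n n 0 = splitUnit A n := by
  rw [decon, dif_pos rfl, eqToHom_refl, Category.id_comp]

lemma decon_succ (n q p : ℕ) : decon A (n + 1) q (p + 1) = app (decon A n q p) := by
  rw [decon]

lemma decon_add (q p : ℕ) : decon A (q + p) q p = dec A q p := by
  induction p with
  | zero => exact decon_self q
  | succ p ih =>
    change decon A (q + p + 1) q (p + 1) = _
    rw [decon_succ, ih]; rfl

section Coalgebra

variable [MonObj A] [ComonObj A]

/-- Multiplication of the last two factors. -/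
noncomputable def mulLast (A : YetterDrinfeld k H) [MonObj A] (n : ℕ) :
    S A (n + 1 + 1) ⟶ S A (n + 1) :=
  (α_ (S A n) A A).hom ≫ S A n ◁ μ[A]

/-- The counit on the last factor. -/
noncomputable def counitLast (A : YetterDrinfeld k H) [ComonObj A] (n : ℕ) :
    S A (n + 1) ⟶ S A n :=
  S A n ◁ ε[A] ≫ (ρ_ (S A n)).hom

variable (A) in
/-- The bar differential without its last face. -/
noncomputable def frontDiff : (n : ℕ) → (S A (n + 1) ⟶ S A n)
  -- On one letter the first and the last face are the same map; here it stands for the first face.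
  | 0 => counitLast A 0
  | n + 1 => tl (frontDiff n) + (-1 : ℤ) ^ (n + 1) • mulLast A n

/-- The bar differential without its first and last faces. -/
noncomputable def innerDiff (A : YetterDrinfeld k H) [MonObj A] : (n : ℕ) → (S A (n + 1) ⟶ S A n)
  | 0 => 0
  | n + 1 => tl (innerDiff A n) + (-1 : ℤ) ^ (n + 1) • mulLast A n

/-- The counit on the first factor. -/
noncomputable def firstFace (A : YetterDrinfeld k H) [ComonObj A] : (n : ℕ) → (S A (n + 1) ⟶ S A n)
  | 0 => counitLast A 0
  | n + 1 => tl (firstFace A n)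

lemma frontDiff_succ (n : ℕ) :
    frontDiff A (n + 1) = tl (frontDiff A n) + (-1 : ℤ) ^ (n + 1) • mulLast A n := rfl

lemma innerDiff_succ (n : ℕ) :
    innerDiff A (n + 1) = tl (innerDiff A n) + (-1 : ℤ) ^ (n + 1) • mulLast A n := rfl

lemma firstFace_succ (n : ℕ) : firstFace A (n + 1) = tl (firstFace A n) := rfl

lemma frontDiff_eq (n : ℕ) : frontDiff A n = firstFace A n + innerDiff A n := by
  induction n with
  | zero => simp [frontDiff, firstFace, innerDiff]
  | succ n ih => rw [frontDiff_succ, firstFace_succ, innerDiff_succ, ih, tl_add]; exact add_assoc _ _ _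

lemma face_last (n : ℕ) : face A n (n + 1) = counitLast A n := by
  cases n with
  | zero => rfl
  | succ n => rw [face, if_pos rfl]; rfl

lemma sum_face (n : ℕ) :
    ∑ i ∈ Finset.range (n + 1), (-1 : ℤ) ^ i • face A n i = frontDiff A n := by
  induction n with
  | zero => rw [Finset.sum_range_one, pow_zero, one_smul]; rfl
  | succ n ih =>
    have h : ∀ i ∈ Finset.range (n + 1), (-1 : ℤ) ^ i • face A (n + 1) i =
        (AddMonoidHom.mk' (tl (m := n + 1) (n := n)) tl_add) ((-1 : ℤ) ^ i • face A n i) := by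
      intro i hi
      rw [Finset.mem_range] at hi
      have : face A (n + 1) i = tl (face A n i) := by
        exact (if_neg (by omega)).trans (if_neg (by omega))
      rw [map_zsmul, this]
      rfl
    have h' : face A (n + 1) (n + 1) = mulLast A n := by
      exact (if_neg (by omega)).trans (if_pos rfl)
    rw [Finset.sum_range_succ, Finset.sum_congr rfl h, ← map_sum, ih, frontDiff_succ, h']
    rfl

lemma barDifferential_eq (n : ℕ) :
    barDifferential A n = frontDiff A n + (-1 : ℤ) ^ (n + 1) • counitLast A n := by
  rw [barDifferential, Finset.sum_range_succ, sum_face, face_last]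

lemma tl_tl_mulLast (u : S A m ⟶ S A n) : tl (tl u) ≫ mulLast A n = mulLast A m ≫ tl u :=
  whiskerRight_comp_mul u _

lemma tl_counitLast (u : S A m ⟶ S A n) : tl u ≫ counitLast A n = counitLast A m ≫ u :=
  whiskerRight_comp_counit u _

lemma tl_mulLast_mulLast (n : ℕ) :
    tl (mulLast A n) ≫ mulLast A n = mulLast A (n + 1) ≫ mulLast A n :=
  mul_mul_whisker _ _ (MonObj.mul_assoc A)

lemma mulLast_counitLast (n : ℕ)
    (hm : μ[A] ≫ ε[A] = (ε[A] ▷ A ≫ 𝟙_ _ ◁ ε[A]) ≫ (λ_ (𝟙_ (YetterDrinfeld k H))).hom) :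
    mulLast A n ≫ counitLast A n = counitLast A (n + 1) ≫ counitLast A n :=
  mul_counit_whisker _ _ _ hm

/-- Induction along the last letter: the part not meeting it vanishes by hypothesis, the mixed terms
cancel by naturality, and the two double multiplications cancel by associativity. -/
lemma frontDiff_frontDiff (n : ℕ)
    (hm : μ[A] ≫ ε[A] = (ε[A] ▷ A ≫ 𝟙_ _ ◁ ε[A]) ≫ (λ_ (𝟙_ (YetterDrinfeld k H))).hom) :
    frontDiff A (n + 1) ≫ frontDiff A n = 0 := by
  induction n with
  | zero =>
    change (tl (counitLast A 0) + (-1 : ℤ) ^ (0 + 1) • mulLast A 0) ≫ counitLast A 0 = 0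
    rw [Preadditive.add_comp, Preadditive.zsmul_comp, mulLast_counitLast _ hm, tl_counitLast]
    simp
  | succ n ih =>
    have h1 : tl (frontDiff A (n + 1)) ≫ mulLast A n = mulLast A (n + 1) ≫ tl (frontDiff A n) +
        (-1 : ℤ) ^ (n + 1) • mulLast A (n + 1) ≫ mulLast A n := by
      rw [frontDiff_succ, tl_add, tl_zsmul, Preadditive.add_comp, Preadditive.zsmul_comp,
        tl_tl_mulLast, tl_mulLast_mulLast]
    rw [frontDiff_succ (n + 1), Preadditive.add_comp, Preadditive.zsmul_comp]
    nth_rw 2 3 [frontDiff_succ n]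
    rw [Preadditive.comp_add, Preadditive.comp_add, Preadditive.comp_zsmul, Preadditive.comp_zsmul,
      ← tl_comp, ih, h1]
    rcases neg_one_pow_eq_or ℤ n with h | h <;> simp [pow_succ, h] <;> abel

lemma barDifferential_comp (n : ℕ)
    (hm : μ[A] ≫ ε[A] = (ε[A] ▷ A ≫ 𝟙_ _ ◁ ε[A]) ≫ (λ_ (𝟙_ (YetterDrinfeld k H))).hom) :
    barDifferential A (n + 1) ≫ barDifferential A n = 0 := by
  rw [barDifferential_eq, barDifferential_eq, Preadditive.add_comp, Preadditive.comp_add,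
    Preadditive.comp_add, frontDiff_frontDiff n hm, frontDiff_succ]
  simp only [Preadditive.add_comp, Preadditive.zsmul_comp, Preadditive.comp_zsmul,
    mulLast_counitLast n hm, tl_counitLast]
  rcases neg_one_pow_eq_or ℤ n with h | h <;> simp [pow_succ, h] <;> abel

lemma app_app_mulLast (f : S A n ⟶ S A q ⊗ S A p) :
    app (app f) ≫ S A q ◁ mulLast A p = mulLast A n ≫ app f :=
  append_append_comp f _

lemma app_counitLast (f : S A n ⟶ S A q ⊗ S A p) :
    app f ≫ S A q ◁ counitLast A p = counitLast A n ≫ f :=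
  append_comp_counit f _

lemma ups_ups_mulLast (f : S A n ⟶ S A q ⊗ S A p) :
    ups (ups f) ≫ mulLast A q ▷ S A p = mulLast A n ≫ ups f :=
  (prebraiding k H).up_up_comp f _

lemma ups_counitLast (f : S A n ⟶ S A q ⊗ S A p) :
    ups f ≫ counitLast A q ▷ S A p = counitLast A n ≫ f :=
  (prebraiding k H).up_comp_counit f _

/-- The deconcatenation and the differential, without the last face. -/
lemma frontDiff_decon (p q n : ℕ) (h : n = q + p) :
    frontDiff A n ≫ decon A n q p = decon A (n + 1) (q + 1) p ≫ frontDiff A q ▷ S A p +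
      (-1 : ℤ) ^ q • decon A (n + 1) q (p + 1) ≫ S A q ◁ innerDiff A p := by
  induction p generalizing n with
  | zero =>
    obtain rfl : n = q := h
    rw [decon_self, decon_self]
    simp [innerDiff, comp_splitUnit]
  | succ p ih =>
    obtain rfl : n = q + p + 1 := h
    rw [frontDiff_succ, Preadditive.add_comp, decon_succ, ← app_comp, ih _ rfl, app_add,
      app_comp_whiskerRight, ← decon_succ, app_zsmul, app_comp_whiskerLeft, ← decon_succ,
      innerDiff_succ, MonoidalPreadditive.whiskerLeft_add, Preadditive.comp_add,
      smul_add, whiskerLeft_zsmul, Preadditive.comp_zsmul, decon_succ (q + p + 1), decon_succ (q + p + 1),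
      decon_succ (q + p) q p,      app_app_mulLast, smul_smul, ← pow_add, Preadditive.zsmul_comp]
    exact add_assoc _ _ _

end Coalgebra

end TensorPowers

end YetterDrinfeld

namespace YetterDrinfeld

set_option linter.unusedSectionVars false

open Prebraiding
open scoped MonObj ComonObj

/-! ### The coaction on tensor powers, the cup-one coproduct and the homotopy formula. -/

section CupOne

variable {k : Type u} [Field k] {H : Type v} [Ring H] [HopfAlgebra k H]
variable {A : YetterDrinfeld k H} {m n p p' q q' r : ℕ}

/-- Append a factor to the source and to the second factor of the target. -/
noncomputable def appA (l : S A n ⟶ A ⊗ S A p) : S A (n + 1) ⟶ A ⊗ S A (p + 1) := append A l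

/-- Split off the first factor. -/
noncomputable def splitFirst (A : YetterDrinfeld k H) : (p : ℕ) → (S A (p + 1) ⟶ A ⊗ S A p)
  | 0 => (λ_ A).hom ≫ (ρ_ A).inv
  | p + 1 => appA (splitFirst A p)

lemma decon_splitFirst (q p : ℕ) :
    decon A (q + p + 1) (q + 1) p ≫ (α_ (S A q) A (S A p)).hom =
      decon A (q + p + 1) q (p + 1) ≫ S A q ◁ splitFirst A p := by
  induction p with
  | zero =>
    rw [decon_self, decon_succ, decon_self]
    exact append_splitUnit
  | succ p ih =>
    change decon A (q + p + 1 + 1) (q + 1) (p + 1) ≫ (α_ (S A q) A (S A (p + 1))).hom =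
      decon A (q + p + 1 + 1) q (p + 1 + 1) ≫ S A q ◁ splitFirst A (p + 1)
    rw [decon_succ (q + p + 1), decon_succ (q + p + 1)]
    exact append_split _ _ _ ih

lemma decon_zero (n : ℕ) : decon A n 0 n = (λ_ (S A n)).inv := by
  induction n with
  | zero =>
    rw [decon_self]
    exact unitors_inv_equal.symm
  | succ n ih =>
    rw [decon_succ, ih]
    exact append_leftUnitor_inv

lemma decon_assoc (q r p : ℕ) :
    decon A (q + r + p) q (r + p) ≫ S A q ◁ decon A (r + p) r p ≫
      (α_ (S A q) (S A r) (S A p)).inv =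
    decon A (q + r + p) (q + r) p ≫ decon A (q + r) q r ▷ S A p := by
  induction p with
  | zero =>
    change decon A (q + r) q r ≫ S A q ◁ decon A r r 0 ≫ (α_ (S A q) (S A r) (S A 0)).inv =
      decon A (q + r) (q + r) 0 ≫ decon A (q + r) q r ▷ S A 0
    rw [decon_self, decon_self]
    exact comp_splitUnit_assoc _
  | succ p ih =>
    change decon A (q + r + p + 1) q (r + p + 1) ≫ S A q ◁ decon A (r + p + 1) r (p + 1) ≫
      (α_ (S A q) (S A r) (S A (p + 1))).inv =
      decon A (q + r + p + 1) (q + r) (p + 1) ≫ decon A (q + r) q r ▷ S A (p + 1)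
    rw [decon_succ, decon_succ, decon_succ]
    exact append_assoc _ _ _ _ ih

variable [MonObj A] [ComonObj A]

/-- The codiagonal coaction, one factor further. -/
noncomputable def coS (l : S A n ⟶ A ⊗ S A p) : S A (n + 1) ⟶ A ⊗ S A (p + 1) :=
  (prebraiding k H).coext l

/-- Multiply the coefficient of `l` by a further factor on the right. -/
noncomputable def mulR (l : S A n ⟶ A ⊗ S A p) : S A (n + 1) ⟶ A ⊗ S A p :=
  (prebraiding k H).mulRight l

/-- Multiply the coefficients of `d` and `l`. -/
noncomputable def mulL (d : S A n ⟶ A ⊗ S A p) (l : S A p ⟶ A ⊗ S A p') : S A n ⟶ A ⊗ S A p' :=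
  d ≫ A ◁ l ≫ (α_ A A (S A p')).inv ≫ μ[A] ▷ S A p'

/-- Apply `l` to the second factor, and append the factor `A` so obtained to the first one. -/
noncomputable def attachS (f : S A n ⟶ S A q ⊗ S A p) (l : S A p ⟶ A ⊗ S A p') :
    S A n ⟶ S A (q + 1) ⊗ S A p' :=
  attach f l

lemma attachS_comp (u : S A m ⟶ S A n) (f : S A n ⟶ S A q ⊗ S A p) (l : S A p ⟶ A ⊗ S A p') :
    attachS (u ≫ f) l = u ≫ attachS f l :=
  attach_comp u f l

lemma attachS_comp_whiskerRight (f : S A n ⟶ S A q ⊗ S A p) (u : S A q ⟶ S A q')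
    (l : S A p ⟶ A ⊗ S A p') : attachS (f ≫ u ▷ S A p) l = attachS f l ≫ tl u ▷ S A p' :=
  attach_comp_whiskerRight f u l

lemma attachS_comp_whiskerLeft (f : S A n ⟶ S A q ⊗ S A p) (u : S A p ⟶ S A p')
    (l : S A p' ⟶ A ⊗ S A r) : attachS (f ≫ S A q ◁ u) l = attachS f (u ≫ l) :=
  attach_comp_whiskerLeft f u l

lemma attachS_whiskerLeft (f : S A n ⟶ S A q ⊗ S A p) (l : S A p ⟶ A ⊗ S A p')
    (u : S A p' ⟶ S A r) : attachS f (l ≫ A ◁ u) = attachS f l ≫ S A (q + 1) ◁ u :=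
  attach_whiskerLeft f l u

lemma add_attachS (f g : S A n ⟶ S A q ⊗ S A p) (l : S A p ⟶ A ⊗ S A p') :
    attachS (f + g) l = attachS f l + attachS g l :=
  add_attach f g l

lemma zsmul_attachS (c : ℤ) (f : S A n ⟶ S A q ⊗ S A p) (l : S A p ⟶ A ⊗ S A p') :
    attachS (c • f) l = c • attachS f l :=
  zsmul_attach c f l

lemma attachS_add (f : S A n ⟶ S A q ⊗ S A p) (l l' : S A p ⟶ A ⊗ S A p') :
    attachS f (l + l') = attachS f l + attachS f l' :=
  attach_add f l l'

lemma attachS_zsmul (c : ℤ) (f : S A n ⟶ S A q ⊗ S A p) (l : S A p ⟶ A ⊗ S A p') :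
    attachS f (c • l) = c • attachS f l :=
  attach_zsmul c f l

lemma ups_attachS_mulLast (f : S A n ⟶ S A q ⊗ S A p) (l : S A p ⟶ A ⊗ S A p') :
    ups (attachS f l) ≫ mulLast A q ▷ S A p' = attachS (app f) (mulR l) :=
  (prebraiding k H).up_attach_comp_mul f l

lemma attachS_mulLast (f : S A n ⟶ S A (q + 1) ⊗ S A p) (l : S A p ⟶ A ⊗ S A p')
    (g : S A n ⟶ S A q ⊗ S A (p + 1))
    (h : f ≫ (α_ (S A q) A (S A p)).hom = g ≫ S A q ◁ splitFirst A p) :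
    attachS f l ≫ mulLast A q ▷ S A p' = attachS g (mulL (splitFirst A p) l) :=
  attach_comp_mul f l g _ h _

lemma attachS_counitLast (f : S A n ⟶ S A q ⊗ S A p) (l : S A p ⟶ A ⊗ S A p)
    (hl : l ≫ ε[A] ▷ S A p = (λ_ (S A p)).inv) : attachS f l ≫ counitLast A q ▷ S A p = f :=
  attach_comp_counit f l _ hl

lemma coS_comp (g : S A m ⟶ S A n) (l : S A n ⟶ A ⊗ S A p) : coS (g ≫ l) = tl g ≫ coS l :=
  (prebraiding k H).coext_comp g l

lemma coS_comp_whiskerLeft (l : S A n ⟶ A ⊗ S A p) (u : S A p ⟶ S A p') :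
    coS (l ≫ A ◁ u) = coS l ≫ A ◁ tl u :=
  (prebraiding k H).coext_comp_whiskerLeft l u

lemma coS_counitLast (l : S A n ⟶ A ⊗ S A p) : coS l ≫ A ◁ counitLast A p = mulR l :=
  (prebraiding k H).coext_comp_counit l

lemma coS_mulL (g : S A n ⟶ A ⊗ S A p) (l : S A p ⟶ A ⊗ S A p') :
    coS (mulL g l) = mulL (appA g) (coS l) :=
  (prebraiding k H).coext_mul g l

/-- The codiagonal coaction of `A` on `S_p(A)`. -/
noncomputable def lam (A : YetterDrinfeld k H) [MonObj A] [ComonObj A] :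
    (p : ℕ) → (S A p ⟶ A ⊗ S A p)
  | 0 => η[A] ≫ (ρ_ A).inv
  | p + 1 => coS (lam A p)

lemma lam_succ (p : ℕ) : lam A (p + 1) = coS (lam A p) := rfl

lemma IsBimonoid.counit_mul (hA : IsBimonoid A) :
    μ[A] ≫ ε[A] = (ε[A] ▷ A ≫ 𝟙_ _ ◁ ε[A]) ≫ (λ_ (𝟙_ (YetterDrinfeld k H))).hom := by
  rw [hA.mul_counit, MonoidalCategory.tensorHom_def]

lemma coS_coS_mulLast (hA : IsBimonoid A) (l : S A n ⟶ A ⊗ S A p) :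
    coS (coS l) ≫ A ◁ mulLast A p = mulLast A n ≫ coS l := by
  refine (prebraiding k H).coext_coext_comp_mul l ?_
  rw [hA.mul_comul, MonoidalCategory.tensorHom_def, MonoidalCategory.tensorHom_def]
  rfl

/-- Multiplying neighbouring letters leaves the product of all first legs unchanged, because Δ is
multiplicative. -/
lemma lam_innerDiff (hA : IsBimonoid A) (p : ℕ) :
    lam A (p + 1) ≫ A ◁ innerDiff A p = innerDiff A p ≫ lam A p := by
  induction p with
  | zero =>
    change lam A (0 + 1) ≫ A ◁ 0 = 0 ≫ lam A 0
    rw [MonoidalPreadditive.whiskerLeft_zero, comp_zero, zero_comp]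
  | succ p ih =>
    rw [innerDiff_succ, MonoidalPreadditive.whiskerLeft_add, Preadditive.comp_add, lam_succ (p + 1),
      ← coS_comp_whiskerLeft, ih, coS_comp, whiskerLeft_zsmul, Preadditive.comp_zsmul,
      lam_succ, coS_coS_mulLast hA, Preadditive.add_comp, Preadditive.zsmul_comp]

/-- The counit removes the second leg of the first letter, so that letter enters the coefficient
whole, as its leftmost factor. Since words grow on the right, the induction only has to extend both
sides by one letter. -/
lemma lam_firstFace (p : ℕ) :
    lam A (p + 1) ≫ A ◁ firstFace A p = mulL (splitFirst A p) (lam A p) := by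
  induction p with
  | zero =>
    change coS (lam A 0) ≫ A ◁ counitLast A 0 = _
    rw [coS_counitLast]
    exact (prebraiding k H).mulRight_one.trans ((Category.assoc _ _ _).trans mulLeft_one).symm
  | succ p ih =>
    rw [lam_succ (p + 1), firstFace_succ, ← coS_comp_whiskerLeft, ih, coS_mulL]
    rfl

lemma lam_counit (hA : IsBimonoid A) (p : ℕ) :
    lam A p ≫ ε[A] ▷ S A p = (λ_ (S A p)).inv := by
  induction p with
  | zero => exact one_counital hA.one_counit
  | succ p ih => exact (prebraiding k H).coext_counital _ ih hA.counit_mul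

/-- The three summands are the first, inner and last faces of a block. In the boundary of `cupOne`
each meets its counterpart: a left neighbour multiplied into the coefficient, a face inside the
block before coacting, a right neighbour multiplied into the coefficient. -/
lemma lam_barDifferential (hA : IsBimonoid A) (p : ℕ) :
    lam A (p + 1) ≫ A ◁ barDifferential A p =
      mulL (splitFirst A p) (lam A p) + innerDiff A p ≫ lam A p +
        (-1 : ℤ) ^ (p + 1) • mulR (lam A p) := by
  rw [barDifferential_eq, frontDiff_eq, MonoidalPreadditive.whiskerLeft_add,
    MonoidalPreadditive.whiskerLeft_add, whiskerLeft_zsmul, Preadditive.comp_add,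
    Preadditive.comp_add, Preadditive.comp_zsmul, lam_firstFace, lam_innerDiff hA, lam_succ,
    coS_counitLast]

/-- The part of the cup-one coproduct which does not meet the last factor. -/
noncomputable def upsPrev (F : (n : ℕ) → (S A n ⟶ S A q ⊗ S A p)) :
    (n : ℕ) → (S A n ⟶ S A (q + 1) ⊗ S A p)
  | 0 => 0
  | n + 1 => ups (F n)

/-- The cup-one coproduct `S_n(A) ⟶ S_q(A) ⊗ S_p(A)`, of interest for `n + 1 = q + p`. -/
noncomputable def cupOne (A : YetterDrinfeld k H) [MonObj A] [ComonObj A] :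
    (q p n : ℕ) → (S A n ⟶ S A q ⊗ S A p)
  | 0, _, _ => 0
  -- Either the block ends before the last letter, which is then braided past the remainder of the
  -- block, or the block consists of the last `p` letters.
  | q + 1, p, n => upsPrev (cupOne A q p) n +
      (-1 : ℤ) ^ (q * (p + 1)) • attachS (decon A n q p) (lam A p)

lemma cupOne_zero (p n : ℕ) : cupOne A 0 p n = 0 := rfl

lemma cupOne_succ (q p n : ℕ) : cupOne A (q + 1) p n = upsPrev (cupOne A q p) n +
      (-1 : ℤ) ^ (q * (p + 1)) • attachS (decon A n q p) (lam A p) := rfl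

/-- Precomposition with the bar differential without its last face. -/
noncomputable def frontPrev (F : (n : ℕ) → (S A n ⟶ S A q ⊗ S A p)) :
    (n : ℕ) → (S A n ⟶ S A q ⊗ S A p)
  | 0 => 0
  | n + 1 => frontDiff A n ≫ F n

/-- Precomposition with the bar differential. -/
noncomputable def barPrev (F : (n : ℕ) → (S A n ⟶ S A q ⊗ S A p)) :
    (n : ℕ) → (S A n ⟶ S A q ⊗ S A p)
  | 0 => 0
  | n + 1 => barDifferential A n ≫ F n

/-- The face multiplying the last two letters acts the same before and after both have been moved.
Giving the common term a name treats `n = 0`, where everything is zero, together with `n > 0`. -/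
lemma exists_upsPrev (F : (n : ℕ) → (S A n ⟶ S A q ⊗ S A p)) (n : ℕ) :
    ∃ Y : S A (n + 1) ⟶ S A (q + 1) ⊗ S A p,
      ups (upsPrev F n) ≫ mulLast A q ▷ S A p = Y ∧
      frontDiff A n ≫ upsPrev F n = ups (frontPrev F n) + (-1 : ℤ) ^ n • Y := by
  cases n with
  | zero => exact ⟨0, by simp [upsPrev], by simp [upsPrev, frontPrev]⟩
  | succ n =>
    refine ⟨_, rfl, ?_⟩
    simp only [upsPrev, frontPrev]
    rw [frontDiff_succ, Preadditive.add_comp, ups_comp, ups_ups_mulLast, Preadditive.zsmul_comp]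

/-- The differential without its last face satisfies a recursion along the last letter, as `cupOne`
does, so this version of the homotopy formula can be proved by induction on `q`. What survives is
the block at the front of the word. -/
lemma frontDiff_cupOne (hA : IsBimonoid A) (q p n : ℕ) (h : n = q + p) :
    cupOne A (q + 1) p n ≫ frontDiff A q ▷ S A p +
      (-1 : ℤ) ^ p • frontPrev (cupOne A q p) n -
      (-1 : ℤ) ^ p • cupOne A q (p + 1) n ≫ S A q ◁ barDifferential A p =
    decon A n p q ≫ braid (S A p) (S A q) := by
  induction q generalizing n with
  | zero =>
    obtain rfl : n = p := by omega
    have e1 : upsPrev (cupOne A 0 n) n = 0 := by cases n <;> simp [upsPrev, cupOne_zero]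
    have e2 : frontPrev (cupOne A 0 n) n = 0 := by cases n <;> simp [frontPrev, cupOne_zero]
    have e3 : (-1 : ℤ) ^ (0 * (n + 1)) = 1 := by simp
    have e4 : cupOne A (0 + 1) n n = attachS (decon A n 0 n) (lam A n) := by
      rw [cupOne_succ, e1, e3, one_smul]
      exact zero_add (M := S A n ⟶ S A (0 + 1) ⊗ S A n) _
    rw [e4, e2, cupOne_zero, zero_comp, smul_zero, sub_zero]
    refine (add_zero (M := S A n ⟶ S A 0 ⊗ S A n) _).trans ?_
    change attachS (decon A n 0 n) (lam A n) ≫ counitLast A 0 ▷ S A n = _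
    -- For `q = 0` the whole word is the block; applying the counit to its coefficient gives the
    -- word back.
    rw [attachS_counitLast _ _ (lam_counit hA n), decon_zero, decon_self]
    exact ((congrArg _ (braid_unit_right _)).trans (Iso.inv_hom_id_assoc _ _)).symm
  | succ q ih =>
    obtain ⟨N, rfl⟩ : ∃ N, n = N + 1 := ⟨q + p, by omega⟩
    obtain rfl : N = q + p := by omega
    have IH := ih (q + p) rfl
    obtain ⟨Y, hY1, hY2⟩ := exists_upsPrev (cupOne A q p) (q + p)
    generalize hn : q + p = n at *
    have hd : decon A (n + 1) (q + 1) p ≫ (α_ (S A q) A (S A p)).hom =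
      decon A (n + 1) q (p + 1) ≫ S A q ◁ splitFirst A p := by
      subst hn; exact decon_splitFirst q p
    -- The terms in which the block lies at the end: `K` has a face left of the block, `J` a face
    -- inside it, and `M1` and `M2` have the last or first letter of a longer block multiplied into
    -- the coefficient. Together with `Y` each of them occurs twice, with opposite signs.
    set K := attachS (decon A (n + 1) (q + 1) p ≫ frontDiff A q ▷ S A p) (lam A p) with hK
    set M1 := attachS (decon A (n + 1) q (p + 1)) (mulR (lam A p)) with hM1
    set M2 := attachS (decon A (n + 1) q (p + 1)) (mulL (splitFirst A p) (lam A p)) with hM2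
    set J := attachS (decon A (n + 1) q (p + 1)) (innerDiff A p ≫ lam A p) with hJ
    -- This is the induction hypothesis with one more letter braided through; its deconcatenation
    -- term is the one that remains at the end.
    have E1 : ups (cupOne A (q + 1) p n) ≫ tl (frontDiff A q) ▷ S A p =
        decon A (n + 1) p (q + 1) ≫ braid (S A p) (S A (q + 1)) -
        (-1 : ℤ) ^ p • ups (frontPrev (cupOne A q p) n) +
        (-1 : ℤ) ^ p • ups (cupOne A q (p + 1) n) ≫ S A (q + 1) ◁ barDifferential A p := by
      rw [decon_succ, ← ups_comp_braid, ← IH, ← ups_comp_whiskerRight, ← ups_comp_whiskerLeft,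
        ups_sub, ups_add, ups_zsmul, ups_zsmul]
      module
    have E2 : ups (cupOne A (q + 1) p n) ≫ mulLast A q ▷ S A p =
        Y + (-1 : ℤ) ^ (q * (p + 1)) • M1 := by
      rw [cupOne_succ, ups_add, Preadditive.add_comp, hY1, ups_zsmul, Preadditive.zsmul_comp,
        ups_attachS_mulLast, ← decon_succ]
    have E3 : attachS (decon A (n + 1) (q + 1) p) (lam A p) ≫ tl (frontDiff A q) ▷ S A p = K := by
      rw [hK, attachS_comp_whiskerRight]
    have E4 : attachS (decon A (n + 1) (q + 1) p) (lam A p) ≫ mulLast A q ▷ S A p = M2 :=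
      attachS_mulLast _ _ _ hd
    have E5 : frontDiff A n ≫ cupOne A (q + 1) p n = ups (frontPrev (cupOne A q p) n) +
        (-1 : ℤ) ^ n • Y + (-1 : ℤ) ^ (q * (p + 1)) • (K + (-1 : ℤ) ^ q • J) := by
      rw [cupOne_succ, Preadditive.comp_add, hY2, Preadditive.comp_zsmul, ← attachS_comp,
        frontDiff_decon p q n hn.symm, add_attachS, zsmul_attachS, attachS_comp_whiskerLeft]
    have E6 : cupOne A (q + 1) (p + 1) (n + 1) ≫ S A (q + 1) ◁ barDifferential A p =
        ups (cupOne A q (p + 1) n) ≫ S A (q + 1) ◁ barDifferential A p +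
        (-1 : ℤ) ^ (q * (p + 1 + 1)) • (M2 + J + (-1 : ℤ) ^ (p + 1) • M1) := by
      rw [cupOne_succ, Preadditive.add_comp, Preadditive.zsmul_comp, ← attachS_whiskerLeft,
        lam_barDifferential hA, attachS_add, attachS_add, attachS_zsmul]
      rfl
    have E0 : cupOne A (q + 1 + 1) p (n + 1) ≫ frontDiff A (q + 1) ▷ S A p =
        ups (cupOne A (q + 1) p n) ≫ tl (frontDiff A q) ▷ S A p +
        (-1 : ℤ) ^ (q + 1) • ups (cupOne A (q + 1) p n) ≫ mulLast A q ▷ S A p +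
        (-1 : ℤ) ^ ((q + 1) * (p + 1)) • (K + (-1 : ℤ) ^ (q + 1) • M2) := by
      rw [cupOne_succ (q + 1), Preadditive.add_comp, frontDiff_succ,
        MonoidalPreadditive.add_whiskerRight, Preadditive.comp_add, Preadditive.comp_add,
        zsmul_whiskerRight, Preadditive.comp_zsmul, Preadditive.comp_zsmul, Preadditive.zsmul_comp,
        Preadditive.zsmul_comp, E3, E4, smul_add, smul_comm ((-1 : ℤ) ^ (q + 1)) _ M2]
      rfl
    -- Every sign is reduced to the parities of `p` and `q` and the common factor (-1)^(q(p+1)).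
    have s1 : (-1 : ℤ) ^ ((q + 1) * (p + 1)) = -((-1) ^ (q * (p + 1)) * (-1) ^ p) := by ring
    have s2 : (-1 : ℤ) ^ (q * (p + 1 + 1)) = (-1) ^ (q * (p + 1)) * (-1) ^ q := by ring
    have s3 : (-1 : ℤ) ^ n = (-1) ^ q * (-1) ^ p := by rw [← hn]; ring
    rw [E0, E1, E2, E6, s1, s2, frontPrev, E5, s3, pow_succ, pow_succ]
    rcases neg_one_pow_eq_or ℤ p with h1 | h1 <;> rcases neg_one_pow_eq_or ℤ q with h2 | h2 <;>
      rw [h1, h2] <;> module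

/-- The cup-one coproduct is a homotopy between the deconcatenation and its opposite. -/
lemma barDifferential_cupOne (hA : IsBimonoid A) (q p n : ℕ) (h : n = q + p) :
    cupOne A (q + 1) p n ≫ barDifferential A q ▷ S A p +
      (-1 : ℤ) ^ p • barPrev (cupOne A q p) n -
      (-1 : ℤ) ^ p • cupOne A q (p + 1) n ≫ S A q ◁ barDifferential A p =
    decon A n p q ≫ braid (S A p) (S A q) - (-1 : ℤ) ^ (p * q) • decon A n q p := by
  -- The last face before and after `cupOne` gives the same term `Z` whenever the last letter is
  -- outside the block, and these cancel. The block at the end of the word contributes the remaining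
  -- deconcatenation.
  obtain ⟨Z, hZ1, hZ2⟩ : ∃ Z : S A n ⟶ S A q ⊗ S A p,
      upsPrev (cupOne A q p) n ≫ counitLast A q ▷ S A p = Z ∧
      barPrev (cupOne A q p) n = frontPrev (cupOne A q p) n + (-1 : ℤ) ^ n • Z := by
    cases n with
    | zero => exact ⟨0, by simp [upsPrev], by simp [barPrev, frontPrev]⟩
    | succ n =>
      refine ⟨_, rfl, ?_⟩
      simp only [upsPrev, frontPrev, barPrev]
      rw [barDifferential_eq, Preadditive.add_comp, ups_counitLast, Preadditive.zsmul_comp]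
  have E : cupOne A (q + 1) p n ≫ counitLast A q ▷ S A p =
      Z + (-1 : ℤ) ^ (q * (p + 1)) • decon A n q p := by
    rw [cupOne_succ, Preadditive.add_comp, hZ1, Preadditive.zsmul_comp,
      attachS_counitLast _ _ (lam_counit hA p)]
  rw [← frontDiff_cupOne hA q p n h, hZ2, barDifferential_eq q, MonoidalPreadditive.add_whiskerRight,
    zsmul_whiskerRight, Preadditive.comp_add, Preadditive.comp_zsmul, E]
  have s1 : (-1 : ℤ) ^ (q * (p + 1)) = (-1) ^ (p * q) * (-1) ^ q := by ring
  have s3 : (-1 : ℤ) ^ n = (-1) ^ q * (-1) ^ p := by rw [h]; ring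
  rw [s1, s3, pow_succ]
  rcases neg_one_pow_eq_or ℤ p with h1 | h1 <;> rcases neg_one_pow_eq_or ℤ q with h2 | h2 <;>
    rw [h1, h2] <;> module

/-- Both composites delete the letter next to the cut. In the differential of S_q ⊗ S_p they carry
the signs (-1)^(q+1) and (-1)^q and cancel, which makes deconcatenation a morphism of complexes. -/
lemma decon_counitLast (q p : ℕ) :
    decon A (q + p + 1) (q + 1) p ≫ counitLast A q ▷ S A p =
      decon A (q + p + 1) q (p + 1) ≫ S A q ◁ firstFace A p := by
  induction p with
  | zero =>
    change decon A (q + 1) (q + 1) 0 ≫ _ = decon A (q + 1) q (0 + 1) ≫ S A q ◁ counitLast A 0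
    rw [decon_self, decon_succ, decon_self, app_counitLast, comp_splitUnit]
  | succ p ih =>
    change decon A (q + p + 1 + 1) (q + 1) (p + 1) ≫ _ = decon A (q + p + 1 + 1) q (p + 1 + 1) ≫ _
    rw [decon_succ (q + p + 1), decon_succ (q + p + 1), ← app_comp_whiskerRight, ih,
      app_comp_whiskerLeft, firstFace_succ]

/-- The deconcatenation is a morphism of complexes. -/
lemma barDifferential_decon (p q n : ℕ) (h : n = q + p) :
    barDifferential A n ≫ decon A n q p =
      decon A (n + 1) (q + 1) p ≫ barDifferential A q ▷ S A p +
      (-1 : ℤ) ^ q • decon A (n + 1) q (p + 1) ≫ S A q ◁ barDifferential A p := by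
  have h1 : decon A (n + 1) (q + 1) p ≫ counitLast A q ▷ S A p =
      decon A (n + 1) q (p + 1) ≫ S A q ◁ firstFace A p := by
    subst h; exact decon_counitLast q p
  have h2 : decon A (n + 1) q (p + 1) ≫ S A q ◁ counitLast A p =
      counitLast A n ≫ decon A n q p := by
    rw [decon_succ, app_counitLast]
  rw [barDifferential_eq, Preadditive.add_comp, Preadditive.zsmul_comp, frontDiff_decon p q n h,
    ← h2, barDifferential_eq q, barDifferential_eq p, frontDiff_eq p,
    MonoidalPreadditive.add_whiskerRight, zsmul_whiskerRight, MonoidalPreadditive.whiskerLeft_add,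
    MonoidalPreadditive.whiskerLeft_add, whiskerLeft_zsmul, Preadditive.comp_add,
    Preadditive.comp_add, Preadditive.comp_add, Preadditive.comp_zsmul, Preadditive.comp_zsmul, h1]
  have s : (-1 : ℤ) ^ (n + 1) = (-1) ^ q * (-1) ^ (p + 1) := by rw [h]; ring
  rw [s, pow_succ (-1 : ℤ) q]
  module

end CupOne

end YetterDrinfeld

namespace YetterDrinfeld

/-! ### Bijectivity of the antipode of a finite dimensional Hopf algebra. -/

section Antipode

variable {k : Type u} [Field k] {H : Type v} [Ring H] [HopfAlgebra k H]

open HopfAlgebra Coalgebra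

/-- Permuted multiplication `p ⊗ q ⊗ r ⊗ s ↦ S(q) r ⊗ S(p) s`. -/
noncomputable def antipodeShuffle (k : Type u) [Field k] (H : Type v) [Ring H] [HopfAlgebra k H] :
    H ⊗[k] (H ⊗[k] (H ⊗[k] H)) →ₗ[k] H ⊗[k] H :=
  LinearMap.mul' k (H ⊗[k] H) ∘ₗ
    (TensorProduct.map (antipode k) (antipode k) ∘ₗ
      (TensorProduct.comm k H H).toLinearMap).rTensor (H ⊗[k] H) ∘ₗ
    (TensorProduct.assoc k H H (H ⊗[k] H)).symm.toLinearMap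

/-- The antipode reverses the comultiplication. -/
lemma comul_antipode (h : H) :
    comul (R := k) (antipode k h) =
      TensorProduct.comm k H H (TensorProduct.map (antipode k) (antipode k) (comul h)) := by
  let G : H →ₗ[k] H ⊗[k] H := (TensorProduct.map (antipode k) (antipode k) ∘ₗ
    (TensorProduct.comm k H H).toLinearMap) ∘ₗ comul
  -- In the convolution algebra Hom(H, H ⊗ H), `G` is a left inverse of `comul`, and `comul ∘
  -- antipode` is a right inverse; hence they agree.
  have hG : WithConv.toConv G * WithConv.toConv (comul (R := k) (A := H)) = 1 := by
    apply WithConv.ext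
    refine LinearMap.ext fun x => ?_
    change LinearMap.mul' k (H ⊗[k] H) (TensorProduct.map G comul (comul x)) =
      algebraMap k (H ⊗[k] H) (counit x)
    have e1 : LinearMap.mul' k (H ⊗[k] H) ∘ₗ TensorProduct.map G comul =
        antipodeShuffle k H ∘ₗ (TensorProduct.assoc k H H (H ⊗[k] H)).toLinearMap ∘ₗ
          (comul (R := k) (A := H)).rTensor (H ⊗[k] H) ∘ₗ
            (comul (R := k) (A := H)).lTensor H := by
      ext a b
      simp [antipodeShuffle, G]
    have e2 : (TensorProduct.assoc k H H (H ⊗[k] H)).toLinearMap ∘ₗ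
          (comul (R := k) (A := H)).rTensor (H ⊗[k] H) ∘ₗ
            (comul (R := k) (A := H)).lTensor H =
        ((comul (R := k) (A := H)).lTensor H).lTensor H ∘ₗ
          (TensorProduct.assoc k H H H).toLinearMap ∘ₗ (comul (R := k) (A := H)).rTensor H := by
      ext a b
      simp only [TensorProduct.AlgebraTensorModule.curry_apply, TensorProduct.curry_apply,
        LinearMap.coe_restrictScalars, LinearMap.comp_apply, LinearMap.lTensor_tmul,
        LinearMap.rTensor_tmul]
      generalize (comul a : H ⊗[k] H) = t
      induction t with
      | zero => simp
      | add x y hx hy => simp only [map_add, TensorProduct.add_tmul, hx, hy]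
      | tmul c d => simp
    have e3 : antipodeShuffle k H ∘ₗ ((TensorProduct.assoc k H H H).toLinearMap ∘ₗ
          (comul (R := k) (A := H)).rTensor H).lTensor H =
        TensorProduct.mk k H H 1 ∘ₗ LinearMap.mul' k H ∘ₗ (antipode k).rTensor H ∘ₗ
          ((TensorProduct.lid k H).toLinearMap ∘ₗ
            (counit (R := k) (A := H)).rTensor H).lTensor H := by
      ext p q s
      have := mul_antipode_rTensor_comul_apply (R := k) q
      simp only [TensorProduct.AlgebraTensorModule.curry_apply, TensorProduct.curry_apply,
        LinearMap.coe_restrictScalars, LinearMap.comp_apply, LinearMap.lTensor_tmul,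
        LinearMap.rTensor_tmul, LinearEquiv.coe_coe, TensorProduct.lid_tmul,
        TensorProduct.tmul_smul, map_smul, LinearMap.mul'_apply, TensorProduct.mk_apply]
      have e : ∀ t : H ⊗[k] H, antipodeShuffle k H (p ⊗ₜ TensorProduct.assoc k H H H (t ⊗ₜ s)) =
          LinearMap.mul' k H ((antipode k).rTensor H t) ⊗ₜ (antipode k p * s) := by
        intro t
        induction t with
        | zero => simp
        | add x y hx hy => simp only [map_add, TensorProduct.add_tmul, TensorProduct.tmul_add, hx, hy]
        | tmul c d => simp [antipodeShuffle]
      rw [e, this, Algebra.algebraMap_eq_smul_one, TensorProduct.smul_tmul']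
    have h1 := LinearMap.congr_fun e1 (comul x)
    have h2 := LinearMap.congr_fun e2 (comul x)
    simp only [LinearMap.comp_apply, LinearEquiv.coe_coe, coassoc_apply] at h1 h2
    rw [h1, h2, ← LinearMap.lTensor_comp_apply]
    have e4 : (comul (R := k) (A := H)).lTensor H ∘ₗ comul =
        (TensorProduct.assoc k H H H).toLinearMap ∘ₗ (comul (R := k) (A := H)).rTensor H ∘ₗ
          comul := (Coalgebra.coassoc (R := k) (A := H)).symm
    have h3 := LinearMap.congr_fun e3 ((comul (R := k) (A := H)).lTensor H (comul x))
    simp only [LinearMap.comp_apply] at h3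
    rw [e4, ← LinearMap.comp_assoc, LinearMap.lTensor_comp, LinearMap.comp_apply, h3,
      ← LinearMap.lTensor_comp_apply, LinearMap.comp_assoc, rTensor_counit_comp_comul]
    have e5 : (TensorProduct.lid k H).toLinearMap ∘ₗ TensorProduct.mk k k H 1 =
      LinearMap.id := by ext; simp
    rw [e5]
    have := mul_antipode_rTensor_comul_apply (R := k) x
    simp only [LinearMap.lTensor_id, LinearMap.id_apply, this]
    simp [Algebra.algebraMap_eq_smul_one,
      Algebra.TensorProduct.one_def, TensorProduct.smul_tmul']
  have := left_inv_eq_right_inv hG LinearMap.comul_right_inv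
  have h1 := LinearMap.congr_fun (WithConv.toConv_injective this) h
  refine h1.symm.trans ?_
  change TensorProduct.map (antipode k) (antipode k) (TensorProduct.comm k H H (comul h)) = _
  generalize (comul h : H ⊗[k] H) = t
  induction t with
  | zero => simp
  | add x y hx hy => simp only [map_add, hx, hy]
  | tmul c d => simp

/-- Convolution inverses determine algebra maps: cancelling the antipode in `f ∘ S ∘ π = f ∘ S`. -/
lemma comp_eq_of_antipode_comp_eq {B : Type v} [Ring B] [Algebra k B] (f : H →ₐ[k] B)
    (p : H →ₗc[k] H)
    (h : f.toLinearMap ∘ₗ antipode k ∘ₗ p.toLinearMap = f.toLinearMap ∘ₗ antipode k) :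
    f.toLinearMap ∘ₗ p.toLinearMap = f.toLinearMap := by
  have i1 : WithConv.toConv (f.toLinearMap ∘ₗ antipode k) * WithConv.toConv f.toLinearMap = 1 := by
    have := LinearMap.algHom_comp_convMul_distrib f (WithConv.toConv (antipode k (A := H)))
      (WithConv.toConv LinearMap.id)
    rw [LinearMap.antipode_mul_id] at this
    refine (WithConv.ofConv_injective this).symm.trans ?_
    apply WithConv.ext
    ext x
    exact f.commutes _
  -- Precomposing f * (f ∘ S) = 1 with the coalgebra map `p` gives (f ∘ p) * (f ∘ S ∘ p) = 1, and
  -- the second factor is f ∘ S by hypothesis.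
  have i2 : WithConv.toConv (f.toLinearMap ∘ₗ p.toLinearMap) *
      WithConv.toConv (f.toLinearMap ∘ₗ antipode k) = 1 := by
    have i3 : WithConv.toConv f.toLinearMap * WithConv.toConv (f.toLinearMap ∘ₗ antipode k) = 1 := by
      have := LinearMap.algHom_comp_convMul_distrib f (WithConv.toConv LinearMap.id)
        (WithConv.toConv (antipode k (A := H)))
      rw [LinearMap.id_mul_antipode] at this
      refine (WithConv.ofConv_injective this).symm.trans ?_
      apply WithConv.ext
      ext x
      exact f.commutes _
    have := LinearMap.convMul_comp_coalgHom_distrib (WithConv.toConv f.toLinearMap)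
      (WithConv.toConv (f.toLinearMap ∘ₗ antipode k)) p
    rw [i3] at this
    simp only [LinearMap.comp_assoc, h] at this
    refine (WithConv.ofConv_injective this).symm.trans ?_
    apply WithConv.ext
    ext x
    exact congrArg (algebraMap k B) (LinearMap.congr_fun p.counit_comp x)
  exact WithConv.toConv_injective (left_inv_eq_right_inv i2 i1)

variable (k H) in
/-- The square of the antipode as an algebra map. -/
noncomputable def antipodeSq : H →ₐ[k] H :=
  AlgHom.ofLinearMap (antipode k ∘ₗ antipode k) (by simp)
    (by simp [antipode_mul_antidistrib])

lemma antipodeSq_pow_comul (m : ℕ) :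
    TensorProduct.map (antipodeSq k H ^ m).toLinearMap (antipodeSq k H ^ m).toLinearMap ∘ₗ comul =
      comul ∘ₗ (antipodeSq k H ^ m).toLinearMap := by
  induction m with
  | zero =>
    change TensorProduct.map LinearMap.id LinearMap.id ∘ₗ comul = comul ∘ₗ LinearMap.id
    simp
  | succ m ih =>
    have e : (antipodeSq k H ^ (m + 1)).toLinearMap =
      (antipode k ∘ₗ antipode k) ∘ₗ (antipodeSq k H ^ m).toLinearMap := by
      rw [pow_succ']; rfl
    rw [e, TensorProduct.map_comp, LinearMap.comp_assoc, ih]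
    refine LinearMap.ext fun x => ?_
    simp only [LinearMap.comp_apply]
    generalize (antipodeSq k H ^ m).toLinearMap x = y
    rw [comul_antipode, comul_antipode]
    generalize (comul y : H ⊗[k] H) = t
    induction t with
    | zero => simp
    | add x y hx hy => simp only [map_add, hx, hy]
    | tmul c d => simp

lemma antipodeSq_pow_counit (m : ℕ) :
    counit (R := k) ∘ₗ (antipodeSq k H ^ m).toLinearMap = counit := by
  induction m with
  | zero => rfl
  | succ m ih =>
    have e : (antipodeSq k H ^ (m + 1)).toLinearMap =
      (antipode k ∘ₗ antipode k) ∘ₗ (antipodeSq k H ^ m).toLinearMap := by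
      rw [pow_succ']; rfl
    rw [e, ← LinearMap.comp_assoc, ← LinearMap.comp_assoc, counit_comp_antipode,
      counit_comp_antipode, ih]

/-- Each square of the antipode is removed by two cancellations, first for the algebra map S ∘ S²ᵐ
into the opposite algebra, then for S²ᵐ. -/
lemma eq_id_of_antipodeSq_pow_comp (p : H →ₗc[k] H) (m : ℕ)
    (h : (antipodeSq k H ^ m).toLinearMap ∘ₗ p.toLinearMap = (antipodeSq k H ^ m).toLinearMap) :
    p.toLinearMap = LinearMap.id := by
  induction m with
  | zero => exact h
  | succ m ih =>
    apply ih
    apply comp_eq_of_antipode_comp_eq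
    have e : (antipodeSq k H ^ (m + 1)).toLinearMap =
      (antipodeSq k H ^ m).toLinearMap ∘ₗ antipode k ∘ₗ antipode k := by
      rw [pow_succ]; rfl
    have e' : ∀ x, antipode k ((antipodeSq k H ^ m) x) = (antipodeSq k H ^ m) (antipode k x) := by
      clear ih h e
      induction m with
      | zero => intro x; rfl
      | succ m ih =>
        intro x
        rw [pow_succ]
        exact ih _
    have h' := comp_eq_of_antipode_comp_eq ((antipodeAlgHomOp k H).comp (antipodeSq k H ^ m)) p (by
      refine LinearMap.ext fun x => ?_
      have := LinearMap.congr_fun h x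
      rw [e] at this
      refine congrArg MulOpposite.op ?_
      change antipode k ((antipodeSq k H ^ m) (antipode k (p x))) =
        antipode k ((antipodeSq k H ^ m) (antipode k x))
      rw [e', e']
      exact this)
    refine LinearMap.ext fun x => ?_
    have := congrArg MulOpposite.unop (LinearMap.congr_fun h' x)
    change antipode k ((antipodeSq k H ^ m) (p x)) = antipode k ((antipodeSq k H ^ m) x) at this
    rw [e', e'] at this
    exact this

/-- The antipode of a finite dimensional Hopf algebra is bijective. -/
theorem antipode_bijective_of_finite [Module.Finite k H] :
    Function.Bijective (antipode k (A := H)) := by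
  set T : Module.End k H := (antipodeSq k H).toLinearMap with hT
  have hpow : ∀ m, (antipodeSq k H ^ m).toLinearMap = T ^ m := by
    intro m
    induction m with
    | zero => rfl
    | succ m ih => rw [pow_succ, pow_succ, ← ih]; rfl
  -- Fitting decomposition of the square of the antipode. The exponent is taken positive so that the
  -- kernel of the antipode lies in that of `T ^ m`.
  obtain ⟨m, hm, hc⟩ : ∃ m, m ≠ 0 ∧ IsCompl (LinearMap.ker (T ^ m)) (LinearMap.range (T ^ m)) := by
    obtain ⟨m, hm⟩ := Filter.eventually_atTop.1 T.eventually_isCompl_ker_pow_range_pow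
    exact ⟨m + 1, by omega, hm _ (by omega)⟩
  have hcomul := antipodeSq_pow_comul (k := k) (H := H) m
  have hcounit := antipodeSq_pow_counit (k := k) (H := H) m
  have hid := fun p => eq_id_of_antipodeSq_pow_comp (k := k) (H := H) p m
  rw [hpow] at hcomul hcounit hid
  have hTS : ∀ x, antipode k x = 0 → (T ^ m) x = 0 := by
    obtain ⟨m, rfl⟩ := Nat.exists_eq_succ_of_ne_zero hm
    intro x hx
    rw [Nat.succ_eq_add_one, pow_succ]
    change (T ^ m) (antipode k (antipode k x)) = 0
    rw [hx, map_zero, map_zero]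
  generalize T ^ m = f at *
  let p : H →ₗ[k] H := Submodule.projection _ _ hc.symm
  have hp : ∀ x, p x ∈ LinearMap.range f := fun x => Submodule.projection_apply_mem hc.symm x
  have hfp : f ∘ₗ p = f := LinearMap.ext fun x => by
    have : x - p x ∈ LinearMap.ker f := by
      rw [← Submodule.projection_apply_eq_zero_iff hc.symm, map_sub, sub_eq_zero]
      exact (Submodule.projection_apply_left hc.symm ⟨p x, hp x⟩).symm
    rw [LinearMap.mem_ker, map_sub, sub_eq_zero] at this
    exact this.symm
  have hpf : p ∘ₗ f = f := LinearMap.ext fun x =>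
    Submodule.projection_apply_left hc.symm ⟨f x, ⟨x, rfl⟩⟩
  have hpp : p ∘ₗ p = p := LinearMap.ext fun x => by
    obtain ⟨y, hy⟩ := hp x
    rw [LinearMap.comp_apply, ← hy]
    exact LinearMap.congr_fun hpf y
  -- `w` is `f` on its range and the identity on its kernel, hence invertible. Writing `p` as `f`
  -- composed with its inverse `e.symm` on either side transfers compatibility with `comul` from `f`
  -- to `p`.
  let w : H →ₗ[k] H := f + (LinearMap.id - p)
  have hwp : w ∘ₗ p = f := by
    simp only [w, LinearMap.add_comp, LinearMap.sub_comp, hfp, hpp, LinearMap.id_comp, sub_self,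
      add_zero]
  have hpw : p ∘ₗ w = f := by
    simp only [w, LinearMap.comp_add, LinearMap.comp_sub, hpf, hpp, LinearMap.comp_id, sub_self,
      add_zero]
  have hw : Function.Injective w := by
    rw [← LinearMap.ker_eq_bot, LinearMap.ker_eq_bot']
    intro x hx
    have h1 : f x = 0 := by rw [← hpw, LinearMap.comp_apply, hx, map_zero]
    have h2 : p x = 0 := by
      have h3 : p x ∈ LinearMap.ker f := by
        rw [LinearMap.mem_ker]
        exact (LinearMap.congr_fun hfp x).trans h1
      exact (Submodule.disjoint_def.1 hc.disjoint) _ h3 (hp x)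
    have : w x = f x + (x - p x) := rfl
    rw [h1, h2, hx] at this
    simpa using this.symm
  let e := LinearEquiv.ofInjectiveEndo w hw
  have he : ∀ x, w x = e x := fun x => rfl
  have hpe : p = f ∘ₗ e.symm.toLinearMap := LinearMap.ext fun x => by
    rw [← hpw]
    simp [he]
  have hep : p = e.symm.toLinearMap ∘ₗ f := LinearMap.ext fun x => by
    rw [← hwp]
    simp [he]
  have c1 : TensorProduct.map p p ∘ₗ comul ∘ₗ p = comul ∘ₗ p := by
    have h1 : comul ∘ₗ p = TensorProduct.map f f ∘ₗ comul ∘ₗ e.symm.toLinearMap := by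
      rw [← LinearMap.comp_assoc, hcomul, LinearMap.comp_assoc, ← hpe]
    rw [h1, ← LinearMap.comp_assoc, ← TensorProduct.map_comp, hpf]
  have c2 : TensorProduct.map p p ∘ₗ comul ∘ₗ p = TensorProduct.map p p ∘ₗ comul := by
    have : TensorProduct.map p p = TensorProduct.map e.symm.toLinearMap e.symm.toLinearMap ∘ₗ
        TensorProduct.map f f := by rw [← TensorProduct.map_comp, ← hep]
    rw [this, LinearMap.comp_assoc, LinearMap.comp_assoc, ← LinearMap.comp_assoc p,
      hcomul, LinearMap.comp_assoc, hfp]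
  let P : H →ₗc[k] H :=
    { p with
      counit_comp := by
        rw [← hcounit, LinearMap.comp_assoc, hfp]
      map_comp_comul := by
        rw [← c2, c1] }
  -- The projection is a coalgebra map fixed by `f` under composition, so cancelling antipodes makes
  -- it the identity, and the kernel of `f` is trivial.
  have hP : p = LinearMap.id := hid P hfp
  have hinj : Function.Injective (antipode k (A := H)) := by
    rw [← LinearMap.ker_eq_bot, LinearMap.ker_eq_bot']
    intro x hx
    have h1 : p x = 0 := by rw [hep, LinearMap.comp_apply, hTS x hx, map_zero]
    rw [hP] at h1
    exact h1
  exact ⟨hinj, LinearMap.injective_iff_surjective.1 hinj⟩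

end Antipode
end YetterDrinfeld

namespace YetterDrinfeld

/-! ### Tensors in B ⊗ V* as linear maps V → B. -/

section Contract

variable (k : Type u) [Field k]

/-- The map `b ⊗ f ↦ (v ↦ f v • b)`. -/
noncomputable def contract (B : Type*) (V : Type u) [AddCommGroup B] [Module k B] [AddCommGroup V]
    [Module k V] : B ⊗[k] Module.Dual k V →ₗ[k] V →ₗ[k] B :=
  dualTensorHom k V B ∘ₗ (TensorProduct.comm k B (Module.Dual k V)).toLinearMap

variable {B B' : Type*} {V : Type u} [AddCommGroup B] [Module k B] [AddCommGroup B'] [Module k B']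
  [AddCommGroup V] [Module k V]

@[simp] lemma contract_tmul (b : B) (f : Module.Dual k V) (v : V) :
    contract k B V (b ⊗ₜ f) v = f v • b := by
  simp [contract]

lemma contract_rTensor (g : B →ₗ[k] B') (t : B ⊗[k] Module.Dual k V) (v : V) :
    contract k B' V (g.rTensor _ t) v = g (contract k B V t v) := by
  induction t with
  | zero => simp
  | add x y hx hy => simp only [map_add, LinearMap.add_apply, hx, hy]
  | tmul b f => simp

/-- For finite dimensional `B` the inverse splits a map into its coordinates in a basis; for finite
dimensional `V` this is the usual V* ⊗ B ≅ Hom(V, B). -/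
lemma contract_bijective (h : Module.Finite k B ∨ Module.Finite k V) :
    Function.Bijective (contract k B V) := by
  rcases h with h | h
  · let b := Module.finBasis k B
    refine Function.bijective_iff_has_inverse.2
      ⟨fun φ => ∑ i, b i ⊗ₜ (b.coord i ∘ₗ φ), fun t => ?_, fun φ => ?_⟩
    · induction t with
      | zero => simp
      | add x y hx hy =>
        simp only [map_add, LinearMap.comp_add, TensorProduct.tmul_add, Finset.sum_add_distrib] at hx hy ⊢
        rw [hx, hy]
      | tmul x f =>
        have e : ∀ i, b.coord i ∘ₗ contract k B V (x ⊗ₜ f) = b.repr x i • f := fun i => by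
          ext v
          simp [mul_comm]
        simp only [e, TensorProduct.tmul_smul]
        simp only [TensorProduct.smul_tmul', ← TensorProduct.sum_tmul, b.sum_repr]
    · ext v
      simp only [map_sum, LinearMap.sum_apply, contract_tmul, LinearMap.comp_apply,
        Module.Basis.coord_apply, b.sum_repr]
  · exact (dualTensorHomEquiv k V B).bijective.comp (TensorProduct.comm k B _).bijective

end Contract

/-! ### Dual Yetter–Drinfeld modules and their universal property. -/

section Dual

variable {k : Type u} [Field k] {H : Type v} [Ring H] [HopfAlgebra k H]

open HopfAlgebra Coalgebra

/-- The conditions under which `V` has a dual: the antipode is bijective, and `H` or `V` is finite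
dimensional. -/
structure Dualizable (V : YetterDrinfeld k H) : Prop where
  bij : Function.Bijective (antipode k (A := H))
  fin : Module.Finite k H ∨ Module.Finite k V

/-- The inverse of a bijective antipode. -/
noncomputable def antipodeInv (hS : Function.Bijective (antipode k (A := H))) : H →ₗ[k] H :=
  (LinearEquiv.ofBijective _ hS).symm.toLinearMap

variable (hS : Function.Bijective (antipode k (A := H)))

@[simp] lemma antipodeInv_antipode (x : H) : antipodeInv hS (antipode k x) = x :=
  (LinearEquiv.ofBijective _ hS).symm_apply_apply x

@[simp] lemma antipode_antipodeInv (x : H) : antipode k (antipodeInv hS x) = x :=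
  (LinearEquiv.ofBijective _ hS).apply_symm_apply x

lemma antipodeInv_mul (x y : H) :
    antipodeInv hS (x * y) = antipodeInv hS y * antipodeInv hS x := by
  apply hS.1
  simp [antipode_mul_antidistrib]

lemma counit_antipodeInv (x : H) : counit (R := k) (antipodeInv hS x) = counit x := by
  conv_rhs => rw [← antipode_antipodeInv hS x, counit_antipode]

lemma comul_antipodeInv (x : H) : comul (R := k) (antipodeInv hS x) =
    TensorProduct.comm k H H (TensorProduct.map (antipodeInv hS) (antipodeInv hS) (comul x)) := by
  obtain ⟨y, rfl⟩ := hS.2 x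
  rw [antipodeInv_antipode, comul_antipode]
  generalize (comul y : H ⊗[k] H) = t
  induction t with
  | zero => simp
  | add x y hx hy => simp only [map_add, ← hx, ← hy]
  | tmul a b => simp

/-- In Sweedler notation S⁻¹(x₂) x₁ = ε(x). Applying S turns it into S(x₁) x₂ = ε(x). -/
lemma mul_antipodeInv_comm (x : H) : LinearMap.mul' k H (TensorProduct.comm k H H
    ((antipodeInv hS).lTensor H (comul x))) = algebraMap k H (counit x) := by
  have := mul_antipode_rTensor_comul_apply (R := k) x
  apply hS.1
  have e : ∀ t : H ⊗[k] H, antipode k (LinearMap.mul' k H (TensorProduct.comm k H H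
    ((antipodeInv hS).lTensor H t))) = LinearMap.mul' k H ((antipode k).rTensor H t) := by
    intro t
    induction t with
    | zero => simp
    | add x y hx hy => simp only [map_add, hx, hy]
    | tmul a b => simp [antipode_mul_antidistrib]
  rw [e, this, Algebra.algebraMap_eq_smul_one, map_smul, antipode_one]

lemma mul_comm_antipodeInv (x : H) : LinearMap.mul' k H (TensorProduct.comm k H H
    ((antipodeInv hS).rTensor H (comul x))) = algebraMap k H (counit x) := by
  have := mul_antipode_lTensor_comul_apply (R := k) x
  apply hS.1
  have e : ∀ t : H ⊗[k] H, antipode k (LinearMap.mul' k H (TensorProduct.comm k H H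
    ((antipodeInv hS).rTensor H t))) = LinearMap.mul' k H ((antipode k).lTensor H t) := by
    intro t
    induction t with
    | zero => simp
    | add x y hx hy => simp only [map_add, hx, hy]
    | tmul a b => simp [antipode_mul_antidistrib]
  rw [e, this, Algebra.algebraMap_eq_smul_one, map_smul, antipode_one]

/-- The map `x ⊗ v ↦ f v • S⁻¹ x`. -/
noncomputable def evalInv {V : Type u} [AddCommGroup V] [Module k V] (f : Module.Dual k V) :
    H ⊗[k] V →ₗ[k] H :=
  (TensorProduct.rid k H).toLinearMap ∘ₗ TensorProduct.map (antipodeInv hS) f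

@[simp] lemma evalInv_tmul {V : Type u} [AddCommGroup V] [Module k V] (f : Module.Dual k V) (x : H)
    (v : V) : evalInv hS f (x ⊗ₜ v) = f v • antipodeInv hS x := by
  simp [evalInv]

variable (V : YetterDrinfeld k H) (hV : Dualizable V)

/-- The contragredient action `(h f)(v) = f (S(h) v)`. -/
noncomputable def dualAct : H →ₐ[k] Module.End k (Module.Dual k V) :=
  AlgHom.ofLinearMap (Module.Dual.transpose ∘ₗ V.act.toLinearMap ∘ₗ antipode k)
    (by ext; simp; rfl) (by intros; ext; simp [antipode_mul_antidistrib]; rfl)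

@[simp] lemma dualAct_apply (h : H) (f : Module.Dual k V) (v : V) :
    dualAct V h f v = f (V.act (antipode k h) v) := rfl

variable {V}

/-- The coaction of the dual: `f₍₋₁₎ f₍₀₎(v) = S⁻¹(v₍₋₁₎) f(v₍₀₎)`. -/
noncomputable def dualCoact : Module.Dual k V →ₗ[k] H ⊗[k] Module.Dual k V :=
  (LinearEquiv.ofBijective _ (contract_bijective k hV.fin)).symm.toLinearMap ∘ₗ
    (LinearMap.lcomp k H V.coact) ∘ₗ LinearMap.llcomp k (H ⊗[k] V) (H ⊗[k] k) H
      (TensorProduct.rid k H).toLinearMap ∘ₗ TensorProduct.mapBilinear (.id k) H V H k (antipodeInv hV.bij)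

lemma contract_dualCoact (f : Module.Dual k V) (v : V) :
    contract k H V (dualCoact hV f) v = evalInv hV.bij f (V.coact v) :=
  LinearMap.congr_fun ((LinearEquiv.ofBijective _ (contract_bijective k hV.fin)).apply_symm_apply _)
    v

lemma contract_injective (hV : Dualizable V) : Function.Injective (contract k H V) :=
  (contract_bijective k hV.fin).1

lemma contract_tensor_injective (hV : Dualizable V) :
    Function.Injective (contract k (H ⊗[k] H) V) :=
  (contract_bijective k (hV.fin.imp (fun h => @Module.Finite.tensorProduct k H H _ _ _ _ _ h h) id)).1

/-- Dualizing a left coaction reverses the order of coefficients; S⁻¹ reverses it back, so the dual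
carries a left coaction again. -/
lemma coassoc_aux (f : Module.Dual k V) (v : V) :
    comul (evalInv hS f (V.coact v)) =
      TensorProduct.comm k H H (TensorProduct.map (antipodeInv hS) (evalInv hS f)
        (V.coact.lTensor H (V.coact v))) := by
  have e : comul ∘ₗ evalInv hS f =
      (TensorProduct.comm k H H).toLinearMap ∘ₗ TensorProduct.map (antipodeInv hS) (evalInv hS f) ∘ₗ
        (TensorProduct.assoc k H H V).toLinearMap ∘ₗ (comul (R := k) (A := H)).rTensor V := by
    ext x w
    simp only [TensorProduct.AlgebraTensorModule.curry_apply, TensorProduct.curry_apply,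
      LinearMap.coe_restrictScalars, LinearMap.comp_apply, LinearMap.rTensor_tmul, evalInv_tmul,
      map_smul, comul_antipodeInv]
    generalize (comul x : H ⊗[k] H) = t
    induction t with
    | zero => simp
    | add x y hx hy => simp only [map_add, TensorProduct.add_tmul, smul_add, hx, hy]
    | tmul a b => simp
  have c1 := LinearMap.congr_fun V.coassoc v
  have h1 := LinearMap.congr_fun e (V.coact v)
  simp only [LinearMap.comp_apply, LinearEquiv.coe_coe] at c1 h1
  rw [h1, c1]

lemma dual_coassoc : (TensorProduct.assoc k H H (Module.Dual k V)).toLinearMap ∘ₗ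
    (comul (R := k) (A := H)).rTensor (Module.Dual k V) ∘ₗ dualCoact hV =
      (dualCoact hV).lTensor H ∘ₗ dualCoact hV := by
  refine LinearMap.ext fun f => ?_
  apply (TensorProduct.assoc k H H (Module.Dual k V)).symm.injective
  apply contract_tensor_injective hV
  refine LinearMap.ext fun v => ?_
  simp only [LinearMap.comp_apply, LinearEquiv.coe_coe, LinearEquiv.symm_apply_apply,
    contract_rTensor, contract_dualCoact, coassoc_aux]
  have e : ∀ t : H ⊗[k] Module.Dual k V, contract k (H ⊗[k] H) V
      ((TensorProduct.assoc k H H (Module.Dual k V)).symm ((dualCoact hV).lTensor H t)) v =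
      TensorProduct.comm k H H (TensorProduct.map (antipodeInv hV.bij) (contract k H V t)
        (V.coact v)) := by
    intro t
    induction t with
    | zero => simp
    | add x y hx hy =>
      simp only [map_add, LinearMap.add_apply, TensorProduct.map_add_right, hx, hy]
    | tmul a g =>
      have e1 : ∀ s : H ⊗[k] Module.Dual k V, contract k (H ⊗[k] H) V
        ((TensorProduct.assoc k H H (Module.Dual k V)).symm (a ⊗ₜ s)) v =
          a ⊗ₜ contract k H V s v := by
        intro s
        induction s with
        | zero => simp
        | add x y hx hy =>
          simp only [map_add, LinearMap.add_apply, TensorProduct.tmul_add, hx, hy]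
        | tmul b g => simp
      rw [LinearMap.lTensor_tmul, e1, contract_dualCoact]
      generalize V.coact v = s
      induction s with
      | zero => simp
      | add x y hx hy => simp only [map_add, TensorProduct.tmul_add, hx, hy]
      | tmul b w => simp
  have e2 : contract k H V (dualCoact hV f) = evalInv hV.bij f ∘ₗ V.coact :=
    LinearMap.ext (contract_dualCoact hV f)
  rw [e, e2, ← LinearMap.comp_apply (TensorProduct.map _ _), ← LinearMap.map_comp_lTensor]

lemma dual_counit : (TensorProduct.lid k (Module.Dual k V)).toLinearMap ∘ₗ
    (counit (R := k) (A := H)).rTensor (Module.Dual k V) ∘ₗ dualCoact hV = LinearMap.id := by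
  refine LinearMap.ext fun f => LinearMap.ext fun v => ?_
  have e : ∀ t : k ⊗[k] Module.Dual k V, TensorProduct.lid k (Module.Dual k V) t v =
      contract k k V t v := by
    intro t
    induction t with
    | zero => simp
    | add x y hx hy => simp only [map_add, LinearMap.add_apply, hx, hy]
    | tmul a g => simp [mul_comm]
  simp only [LinearMap.comp_apply, LinearEquiv.coe_coe, e, contract_rTensor, contract_dualCoact]
  have e1 : counit (R := k) ∘ₗ evalInv hV.bij f = f ∘ₗ (TensorProduct.lid k V).toLinearMap ∘ₗ
      (counit (R := k) (A := H)).rTensor V := by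
    ext x w
    simp [counit_antipodeInv, mul_comm]
  have h1 := LinearMap.congr_fun e1 (V.coact v)
  have c1 := LinearMap.congr_fun V.counit_coact v
  simp only [LinearMap.comp_apply] at h1 c1
  rw [h1, c1]
  simp

/-- Evaluated at `v`, the antipode-free compatibility of the dual at `h` is that of `V` at S(h),
with the two sides interchanged. -/
lemma dual_compat (h : H) (f : Module.Dual k V) :
    dualCoact hV (dualAct V h f) = twist k (dualAct V) h (dualCoact hV f) := by
  revert h f
  rw [compat_iff]
  intro h f
  apply contract_injective hV
  refine LinearMap.ext fun v => ?_
  have r1 : ∀ (b : H) (t : H ⊗[k] Module.Dual k V),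
      contract k H V (rightMul k (Module.Dual k V) b t) v = contract k H V t v * b := by
    intro b t
    induction t with
    | zero => simp
    | add x y hx hy => simp only [map_add, LinearMap.add_apply, add_mul, hx, hy]
    | tmul a g => simp
  have r2 : ∀ (a : H) (t : H ⊗[k] V), evalInv hV.bij f (rightMul k V (antipode k a) t) =
      a * evalInv hV.bij f t := by
    intro a t
    induction t with
    | zero => simp
    | add x y hx hy => simp only [map_add, mul_add, hx, hy]
    | tmul c w => simp [antipodeInv_mul]
  let E := (Module.endTensorEndAlgHom (R := k) (S := k) (A := k) (M := H) (N := V)).comp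
    (Algebra.TensorProduct.map (Algebra.lmul k H) V.act)
  let E' := (Module.endTensorEndAlgHom (R := k) (S := k) (A := k) (M := H)
    (N := Module.Dual k V)).comp (Algebra.TensorProduct.map (Algebra.lmul k H) (dualAct V))
  have l1 : ∀ s : H ⊗[k] H, contract k H V (sweep k (dualAct V) (dualCoact hV) s f) v =
      evalInv hV.bij f (E (TensorProduct.comm k H H
        (TensorProduct.map (antipode k) (antipode k) s)) (V.coact v)) := by
    intro s
    induction s with
    | zero => simp
    | add x y hx hy => simp only [map_add, LinearMap.add_apply, hx, hy]
    | tmul a b =>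
      rw [sweep_tmul, r1, contract_dualCoact]
      generalize V.coact v = t
      induction t with
      | zero => simp
      | add x y hx hy => simp only [map_add, add_mul, hx, hy]
      | tmul c w => simp [E, Module.endTensorEndAlgHom_apply, antipodeInv_mul]
  have l2 : ∀ s : H ⊗[k] H, contract k H V (E' s (dualCoact hV f)) v =
      evalInv hV.bij f (sweep k V.act V.coact (TensorProduct.comm k H H
        (TensorProduct.map (antipode k) (antipode k) s)) v) := by
    intro s
    induction s with
    | zero => simp
    | add x y hx hy => simp only [map_add, LinearMap.add_apply, hx, hy]
    | tmul a b =>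
      rw [TensorProduct.map_tmul, TensorProduct.comm_tmul, sweep_tmul, r2, ← contract_dualCoact hV]
      generalize dualCoact hV f = t
      induction t with
      | zero => simp
      | add x y hx hy => simp only [map_add, LinearMap.add_apply, mul_add, hx, hy]
      | tmul c g => simp [E', Module.endTensorEndAlgHom_apply]
  have l3 := l2 (comul h)
  rw [← comul_antipode, sweep_comul] at l3
  rw [l1, ← comul_antipode]
  exact l3.symm

variable (V) in
/-- The dual of a dualizable Yetter-Drinfeld module. -/
noncomputable def dual (hV : Dualizable V) : YetterDrinfeld k H where
  carrier := Module.Dual k V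
  act := dualAct V
  coact := dualCoact hV
  coassoc := dual_coassoc hV
  counit_coact := dual_counit hV
  compat := dual_compat hV

/-- Colinearity of the evaluation: the coefficient becomes S⁻¹(v₍₋₁₎) v₍₋₂₎ f(v₍₀₎), which collapses
by `mul_antipodeInv_comm`. -/
lemma tensorCoact_lift_aux (f : Module.Dual k V) (v : V) :
    (contractLeft k V).lTensor H (tensorCoact k (dualCoact hV) V.coact (f ⊗ₜ v)) =
      (1 : H) ⊗ₜ f v := by
  have e1 : ∀ (t : H ⊗[k] Module.Dual k V) (s : H ⊗[k] V),
      (contractLeft k V).lTensor H (merge k H _ _ (t ⊗ₜ s)) =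
        (LinearMap.mul' k H (TensorProduct.comm k H H (TensorProduct.map .id (contract k H V t) s)))
          ⊗ₜ 1 := by
    intro t s
    induction t with
    | zero => simp
    | add x y hx hy =>
      simp only [map_add, TensorProduct.map_add_right, TensorProduct.add_tmul,
        LinearMap.add_apply, hx, hy]
    | tmul a g =>
      induction s with
      | zero => simp
      | add x y hx hy => simp only [map_add, TensorProduct.tmul_add, TensorProduct.add_tmul, hx, hy]
      | tmul b w => simp [TensorProduct.smul_tmul]
  have e2 : contract k H V (dualCoact hV f) = evalInv hV.bij f ∘ₗ V.coact :=
    LinearMap.ext (contract_dualCoact hV f)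
  have e3 : LinearMap.mul' k H ∘ₗ (TensorProduct.comm k H H).toLinearMap ∘ₗ
      (evalInv hV.bij f).lTensor H ∘ₗ (TensorProduct.assoc k H H V).toLinearMap ∘ₗ
        (comul (R := k) (A := H)).rTensor V =
      (Algebra.linearMap k H) ∘ₗ f ∘ₗ (TensorProduct.lid k V).toLinearMap ∘ₗ
        (counit (R := k) (A := H)).rTensor V := by
    ext x w
    have := mul_antipodeInv_comm hV.bij x
    have e4 : ∀ t : H ⊗[k] H, LinearMap.mul' k H (TensorProduct.comm k H H
      ((evalInv hV.bij f).lTensor H (TensorProduct.assoc k H H V (t ⊗ₜ w)))) =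
      f w • LinearMap.mul' k H (TensorProduct.comm k H H
        ((antipodeInv hV.bij).lTensor H t)) := by
      intro t
      induction t with
      | zero => simp
      | add x y hx hy => simp only [map_add, TensorProduct.add_tmul, smul_add, hx, hy]
      | tmul a b => simp
    simp [e4, this, Algebra.algebraMap_eq_smul_one, smul_smul, mul_comm]
  have c1 := LinearMap.congr_fun V.coassoc v
  have c2 := LinearMap.congr_fun V.counit_coact v
  have h3 := LinearMap.congr_fun e3 (V.coact v)
  simp only [LinearMap.comp_apply, LinearEquiv.coe_coe] at c1 c2 h3
  rw [c1, c2] at h3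
  rw [tensorCoact_tmul, e1, e2]
  rw [LinearMap.lTensor, ← LinearMap.comp_apply (TensorProduct.map _ _), LinearMap.lTensor,
    ← TensorProduct.map_comp, LinearMap.id_comp] at h3
  rw [h3]
  simp [Algebra.algebraMap_eq_smul_one, TensorProduct.smul_tmul]

variable (V) in
/-- The evaluation morphism. -/
noncomputable def dualEv (hV : Dualizable V) : dual V hV ⊗ V ⟶ 𝟙_ (YetterDrinfeld k H) where
  lin := contractLeft k V
  map_act h (z : Module.Dual k V ⊗[k] V) := by
    change contractLeft k V (tensorAct k (dualAct V) V.act h z) =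
      algebraMap k (Module.End k k) (counit h) (contractLeft k V z)
    induction z with
    | zero => simp
    | add x y hx hy => simp only [map_add, hx, hy]
    | tmul f v =>
      rw [tensorAct_tmul]
      have e : ∀ t : H ⊗[k] H, contractLeft k V (TensorProduct.map
          ((dualAct V).toLinearMap.flip f) (V.act.toLinearMap.flip v) t) =
          f (V.act (LinearMap.mul' k H ((antipode k).rTensor H t)) v) := by
        intro t
        induction t with
        | zero => simp
        | add x y hx hy => simp only [map_add, LinearMap.add_apply, hx, hy]
        | tmul a b => simp
      rw [e, mul_antipode_rTensor_comul_apply]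
      simp [Algebra.algebraMap_eq_smul_one]
  map_coact (z : Module.Dual k V ⊗[k] V) := by
    change (1 : H) ⊗ₜ contractLeft k V z = (contractLeft k V).lTensor H
      (tensorCoact k (dualCoact hV) V.coact z)
    induction z with
    | zero => simp
    | add x y hx hy => simp only [map_add, TensorProduct.tmul_add, hx, hy]
    | tmul f v => rw [tensorCoact_lift_aux, contractLeft_apply]

/-- The unit object has trivial action. -/
lemma lin_act {X : YetterDrinfeld k H} (φ : X ⊗ V ⟶ 𝟙_ (YetterDrinfeld k H)) (h : H) (x : X)
    (v : V) : φ.lin (TensorProduct.map (X.act.toLinearMap.flip x) (V.act.toLinearMap.flip v)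
      (comul h) : X ⊗[k] V) = counit (R := k) h • φ.lin (x ⊗ₜ[k] v : X ⊗[k] V) := by
  have := φ.map_act h (x ⊗ₜ[k] v : X ⊗[k] V)
  change φ.lin (tensorAct k X.act V.act h (x ⊗ₜ v)) =
    algebraMap k (Module.End k k) (counit h) (φ.lin (x ⊗ₜ[k] v : X ⊗[k] V)) at this
  rw [tensorAct_tmul] at this
  exact this

/-- A morphism `X ⊗ V ⟶ 𝟙_` intertwines the action on `X` with the contragredient one. -/
lemma lin_act_antipode {X : YetterDrinfeld k H} (φ : X ⊗ V ⟶ 𝟙_ (YetterDrinfeld k H)) (h : H)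
    (x : X) (v : V) : φ.lin (X.act h x ⊗ₜ[k] v : X ⊗[k] V) =
      φ.lin (x ⊗ₜ[k] V.act (antipode k h) v : X ⊗[k] V) := by
  let L : X ⊗[k] V →ₗ[k] k := φ.lin
  have hL : ∀ h x v, L (TensorProduct.map (X.act.toLinearMap.flip x) (V.act.toLinearMap.flip v)
    (comul h)) = counit (R := k) h • L (x ⊗ₜ v) := lin_act φ
  change L _ = L _
  -- `K` is a ⊗ b ⊗ c ↦ L(a x ⊗ b S(c) v). On the iterated coproduct of `h` it collapses to L(h x ⊗
  -- v) by the antipode axiom and to L(x ⊗ S(h) v) by linearity of `φ`.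
  let K : H ⊗[k] (H ⊗[k] H) →ₗ[k] k := L ∘ₗ TensorProduct.map (X.act.toLinearMap.flip x)
    (V.act.toLinearMap.flip v ∘ₗ LinearMap.mul' k H ∘ₗ (antipode k).lTensor H)
  have e1 : K ∘ₗ (comul (R := k) (A := H)).lTensor H =
      L ∘ₗ (TensorProduct.mk k X V).flip v ∘ₗ X.act.toLinearMap.flip x ∘ₗ
        (TensorProduct.rid k H).toLinearMap ∘ₗ (counit (R := k) (A := H)).lTensor H := by
    ext a b
    have := mul_antipode_lTensor_comul_apply (R := k) b
    simp only [LinearMap.lTensor] at this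
    simp [K, LinearMap.lTensor, this, Algebra.algebraMap_eq_smul_one]
  have e2 : K ∘ₗ (TensorProduct.assoc k H H H).toLinearMap ∘ₗ
      (comul (R := k) (A := H)).rTensor H =
      L ∘ₗ TensorProduct.mk k X V x ∘ₗ V.act.toLinearMap.flip v ∘ₗ antipode k ∘ₗ
        (TensorProduct.lid k H).toLinearMap ∘ₗ (counit (R := k) (A := H)).rTensor H := by
    ext a b
    have e3 : ∀ t : H ⊗[k] H, K (TensorProduct.assoc k H H H (t ⊗ₜ b)) =
        L (TensorProduct.map (X.act.toLinearMap.flip x)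
          (V.act.toLinearMap.flip (V.act (antipode k b) v)) t) := by
      intro t
      induction t with
      | zero => simp
      | add x y hx hy => simp only [map_add, TensorProduct.add_tmul, hx, hy]
      | tmul c d => simp [K]
    simp [e3, hL]
  have h1 := LinearMap.congr_fun e1 (comul h)
  have h2 := LinearMap.congr_fun e2 (comul h)
  simp only [LinearMap.comp_apply, LinearEquiv.coe_coe, coassoc_apply, lTensor_counit_comul,
    rTensor_counit_comul] at h1 h2
  rw [h1] at h2
  simpa using h2

lemma lin_coact {X : YetterDrinfeld k H} (φ : X ⊗ V ⟶ 𝟙_ (YetterDrinfeld k H)) (x : X) (v : V) :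
    (show X ⊗[k] V →ₗ[k] k from φ.lin).lTensor H
      (merge k H X V (X.coact x ⊗ₜ V.coact v)) =
      (1 : H) ⊗ₜ[k] (φ.lin (x ⊗ₜ[k] v : X ⊗[k] V) : k) :=
  (φ.map_coact (x ⊗ₜ[k] v : X ⊗[k] V)).symm

/-- A morphism `X ⊗ V ⟶ 𝟙_` intertwines the coaction on `X` with the contragredient one. -/
lemma evalInv_lin {X : YetterDrinfeld k H} (φ : X ⊗ V ⟶ 𝟙_ (YetterDrinfeld k H)) (x : X) (v : V) :
    evalInv hS (TensorProduct.curry (φ.lin : X ⊗[k] V →ₗ[k] k) x) (V.coact v) =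
      contract k H V ((TensorProduct.curry (φ.lin : X ⊗[k] V →ₗ[k] k)).lTensor H (X.coact x)) v := by
  let L : X ⊗[k] V →ₗ[k] k := φ.lin
  have hL : ∀ v, L.lTensor H (merge k H X V (X.coact x ⊗ₜ V.coact v)) =
      (1 : H) ⊗ₜ[k] L (x ⊗ₜ[k] v) := lin_coact φ x
  change evalInv hS (TensorProduct.curry L x) (V.coact v) =
    contract k H V ((TensorProduct.curry L).lTensor H (X.coact x)) v
  -- `M` is a ⊗ b ⊗ w ↦ L(x₍₀₎ ⊗ w) x₍₋₁₎ b S⁻¹(a). On the twofold coaction of `v`, colinearity of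
  -- `φ` gives one side, and b S⁻¹(a) collapses to the counit to give the other.
  let M : H ⊗[k] (H ⊗[k] V) →ₗ[k] H := LinearMap.mul' k H ∘ₗ
    (TensorProduct.comm k H H).toLinearMap ∘ₗ TensorProduct.map (antipodeInv hS)
      ((TensorProduct.rid k H).toLinearMap ∘ₗ L.lTensor H ∘ₗ merge k H X V ∘ₗ
        TensorProduct.mk k (H ⊗[k] X) (H ⊗[k] V) (X.coact x))
  have e1 : M ∘ₗ V.coact.lTensor H = evalInv hS (TensorProduct.curry L x) := by
    ext a w
    simp [M, hL]
  have e2 : M ∘ₗ (TensorProduct.assoc k H H V).toLinearMap ∘ₗ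
      (comul (R := k) (A := H)).rTensor V =
      contract k H V ((TensorProduct.curry L).lTensor H (X.coact x)) ∘ₗ
        (TensorProduct.lid k V).toLinearMap ∘ₗ (counit (R := k) (A := H)).rTensor V := by
    ext a w
    have := mul_comm_antipodeInv hS a
    have e3 : ∀ t : H ⊗[k] H, M (TensorProduct.assoc k H H V (t ⊗ₜ w)) =
        contract k H V ((TensorProduct.curry L).lTensor H (X.coact x)) w *
          LinearMap.mul' k H (TensorProduct.comm k H H ((antipodeInv hS).rTensor H t)) := by
      intro t
      induction t with
      | zero => simp
      | add x y hx hy => simp only [map_add, TensorProduct.add_tmul, mul_add, hx, hy]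
      | tmul c d =>
        simp only [M, TensorProduct.assoc_tmul, LinearMap.comp_apply, TensorProduct.map_tmul,
          TensorProduct.mk_apply, LinearEquiv.coe_coe, TensorProduct.comm_tmul,
          LinearMap.mul'_apply, LinearMap.rTensor_tmul]
        generalize X.coact x = s
        induction s with
        | zero => simp
        | add x y hx hy =>
          simp only [map_add, TensorProduct.add_tmul, add_mul, LinearMap.add_apply, hx, hy]
        | tmul e y => simp [mul_assoc]
    simp [e3, this, Algebra.algebraMap_eq_smul_one]
  have c1 := LinearMap.congr_fun V.coassoc v
  have c2 := LinearMap.congr_fun V.counit_coact v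
  have h2 := LinearMap.congr_fun e2 (V.coact v)
  have h1 := LinearMap.congr_fun e1 (V.coact v)
  simp only [LinearMap.comp_apply, LinearEquiv.coe_coe] at c1 c2 h1 h2
  rw [c1, c2, h1] at h2
  exact h2

/-- The morphism to the dual corresponding to a pairing. -/
noncomputable def dualLift (hV : Dualizable V) {X : YetterDrinfeld k H}
    (φ : X ⊗ V ⟶ 𝟙_ (YetterDrinfeld k H)) : X ⟶ dual V hV where
  lin := TensorProduct.curry (φ.lin : X ⊗[k] V →ₗ[k] k)
  map_act h x := LinearMap.ext fun v => lin_act_antipode φ h x v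
  map_coact x := by
    apply contract_injective hV
    refine LinearMap.ext fun v => ?_
    exact (contract_dualCoact hV _ v).trans (evalInv_lin hV.bij φ x v)

lemma isInternalDual_dualEv (hV : Dualizable V) : IsInternalDual (dualEv V hV) := by
  intro X φ
  refine ⟨dualLift hV φ, ?_, ?_⟩
  · apply hom_ext
    refine TensorProduct.ext' fun x v => ?_
    rfl
  · rintro g rfl
    apply hom_ext
    refine LinearMap.ext fun x => LinearMap.ext fun v => ?_
    rfl

end Dual

end YetterDrinfeld

namespace YetterDrinfeld

/-! ### Transposing coproducts N → Q ⊗ P to products P* ⊗ Q* → N*. -/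

section Pair

variable {k : Type u} [Field k] {H : Type v} [Ring H] [HopfAlgebra k H]

open HopfAlgebra Coalgebra

variable {M M' N N' P P' Q Q' R : YetterDrinfeld k H}

/-- The transpose of a morphism. -/
noncomputable def dualMap (hN : Dualizable N) (hP : Dualizable P) (w : N ⟶ P) :
    dual P hP ⟶ dual N hN :=
  dualLift hN (dual P hP ◁ w ≫ dualEv P hP)

lemma dualMap_lin (hN : Dualizable N) (hP : Dualizable P) (w : N ⟶ P) (f : Module.Dual k P) :
    (dualMap hN hP w).lin f = f ∘ₗ w.lin := rfl

lemma dualMap_comp (hM : Dualizable M) (hN : Dualizable N) (hP : Dualizable P) (w : M ⟶ N)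
    (w' : N ⟶ P) : dualMap hM hP (w ≫ w') = dualMap hN hP w' ≫ dualMap hM hN w := rfl

lemma dualMap_zero (hN : Dualizable N) (hP : Dualizable P) :
    dualMap hN hP (0 : N ⟶ P) = 0 := by
  apply hom_ext
  refine LinearMap.ext fun f => ?_
  exact LinearMap.comp_zero (f : P →ₗ[k] k)

/-- The pairing `(f ⊗ g) ⊗ (y ⊗ x) ↦ f x * g y`. -/
noncomputable def doubleEv (hP : Dualizable P) (hQ : Dualizable Q) :
    (dual P hP ⊗ dual Q hQ) ⊗ (Q ⊗ P) ⟶ 𝟙_ (YetterDrinfeld k H) :=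
  (α_ _ _ _).hom ≫ dual P hP ◁ ((α_ _ _ _).inv ≫ dualEv Q hQ ▷ P ≫ (λ_ P).hom) ≫ dualEv P hP

lemma doubleEv_lin (hP : Dualizable P) (hQ : Dualizable Q) (f : Module.Dual k P)
    (g : Module.Dual k Q) (t : Q ⊗[k] P) :
    (doubleEv hP hQ).lin (tmul (V := dual P hP ⊗ dual Q hQ) (W := Q ⊗ P)
      (tmul (V := dual P hP) (W := dual Q hQ) f g) t) = tensorDual g f t := by
  have e : (doubleEv hP hQ).lin ∘ₗ (TensorProduct.mk k (dual P hP ⊗ dual Q hQ : YetterDrinfeld k H)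
      (Q ⊗[k] P) (tmul (V := dual P hP) (W := dual Q hQ) f g)) = tensorDual g f := by
    refine TensorProduct.ext' fun y x => ?_
    exact map_smul (f : P →ₗ[k] k) (g y) x
  exact LinearMap.congr_fun e t

/-- The product `dual P ⊗ dual Q ⟶ dual N` along `T : N ⟶ Q ⊗ P`. -/
noncomputable def pair (hN : Dualizable N) (hP : Dualizable P) (hQ : Dualizable Q)
    (T : N ⟶ Q ⊗ P) : dual P hP ⊗ dual Q hQ ⟶ dual N hN :=
  dualLift hN ((dual P hP ⊗ dual Q hQ) ◁ T ≫ doubleEv hP hQ)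

/-- The factors are interchanged because the evaluation is nested; this produces the opposite cup
product. -/
lemma pair_lin (hN : Dualizable N) (hP : Dualizable P) (hQ : Dualizable Q)
    (T : N ⟶ Q ⊗ P) (f : Module.Dual k P) (g : Module.Dual k Q) :
    (pair hN hP hQ T).lin (tmul (V := dual P hP) (W := dual Q hQ) f g) =
      tensorDual g f ∘ₗ T.lin :=
  LinearMap.ext fun x => doubleEv_lin hP hQ f g (T.lin x)

lemma pair_ext {hP : Dualizable P} {hQ : Dualizable Q} {E : YetterDrinfeld k H}
    {φ ψ : dual P hP ⊗ dual Q hQ ⟶ E} (h : ∀ (f : Module.Dual k P) (g : Module.Dual k Q),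
      φ.lin (tmul (V := dual P hP) (W := dual Q hQ) f g) =
        ψ.lin (tmul (V := dual P hP) (W := dual Q hQ) f g)) : φ = ψ :=
  hom_ext (TensorProduct.ext' h)

variable (hM : Dualizable M) (hM' : Dualizable M') (hN : Dualizable N) (hN' : Dualizable N')
  (hP : Dualizable P) (hP' : Dualizable P') (hQ : Dualizable Q) (hQ' : Dualizable Q')
  (hR : Dualizable R)

lemma pair_add (T U : N ⟶ Q ⊗ P) :
    pair hN hP hQ (T + U) = pair hN hP hQ T + pair hN hP hQ U := by
  refine pair_ext fun f g => ?_
  rw [add_lin, LinearMap.add_apply, pair_lin, pair_lin, pair_lin, add_lin]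
  exact LinearMap.comp_add _ _ _

/-- `pair` as a homomorphism. -/
noncomputable def pairHom : (N ⟶ Q ⊗ P) →+ (dual P hP ⊗ dual Q hQ ⟶ dual N hN) :=
  AddMonoidHom.mk' (pair hN hP hQ) (pair_add hN hP hQ)

lemma pair_zsmul (n : ℤ) (T : N ⟶ Q ⊗ P) :
    pair hN hP hQ (n • T) = n • pair hN hP hQ T :=
  map_zsmul (pairHom hN hP hQ) n T

lemma pair_sub (T U : N ⟶ Q ⊗ P) :
    pair hN hP hQ (T - U) = pair hN hP hQ T - pair hN hP hQ U :=
  map_sub (pairHom hN hP hQ) T U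

lemma pair_comp (u : N' ⟶ N) (T : N ⟶ Q ⊗ P) :
    pair hN' hP hQ (u ≫ T) = pair hN hP hQ T ≫ dualMap hN' hN u := by
  refine pair_ext fun f g => ?_
  rw [comp_lin, LinearMap.comp_apply, pair_lin, pair_lin, dualMap_lin, comp_lin]
  rfl

lemma pair_whiskerLeft (T : N ⟶ Q ⊗ P) (w : P ⟶ P') :
    pair hN hP' hQ (T ≫ Q ◁ w) = dualMap hP hP' w ▷ dual Q hQ ≫ pair hN hP hQ T := by
  refine pair_ext fun f g => ?_
  rw [pair_lin, comp_lin, comp_lin, LinearMap.comp_apply]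
  refine Eq.trans ?_ (pair_lin hN hP hQ T (f ∘ₗ w.lin) g).symm
  rw [← LinearMap.comp_assoc]
  congr 1
  exact TensorProduct.ext' fun _ _ => rfl

lemma pair_whiskerRight (T : N ⟶ Q ⊗ P) (w : Q ⟶ Q') :
    pair hN hP hQ' (T ≫ w ▷ P) = dual P hP ◁ dualMap hQ hQ' w ≫ pair hN hP hQ T := by
  refine pair_ext fun f g => ?_
  rw [pair_lin, comp_lin, comp_lin, LinearMap.comp_apply]
  refine Eq.trans ?_ (pair_lin hN hP hQ T f (g ∘ₗ w.lin)).symm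
  rw [← LinearMap.comp_assoc]
  congr 1
  exact TensorProduct.ext' fun _ _ => rfl

/-- Both sides send f ⊗ g ⊗ r to r ⊗ g ⊗ f composed with a twofold cut, and `h` says that the two
cuts agree. -/
lemma pair_assoc (U : M ⟶ Q ⊗ P) (T : N ⟶ R ⊗ M) (U' : M' ⟶ R ⊗ Q) (T' : N ⟶ M' ⊗ P)
    (h : T ≫ R ◁ U ≫ (α_ R Q P).inv = T' ≫ U' ▷ P) :
    pair hM hP hQ U ▷ dual R hR ≫ pair hN hM hR T =
      (α_ _ _ _).hom ≫ dual P hP ◁ pair hM' hQ hR U' ≫ pair hN hP hM' T' := by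
  apply hom_ext
  refine TensorProduct.ext_threefold fun (f : Module.Dual k P) (g : Module.Dual k Q)
    (r : Module.Dual k R) => ?_
  have e1 := pair_lin hM hP hQ U f g
  have e2 := pair_lin hM' hQ hR U' g r
  refine Eq.trans (congrArg (fun y => (pair hN hM hR T).lin
    (tmul (V := dual M hM) (W := dual R hR) y r)) e1) ?_
  refine Eq.trans ?_ (congrArg (fun y => (pair hN hP hM' T').lin
    (tmul (V := dual P hP) (W := dual M' hM') f y)) e2).symm
  refine (pair_lin hN hM hR T _ r).trans (Eq.trans ?_ (pair_lin hN hP hM' T' f _).symm)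
  have a1 : tensorDual r (tensorDual g f ∘ₗ U.lin) =
      tensorDual (tensorDual r g) f ∘ₗ (R ◁ U ≫ (α_ R Q P).inv).lin := by
    refine TensorProduct.ext' fun y x => ?_
    change r y * tensorDual g f (U.lin x) = tensorDual (tensorDual r g) f
      ((TensorProduct.assoc k R Q P).symm (y ⊗ₜ U.lin x))
    generalize U.lin x = t
    revert t
    change ∀ t : Q ⊗[k] P, _
    intro t
    induction t with
    | zero => simp
    | add a b ha hb => simp only [map_add, TensorProduct.tmul_add, mul_add, ha, hb]
    | tmul a b => exact (mul_assoc _ _ _).symm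
  have a2 : tensorDual (tensorDual r g ∘ₗ U'.lin) f =
      tensorDual (tensorDual r g) f ∘ₗ (U' ▷ P).lin :=
    TensorProduct.ext' fun _ _ => rfl
  refine LinearMap.ext fun x => ?_
  have h' := congrArg (fun w => tensorDual (tensorDual r g) f (w.lin x)) h
  exact (LinearMap.congr_fun a1 (T.lin x)).trans (h'.trans (LinearMap.congr_fun a2 (T'.lin x)).symm)

/-- The action on the dual of `Q` uses S and the coaction on the dual of `P` uses S⁻¹. They cancel
when f₍₋₁₎ acts on `g`, which leaves g(x₍₋₁₎ y) f(x₍₀₎), the transpose of the original braiding. -/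
lemma braid_pair (T : N ⟶ P ⊗ Q) :
    braid (dual P hP) (dual Q hQ) ≫ pair hN hQ hP T = pair hN hP hQ (T ≫ braid P Q) := by
  refine pair_ext fun f g => LinearMap.ext fun z => ?_
  let D : (Module.Dual k Q ⊗[k] Module.Dual k P) ⊗[k] (P ⊗[k] Q) →ₗ[k] k := (doubleEv hQ hP).lin
  have hD : ∀ f g x y, D ((g ⊗ₜ f) ⊗ₜ (x ⊗ₜ y)) = f x * g y := fun f g x y =>
    doubleEv_lin hQ hP g f (x ⊗ₜ y)
  have key : ∀ s : P ⊗[k] Q, D (TensorProduct.map ((dualAct Q).toLinearMap.flip g) LinearMap.id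
      (dualCoact hP f) ⊗ₜ s) = LinearMap.mul' k k (TensorProduct.map g f
        (braidLin k P.coact Q.act s)) := by
    intro s
    induction s with
    | zero => simp
    | add a b ha hb => simp only [map_add, TensorProduct.tmul_add, ha, hb]
    | tmul x y =>
      have e : ∀ t : H ⊗[k] Module.Dual k P,
          D (TensorProduct.map ((dualAct Q).toLinearMap.flip g) LinearMap.id t ⊗ₜ (x ⊗ₜ y)) =
            g (Q.act (antipode k (contract k H P t x)) y) := by
        intro t
        induction t with
        | zero => simp
        | add a b ha hb =>
          simp only [map_add, TensorProduct.add_tmul, LinearMap.add_apply, ha, hb]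
        | tmul a b => simp [hD]
      rw [e, contract_dualCoact, braidLin_tmul]
      generalize P.coact x = t
      induction t with
      | zero => simp
      | add a b ha hb => simp only [map_add, LinearMap.add_apply, ha, hb]
      | tmul a b => simp [mul_comm]
  have e1 : (braid (dual P hP) (dual Q hQ)).lin (tmul (V := dual P hP) (W := dual Q hQ) f g) =
      TensorProduct.map ((dualAct Q).toLinearMap.flip g) LinearMap.id (dualCoact hP f) :=
    braidLin_tmul (dual P hP) (dual Q hQ) f g
  have e2 := key (T.lin z)
  rw [← e1] at e2
  exact e2.trans (LinearMap.congr_fun (pair_lin hN hP hQ (T ≫ braid P Q) f g) z).symm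

end Pair

end YetterDrinfeld

namespace YetterDrinfeld

/-! ### From degreewise products to a monoid in cochain complexes. -/

section Algebra

variable {k : Type u} [Field k] {H : Type v} [Ring H] [HopfAlgebra k H]

/-- The components of the structure of a differential graded algebra. -/
structure DGAlgebraData (C : CochainComplex (YetterDrinfeld k H) ℕ) where
  one : 𝟙_ (YetterDrinfeld k H) ⟶ C.X 0
  mul : ∀ (p q n : ℕ), p + q = n → (C.X p ⊗ C.X q ⟶ C.X n)
  one_d : one ≫ C.d 0 1 = 0
  leibniz : ∀ (p q n : ℕ) (h : p + q = n), mul p q n h ≫ C.d n (n + 1) =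
    C.d p (p + 1) ▷ C.X q ≫ mul (p + 1) q (n + 1) (by omega) +
      (-1 : ℤˣ) ^ p • (C.X p ◁ C.d q (q + 1) ≫ mul p (q + 1) (n + 1) (by omega))
  one_mul : ∀ n, (λ_ (C.X n)).inv ≫ one ▷ C.X n ≫ mul 0 n n (Nat.zero_add n) = 𝟙 _
  mul_one : ∀ n, (ρ_ (C.X n)).inv ≫ C.X n ◁ one ≫ mul n 0 n (Nat.add_zero n) = 𝟙 _
  mul_assoc : ∀ (p q r a b n : ℕ) (h₁ : p + q = a) (h₂ : q + r = b) (h₃ : a + r = n),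
    mul p q a h₁ ▷ C.X r ≫ mul a r n h₃ =
      (α_ _ _ _).hom ≫ C.X p ◁ mul q r b h₂ ≫ mul p b n (by omega)

namespace DGAlgebraData

variable {C : CochainComplex (YetterDrinfeld k H) ℕ} (D : DGAlgebraData C)

/-- The multiplication in degree `n`. -/
noncomputable def mulX (n : ℕ) : (HomologicalComplex.tensorObj C C).X n ⟶ C.X n :=
  HomologicalComplex.mapBifunctorDesc fun p q h => D.mul p q n h

lemma ι_mulX (p q n : ℕ) (h : p + q = n) :
    HomologicalComplex.ιTensorObj C C p q n h ≫ D.mulX n = D.mul p q n h :=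
  HomologicalComplex.ι_mapBifunctorDesc _ _ _ _

/-- The multiplication. -/
noncomputable def mulHom : C ⊗ C ⟶ C where
  f n := D.mulX n
  comm' i j hij := by
    change i + 1 = j at hij
    subst hij
    change D.mulX i ≫ C.d i (i + 1) = (HomologicalComplex.tensorObj C C).d i (i + 1) ≫ D.mulX (i + 1)
    refine HomologicalComplex.mapBifunctor.hom_ext fun p q h => ?_
    change p + q = i at h
    change HomologicalComplex.ιTensorObj C C p q i h ≫ _ =
      HomologicalComplex.ιTensorObj C C p q i h ≫ _
    rw [← Category.assoc, ← Category.assoc, ι_mulX, ι_d C C p q i (i + 1) h rfl,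
      Preadditive.add_comp, Linear.units_smul_comp, Category.assoc, Category.assoc, ι_mulX, ι_mulX,
      D.leibniz]

lemma ι_mulHom (p q n : ℕ) (h : p + q = n) :
    HomologicalComplex.ιTensorObj C C p q n h ≫ D.mulHom.f n = D.mul p q n h :=
  D.ι_mulX p q n h

/-- The unit. -/
noncomputable def oneHom : 𝟙_ (CochainComplex (YetterDrinfeld k H) ℕ) ⟶ C :=
  HomologicalComplex.mkHomFromSingle D.one (by
    rintro j (rfl : 0 + 1 = j)
    exact D.one_d)

lemma oneHom_f : D.oneHom.f 0 =
    (HomologicalComplex.singleObjXSelf (ComplexShape.up ℕ) 0 (𝟙_ (YetterDrinfeld k H))).hom ≫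
      D.one :=
  HomologicalComplex.mkHomFromSingle_f _ _

lemma ι_whiskerRight {K K' L : CochainComplex (YetterDrinfeld k H) ℕ} (f : K ⟶ K')
    (p q n : ℕ) (h : p + q = n) :
    HomologicalComplex.ιTensorObj K L p q n h ≫ (f ▷ L).f n =
      f.f p ▷ L.X q ≫ HomologicalComplex.ιTensorObj K' L p q n h := by
  refine (HomologicalComplex.ι_mapBifunctorMap f (𝟙 L) (curriedTensor _) (ComplexShape.up ℕ)
    p q n h).trans ?_
  change f.f p ▷ L.X q ≫ K'.X p ◁ (𝟙 (L.X q)) ≫ _ = _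
  rw [MonoidalCategory.whiskerLeft_id, Category.id_comp]

lemma ι_whiskerLeft {K L L' : CochainComplex (YetterDrinfeld k H) ℕ} (f : L ⟶ L')
    (p q n : ℕ) (h : p + q = n) :
    HomologicalComplex.ιTensorObj K L p q n h ≫ (K ◁ f).f n =
      K.X p ◁ f.f q ≫ HomologicalComplex.ιTensorObj K L' p q n h := by
  refine (HomologicalComplex.ι_mapBifunctorMap (𝟙 K) f (curriedTensor _) (ComplexShape.up ℕ)
    p q n h).trans ?_
  change (𝟙 (K.X p)) ▷ L.X q ≫ K.X p ◁ f.f q ≫ _ = _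
  rw [MonoidalCategory.id_whiskerRight, Category.id_comp]

lemma one_mulHom : D.oneHom ▷ C ≫ D.mulHom = (λ_ C).hom := by
  -- The inverse unitor is the inclusion of a single summand, so after this cancellation only one
  -- component of the product is left.
  rw [← cancel_epi (λ_ C).inv, Iso.inv_hom_id]
  ext n : 1
  change (HomologicalComplex.leftUnitor' C).inv n ≫ (D.oneHom ▷ C).f n ≫ D.mulHom.f n = 𝟙 _
  rw [HomologicalComplex.leftUnitor'_inv, Category.assoc, Category.assoc, ← Category.assoc
    (HomologicalComplex.ιTensorObj _ _ _ _ _ _), ι_whiskerRight, Category.assoc, ι_mulHom, oneHom_f,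
    MonoidalCategory.comp_whiskerRight, Category.assoc, ← Category.assoc (_ ▷ _) (_ ▷ _),
    ← MonoidalCategory.comp_whiskerRight, Iso.inv_hom_id, MonoidalCategory.id_whiskerRight,
    Category.id_comp, D.one_mul]

lemma mul_oneHom : C ◁ D.oneHom ≫ D.mulHom = (ρ_ C).hom := by
  rw [← cancel_epi (ρ_ C).inv, Iso.inv_hom_id]
  ext n : 1
  change (HomologicalComplex.rightUnitor' C).inv n ≫ (C ◁ D.oneHom).f n ≫ D.mulHom.f n = 𝟙 _
  rw [HomologicalComplex.rightUnitor'_inv, Category.assoc, Category.assoc, ← Category.assoc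
    (HomologicalComplex.ιTensorObj _ _ _ _ _ _), ι_whiskerLeft, Category.assoc, ι_mulHom, oneHom_f,
    MonoidalCategory.whiskerLeft_comp, Category.assoc, ← Category.assoc (_ ◁ _) (_ ◁ _),
    ← MonoidalCategory.whiskerLeft_comp, Iso.inv_hom_id, MonoidalCategory.whiskerLeft_id,
    Category.id_comp, D.mul_one]

lemma mulHom_assoc : D.mulHom ▷ C ≫ D.mulHom = (α_ C C C).hom ≫ C ◁ D.mulHom ≫ D.mulHom := by
  ext n : 1
  -- In each degree the associator is that of graded objects, so associativity is checked on the
  -- summands with fixed `p`, `q`, `r`.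
  refine GradedObject.Monoidal.tensorObj₃'_ext (X₁ := C.X) (X₂ := C.X) (X₃ := C.X) _ _
    fun p q r h => ?_
  let J' : (C.X p ⊗ C.X q) ⊗ C.X r ⟶ ((C ⊗ C) ⊗ C).X n :=
    HomologicalComplex.ιTensorObj C C p q (p + q) rfl ▷ C.X r ≫
      HomologicalComplex.ιTensorObj (C ⊗ C) C (p + q) r n h
  let J : C.X p ⊗ C.X q ⊗ C.X r ⟶ (C ⊗ C ⊗ C).X n :=
    C.X p ◁ HomologicalComplex.ιTensorObj C C q r (q + r) rfl ≫
      HomologicalComplex.ιTensorObj C (C ⊗ C) p (q + r) n ((Nat.add_assoc p q r).symm.trans h)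
  have e1 : GradedObject.Monoidal.ιTensorObj₃' C.X C.X C.X p q r n h = J' :=
    GradedObject.Monoidal.ιTensorObj₃'_eq _ _ _ p q r n h _ rfl
  have e2 : GradedObject.Monoidal.ιTensorObj₃ C.X C.X C.X p q r n h = J :=
    GradedObject.Monoidal.ιTensorObj₃_eq _ _ _ p q r n h _ rfl
  have e3 : J' ≫ (α_ C C C).hom.f n = (α_ _ _ _).hom ≫ J := by
    have := GradedObject.Monoidal.ιTensorObj₃'_associator_hom C.X C.X C.X p q r n h
    rw [e1, e2] at this
    exact this
  have l : J' ≫ (D.mulHom ▷ C).f n ≫ D.mulHom.f n =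
      D.mul p q _ rfl ▷ C.X r ≫ D.mul (p + q) r n h := by
    rw [Category.assoc, ← Category.assoc (HomologicalComplex.ιTensorObj _ _ _ _ _ _),
      ι_whiskerRight, Category.assoc, ι_mulHom, ← Category.assoc,
      ← MonoidalCategory.comp_whiskerRight, ι_mulHom]
  have r : J' ≫ (α_ C C C).hom.f n ≫ (C ◁ D.mulHom).f n ≫ D.mulHom.f n =
      (α_ _ _ _).hom ≫ C.X p ◁ D.mul q r _ rfl ≫ D.mul p (q + r) n (by omega) := by
    rw [← Category.assoc, e3, Category.assoc, Category.assoc, ← Category.assoc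
      (HomologicalComplex.ιTensorObj _ _ _ _ _ _), ι_whiskerLeft, Category.assoc, ι_mulHom,
      ← Category.assoc (_ ◁ _) (_ ◁ _), ← MonoidalCategory.whiskerLeft_comp, ι_mulHom]
  rw [e1]
  exact l.trans ((D.mul_assoc p q _ _ _ n rfl rfl h).trans r.symm)

/-- The monoid in cochain complexes. -/
noncomputable abbrev monObj : MonObj C where
  one := D.oneHom
  mul := D.mulHom
  one_mul := D.one_mulHom
  mul_one := D.mul_oneHom
  mul_assoc := D.mulHom_assoc

end DGAlgebraData

end Algebra

end YetterDrinfeld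

namespace YetterDrinfeld

set_option linter.unusedSectionVars false

open Prebraiding

/-! ### The cochain algebra of `A` and its homotopy. -/

section BarCochain

variable {k : Type u} [Field k] {H : Type v} [Ring H] [HopfAlgebra k H]
  (A : YetterDrinfeld k H) [MonObj A] [ComonObj A]

/-- The two faces on one letter coincide and have opposite signs. This makes the unit of the cochain
algebra a cocycle. -/
lemma barDifferential_zero : barDifferential A 0 = 0 := by
  rw [barDifferential_eq]
  change counitLast A 0 + (-1 : ℤ) • counitLast A 0 = 0
  rw [neg_one_zsmul]
  exact add_neg_cancel _

lemma finite_S {k : Type u} [Field k] {H : Type v} [Ring H] [HopfAlgebra k H]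
    (A : YetterDrinfeld k H) [Module.Finite k A] (n : ℕ) : Module.Finite k (S A n) := by
  induction n with
  | zero => exact Module.Finite.self k
  | succ n ih => exact Module.Finite.tensorProduct k (S A n) A

variable {A} (hA : IsBimonoid A) (hd : ∀ n, Dualizable (S A n))

/-- The cochain complex `Hom(S_•(A), k)`. -/
noncomputable def barCochain : CochainComplex (YetterDrinfeld k H) ℕ :=
  CochainComplex.of (fun n => dual (S A n) (hd n))
    (fun n => dualMap (hd (n + 1)) (hd n) (barDifferential A n)) (fun n => by
      rw [← dualMap_comp, barDifferential_comp n hA.counit_mul, dualMap_zero])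

lemma barCochain_d (n : ℕ) : (barCochain hA hd).d n (n + 1) =
    dualMap (hd (n + 1)) (hd n) (barDifferential A n) :=
  CochainComplex.of_d (fun n => dual (S A n) (hd n))
    (fun n => dualMap (hd (n + 1)) (hd n) (barDifferential A n)) n

/-- The opposite cup product in given degrees. -/
noncomputable def cup (p q n : ℕ) :
    dual (S A p) (hd p) ⊗ dual (S A q) (hd q) ⟶ dual (S A n) (hd n) :=
  (-1 : ℤ) ^ (p * q) • pair (hd n) (hd p) (hd q) (decon A n q p)

/-- The transpose of `barDifferential_decon`. The factor (-1)^(pq) in `cup` converts the sign (-1)^q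
on the differential of S_p into (-1)^p on the differential of the second cochain factor. -/
lemma cup_dualMap (p q n : ℕ) (h : p + q = n) :
    cup hd p q n ≫ dualMap (hd (n + 1)) (hd n) (barDifferential A n) =
      dualMap (hd (p + 1)) (hd p) (barDifferential A p) ▷ dual (S A q) (hd q) ≫
          cup hd (p + 1) q (n + 1) +
        (-1 : ℤˣ) ^ p • (dual (S A p) (hd p) ◁
          dualMap (hd (q + 1)) (hd q) (barDifferential A q) ≫ cup hd p (q + 1) (n + 1)) := by
  simp only [cup, Preadditive.zsmul_comp, Preadditive.comp_zsmul, ← pair_comp, ← pair_whiskerLeft,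
    ← pair_whiskerRight]
  rw [barDifferential_decon p q n (by omega), pair_add, pair_zsmul, Units.smul_def]
  push_cast
  simp only [Nat.add_mul, Nat.mul_add, pow_add, Nat.one_mul, Nat.mul_one]
  rcases neg_one_pow_eq_or ℤ p with h1 | h1 <;> rcases neg_one_pow_eq_or ℤ q with h2 | h2 <;>
    rw [h1, h2] <;> module

/-- The unit of the cochain algebra. -/
noncomputable def cupUnit : 𝟙_ (YetterDrinfeld k H) ⟶ dual (S A 0) (hd 0) :=
  dualLift (hd 0) (λ_ (𝟙_ (YetterDrinfeld k H))).hom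

lemma cupUnit_cup (n : ℕ) :
    (λ_ _).inv ≫ cupUnit hd ▷ dual (S A n) (hd n) ≫ cup hd 0 n n = 𝟙 _ := by
  apply hom_ext
  refine LinearMap.ext fun (f : Module.Dual k (S A n)) => ?_
  have e : cup hd 0 n n = pair (hd n) (hd 0) (hd n) (splitUnit A n) := by
    rw [cup, Nat.zero_mul, pow_zero, one_smul, decon_self]
  rw [e]
  refine (pair_lin (hd n) (hd 0) (hd n) (splitUnit A n) ((cupUnit hd).lin (1 : k)) f).trans ?_
  refine LinearMap.ext fun v => ?_
  change f v * ((1 : k) * (1 : k)) = _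
  rw [mul_one, mul_one]
  rfl

lemma cup_cupUnit (n : ℕ) :
    (ρ_ _).inv ≫ dual (S A n) (hd n) ◁ cupUnit hd ≫ cup hd n 0 n = 𝟙 _ := by
  apply hom_ext
  refine LinearMap.ext fun (f : Module.Dual k (S A n)) => ?_
  have e : cup hd n 0 n = pair (hd n) (hd n) (hd 0) (λ_ (S A n)).inv := by
    rw [cup, Nat.mul_zero, pow_zero, one_smul, decon_zero]
  rw [e]
  refine (pair_lin (hd n) (hd n) (hd 0) (λ_ (S A n)).inv f ((cupUnit hd).lin (1 : k))).trans ?_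
  refine LinearMap.ext fun v => ?_
  change ((1 : k) * (1 : k)) * f v = _
  rw [one_mul, one_mul]
  rfl

lemma cup_assoc (p q r a b n : ℕ) (h₁ : p + q = a) (h₂ : q + r = b) (h₃ : a + r = n) :
    cup hd p q a ▷ dual (S A r) (hd r) ≫ cup hd a r n =
      (α_ _ _ _).hom ≫ dual (S A p) (hd p) ◁ cup hd q r b ≫ cup hd p b n := by
  obtain rfl : a = q + p := by omega
  obtain rfl : b = r + q := by omega
  obtain rfl : n = r + q + p := by omega
  simp only [cup, zsmul_whiskerRight, whiskerLeft_zsmul, Preadditive.zsmul_comp,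
    Preadditive.comp_zsmul]
  rw [pair_assoc (hd (q + p)) (hd (r + q)) (hd (r + q + p)) (hd p) (hd q) (hd r) _ _ _ _
    (decon_assoc r q p), smul_smul, smul_smul]
  congr 1
  ring

/-- The differential graded algebra `Hom(S_•(A), k)` with the opposite cup product. -/
noncomputable def barCochainData : DGAlgebraData (barCochain hA hd) where
  one := cupUnit hd
  mul p q n _ := cup hd p q n
  one_d := by
    rw [barCochain_d, barDifferential_zero, dualMap_zero]
    exact comp_zero
  leibniz p q n h := by
    rw [barCochain_d, barCochain_d, barCochain_d]
    exact cup_dualMap hd p q n h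
  one_mul := cupUnit_cup hd
  mul_one := cup_cupUnit hd
  mul_assoc := cup_assoc hd

/-- The components of the homotopy, on the summands of the tensor product. -/
noncomputable def cupHtpy (p q n : ℕ) :
    dual (S A p) (hd p) ⊗ dual (S A q) (hd q) ⟶ dual (S A n) (hd n) :=
  (-1 : ℤ) ^ p • pair (hd n) (hd p) (hd q) (cupOne A q p n)

/-- The homotopy between the product and the product with exchanged factors. -/
noncomputable def htpyX (i j : ℕ) :
    (HomologicalComplex.tensorObj (barCochain hA hd) (barCochain hA hd)).X i ⟶
      (barCochain hA hd).X j :=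
  if j + 1 = i then HomologicalComplex.mapBifunctorDesc fun p q _ => cupHtpy hd p q j else 0

lemma ι_htpyX (p q i j : ℕ) (h : p + q = i) (hij : j + 1 = i) :
    HomologicalComplex.ιTensorObj (barCochain hA hd) (barCochain hA hd) p q i h ≫ htpyX hA hd i j =
      cupHtpy hd p q j := by
  rw [htpyX, if_pos hij]
  exact HomologicalComplex.ι_mapBifunctorDesc _ _ _ _

/-- The sign of the graded braiding and the sign of the opposite cup product are both (-1)^(pq) and
cancel. -/
lemma braid_cup (p q n : ℕ) :
    (-1 : ℤˣ) ^ (p * q) • (braid (dual (S A p) (hd p)) (dual (S A q) (hd q)) ≫ cup hd q p n) =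
      pair (hd n) (hd p) (hd q) (decon A n p q ≫ braid (S A p) (S A q)) := by
  rw [cup, Preadditive.comp_zsmul, braid_pair, Units.smul_def, smul_smul, Nat.mul_comm q p]
  push_cast
  rw [← mul_pow, neg_one_mul, neg_neg, one_pow, one_smul]

/-- The transpose of `barDifferential_cupOne`. The sign (-1)^p in `cupHtpy` is the one that turns
its coefficients into those of the differential of the tensor product. -/
lemma cupHtpy_eq (hA : IsBimonoid A) (hd : ∀ n, Dualizable (S A n)) (p q n : ℕ) (h : p + q = n) :
    pair (hd n) (hd p) (hd q) (decon A n p q ≫ braid (S A p) (S A q)) =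
      dualMap (hd (p + 1)) (hd p) (barDifferential A p) ▷ dual (S A q) (hd q) ≫
          cupHtpy hd (p + 1) q n +
        (-1 : ℤˣ) ^ p • (dual (S A p) (hd p) ◁
          dualMap (hd (q + 1)) (hd q) (barDifferential A q) ≫ cupHtpy hd p (q + 1) n) +
      (-1 : ℤ) ^ p • pair (hd n) (hd p) (hd q) (barPrev (cupOne A q p) n) + cup hd p q n := by
  simp only [cup, cupHtpy, Preadditive.comp_zsmul, ← pair_whiskerLeft, ← pair_whiskerRight]
  have e := congrArg (pair (hd n) (hd p) (hd q))
    (barDifferential_cupOne hA q p n (by omega))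
  rw [pair_sub, pair_sub, pair_add, pair_zsmul, pair_zsmul, pair_zsmul] at e
  rw [← sub_eq_iff_eq_add, ← e, Units.smul_def]
  push_cast
  rw [pow_succ]
  rcases neg_one_pow_eq_or ℤ p with h1 | h1 <;> rw [h1] <;> module

lemma htpyX_comm (n : ℕ) :
    (gradedBraiding (barCochain hA hd) (barCochain hA hd) ≫ (barCochainData hA hd).mulHom).f n =
      dNext n (htpyX hA hd) + prevD n (htpyX hA hd) + (barCochainData hA hd).mulHom.f n := by
  refine HomologicalComplex.mapBifunctor.hom_ext fun p q h => ?_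
  change p + q = n at h
  set C := barCochain hA hd
  set D := barCochainData hA hd
  change HomologicalComplex.ιTensorObj C C p q n h ≫ (gradedBraidingX C C n ≫ D.mulHom.f n) =
    HomologicalComplex.ιTensorObj C C p q n h ≫ (_ + _ + D.mulHom.f n)
  have e1 : HomologicalComplex.ιTensorObj C C p q n h ≫ (gradedBraidingX C C n ≫ D.mulHom.f n) =
      pair (hd n) (hd p) (hd q) (decon A n p q ≫ braid (S A p) (S A q)) := by
    rw [← Category.assoc, ι_gradedBraidingX, Linear.units_smul_comp, Category.assoc, D.ι_mulHom]
    exact braid_cup hd p q n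
  have e2 : HomologicalComplex.ιTensorObj C C p q n h ≫ dNext n (htpyX hA hd) =
      dualMap (hd (p + 1)) (hd p) (barDifferential A p) ▷ dual (S A q) (hd q) ≫
          cupHtpy hd (p + 1) q n +
        (-1 : ℤˣ) ^ p • (dual (S A p) (hd p) ◁
          dualMap (hd (q + 1)) (hd q) (barDifferential A q) ≫ cupHtpy hd p (q + 1) n) := by
    rw [dNext_eq _ (show (ComplexShape.up ℕ).Rel n (n + 1) from rfl), ← Category.assoc,
      ι_d C C p q n (n + 1) h rfl, Preadditive.add_comp, Linear.units_smul_comp, Category.assoc,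
      Category.assoc, ι_htpyX hA hd _ _ _ _ _ rfl, ι_htpyX hA hd _ _ _ _ _ rfl, barCochain_d,
      barCochain_d]
    rfl
  have e3 : HomologicalComplex.ιTensorObj C C p q n h ≫ prevD n (htpyX hA hd) =
      (-1 : ℤ) ^ p • pair (hd n) (hd p) (hd q) (barPrev (cupOne A q p) n) := by
    cases n with
    | zero =>
      -- In degree 0 nothing precedes: the homotopy component vanishes by its default value, and so
      -- does `barPrev`.
      rw [prevD_nat, htpyX, if_neg (by omega), zero_comp, comp_zero]
      refine Eq.symm ((congrArg _ (map_zero (pairHom (hd 0) (hd p) (hd q)))).trans (zsmul_zero _))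
    | succ n =>
      rw [prevD_eq _ (show (ComplexShape.up ℕ).Rel n (n + 1) from rfl), ← Category.assoc,
        ι_htpyX hA hd _ _ _ _ _ rfl, barCochain_d, cupHtpy]
      change _ = _ • pair _ _ _ (barDifferential A n ≫ cupOne A q p n)
      rw [pair_comp]
      exact Preadditive.zsmul_comp _ _ _
  have e4 : HomologicalComplex.ιTensorObj C C p q n h ≫ D.mulHom.f n = cup hd p q n :=
    D.ι_mulHom p q n h
  rw [e1, Preadditive.comp_add, Preadditive.comp_add, e2, e3, e4]
  exact cupHtpy_eq hA hd p q n h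

/-- The product is homotopic to the product with exchanged factors. -/
noncomputable def cupHomotopy : Homotopy
    (gradedBraiding (barCochain hA hd) (barCochain hA hd) ≫ (barCochainData hA hd).mulHom)
    (barCochainData hA hd).mulHom where
  hom := htpyX hA hd
  zero _ _ hij := if_neg hij
  comm := htpyX_comm hA hd

end BarCochain

lemma neg_one_zsmul_lin {k : Type u} [Field k] {H : Type v} [Ring H] [HopfAlgebra k H]
    {V W : YetterDrinfeld k H} (n : ℕ) (f : V ⟶ W) :
    ((-1 : ℤ) ^ n • f).lin = (-1 : k) ^ n • f.lin := by
  rcases Nat.even_or_odd n with h | h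
  · rw [h.neg_one_pow, h.neg_one_pow, one_smul, one_smul]
  · rw [h.neg_one_pow, h.neg_one_pow, neg_one_zsmul, neg_lin, neg_one_smul]

/-- All tensor powers of `A` are dualizable under the finiteness assumption. -/
lemma dualizable_S {k : Type u} [Field k] {H : Type v} [Ring H] [HopfAlgebra k H]
    (A : YetterDrinfeld k H)
    (hfin : Module.Finite k H ∨
      (Module.Finite k A ∧ Function.Bijective (HopfAlgebra.antipode k (A := H)))) (n : ℕ) :
    Dualizable (S A n) := by
  rcases hfin with h | ⟨h, hS⟩
  · exact ⟨antipode_bijective_of_finite, Or.inl h⟩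
  · exact ⟨hS, Or.inr (finite_S A n)⟩

end YetterDrinfeld

theorem mainTheorem5 {k : Type u} [Field k] {H : Type v} [Ring H] [HopfAlgebra k H]
    (A : YetterDrinfeld k H) [MonObj A] [ComonObj A] (hA : YetterDrinfeld.IsBimonoid A)
    (hfin : Module.Finite k H ∨
      (Module.Finite k A ∧ Function.Bijective (HopfAlgebra.antipode k (A := H)))) :
    ∃ (C : CochainComplex (YetterDrinfeld k H) ℕ) (_ : MonObj C)
      (e : ∀ n, C.X n ≃ₗ[k] Module.Dual k (YetterDrinfeld.S A n)),
      (∀ n, ∃ ev : C.X n ⊗ YetterDrinfeld.S A n ⟶ 𝟙_ (YetterDrinfeld k H),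
        YetterDrinfeld.IsInternalDual ev ∧
          ∀ f x, YetterDrinfeld.toDual ev (YetterDrinfeld.tmul f x) = e n f x) ∧
      (∀ n f, e (n + 1) ((C.d n (n + 1)).lin f) =
        e n f ∘ₗ (YetterDrinfeld.barDifferential A n).lin) ∧
      (∀ x : k, e 0 (((HomologicalComplex.singleObjXSelf (ComplexShape.up ℕ) 0
        (𝟙_ (YetterDrinfeld k H))).inv ≫ (MonObj.one (X := C)).f 0).lin (1 : k)) x = x) ∧
      (∀ p q f g, e (q + p) ((HomologicalComplex.ιTensorObj C C p q (q + p) (Nat.add_comm p q) ≫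
          (MonObj.mul (X := C)).f (q + p)).lin (YetterDrinfeld.tmul f g)) =
        (-1 : k) ^ (p * q) •
          (YetterDrinfeld.tensorDual (e q g) (e p f) ∘ₗ (YetterDrinfeld.dec A q p).lin)) ∧
      Nonempty (Homotopy (YetterDrinfeld.gradedBraiding C C ≫ MonObj.mul)
        (MonObj.mul (X := C))) := by
  have hd := YetterDrinfeld.dualizable_S A hfin
  let C := YetterDrinfeld.barCochain hA hd
  let D := YetterDrinfeld.barCochainData hA hd
  -- The objects of `C` have the full linear duals as underlying spaces, so the comparison maps are
  -- identities.
  refine ⟨C, D.monObj, fun n => LinearEquiv.refl k (Module.Dual k (YetterDrinfeld.S A n)),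
    fun n => ⟨YetterDrinfeld.dualEv (YetterDrinfeld.S A n) (hd n),
      YetterDrinfeld.isInternalDual_dualEv (hd n), fun f x => rfl⟩, fun n f => ?_, fun x => ?_,
    fun p q f g => ?_, ⟨YetterDrinfeld.cupHomotopy hA hd⟩⟩
  · have e := YetterDrinfeld.barCochain_d hA hd n
    exact LinearMap.congr_fun (congrArg YetterDrinfeld.Hom.lin e) f
  · have e : (HomologicalComplex.singleObjXSelf (ComplexShape.up ℕ) 0
        (𝟙_ (YetterDrinfeld k H))).inv ≫ D.oneHom.f 0 = YetterDrinfeld.cupUnit hd := by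
      rw [D.oneHom_f, Iso.inv_hom_id_assoc]
      rfl
    have e' := LinearMap.congr_fun (congrArg YetterDrinfeld.Hom.lin e) (1 : k)
    exact (congrArg (fun φ : Module.Dual k k => φ x) e').trans (one_mul x)
  · have e : HomologicalComplex.ιTensorObj C C p q (q + p) (Nat.add_comm p q) ≫
        D.mulHom.f (q + p) = YetterDrinfeld.cup hd p q (q + p) :=
      D.ι_mulHom p q (q + p) (Nat.add_comm p q)
    have e' := LinearMap.congr_fun (congrArg YetterDrinfeld.Hom.lin e)
      (YetterDrinfeld.tmul (V := C.X p) (W := C.X q) f g)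
    refine Eq.trans e' ?_
    rw [YetterDrinfeld.cup, YetterDrinfeld.neg_one_zsmul_lin, YetterDrinfeld.decon_add]
    exact congrArg (fun φ => (-1 : k) ^ (p * q) • φ)
      (YetterDrinfeld.pair_lin (hd (q + p)) (hd p) (hd q) (YetterDrinfeld.dec A q p) f g)
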